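/- Let $\nu\in\{2,3\}$, $\rho>0$, $a\ge 2\rho$, and let $V\in L^2(0,\rho)$ be real-valued. For a sequence of points $Y=(y_i)_{i\in\mathbb Z}$ in $\mathbb R^\nu$ with $|y_i-y_j|\ge 2\rho$ for $i\ne j$, let $$H_{V,Y}=-\Delta-\sum_{i\in\mathbb Z}V_i,\qquad V_i(x)=V(|x-y_i|)\ \text{ for } |x-y_i|<\rho,\quad V_i(x)=0\ \text{ otherwise},$$ be the Schrödinger operator in $L^2(\mathbb R^\nu)$, self-adjoint on $H^2(\mathbb R^\nu)$. Its essential spectrum $\sigma_{\mathrm{ess}}(H_{V,Y})$ is the spectrum without the discrete spectrum, i.e. without the isolated points of the spectrum that are eigenvalues of finite multiplicity. Let $\Gamma:\mathbb R\to\mathbb R^\nu$ be a continuous, piecewise $C^1$ curve parametrized by arc length, $|\dot\Gamma|=1$, and let $Y$ consist of the points $y_i=\Gamma(ia)$, $i\in\mathbb Z$. Suppose that $|y_i-y_j|\ge 2\rho$ for all $i\neq j$, that $\Gamma$ is straight outside a compact set (there is $S$ such that $\Gamma$ is affine on $[S,\infty)$ and on $(-\infty,-S]$), and that $|\Gamma(s)-\Gamma(-s)|\to\infty$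 as $|s|\to\infty$. Then $$\sigma_{\mathrm{ess}}(H_{V,Y})=\sigma_{\mathrm{ess}}(H_{V,Y_0})$$ for every straight equidistant chain $Y_0=(p+ia\,e)_{i\in\mathbb Z}$ with $p,e\in\mathbb R^\nu$, $|e|=1$. -/

import Mathlib

open MeasureTheory Filter
open scoped SchwartzMap Laplacian

noncomputable section

namespace BentChain

/-! ### Spectra of unbounded operators -/

section Spectrum

variable {X : Type*} [NormedAddCommGroup X] [NormedSpace ℂ X]

/-- The resolvent set of an operator `T` with domain `T.domain`: those `z` for which
`T - z : T.domain → X` has an everywhere defined bounded two-sided inverse `R`. -/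
def resolventSet (T : X →ₗ.[ℂ] X) : Set ℂ :=
  {z | ∃ R : X →L[ℂ] X,
    (∀ f : X, ∃ h : R f ∈ T.domain, T ⟨R f, h⟩ - z • R f = f) ∧
    ∀ ψ : T.domain, R (T ψ - z • (ψ : X)) = ψ}

/-- The spectrum `σ(T)`. -/
def spectrum (T : X →ₗ.[ℂ] X) : Set ℂ := (resolventSet T)ᶜ

/-- The eigenspace `ker (T - z)`, as a subspace of the domain of `T`. -/
def eigenspace (T : X →ₗ.[ℂ] X) (z : ℂ) : Submodule ℂ T.domain :=
  LinearMap.ker (T.toFun - z • T.domain.subtype)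

/-- The discrete spectrum of a self-adjoint operator: the isolated points of the spectrum that are
eigenvalues of finite multiplicity. -/
def discreteSpectrum (T : X →ₗ.[ℂ] X) : Set ℂ :=
  {z | z ∈ spectrum T ∧ (∃ ε > 0, ∀ w ∈ spectrum T, dist w z < ε → w = z) ∧
    eigenspace T z ≠ ⊥ ∧ FiniteDimensional ℂ (eigenspace T z)}

/-- The essential spectrum `σ_ess(T) = σ(T) \ σ_disc(T)` of a self-adjoint operator. -/
def essentialSpectrum (T : X →ₗ.[ℂ] X) : Set ℂ := spectrum T \ discreteSpectrum T

end Spectrum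

/-! ### Schrödinger operators in `L²(ℝ^ν)` -/

/-- `ℝ^ν` with the Euclidean norm. -/
abbrev Space (ν : ℕ) : Type := EuclideanSpace ℝ (Fin ν)

/-- The Hilbert space `L²(ℝ^ν)` of complex-valued functions. -/
abbrev L2 (ν : ℕ) : Type := Lp ℂ 2 (volume : Measure (Space ν))

/-- The embedding of `L²(ℝ^ν)` into the tempered distributions. -/
def toDistribution (ν : ℕ) : L2 ν →ₗ[ℂ] 𝓢'(Space ν, ℂ) :=
  (Lp.toTemperedDistributionCLM ℂ (volume : Measure (Space ν)) 2).toLinearMap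

theorem toDistribution_injective (ν : ℕ) : Function.Injective (toDistribution ν) :=
  LinearMap.ker_eq_bot.mp Lp.ker_toTemperedDistributionCLM_eq_bot

/-- The Sobolev space `H²(ℝ^ν)` as a subspace of `L²(ℝ^ν)`. -/
def sobolevH2 (ν : ℕ) : Submodule ℂ (L2 ν) where
  carrier := {ψ | TemperedDistribution.MemSobolev 2 2 (toDistribution ν ψ)}
  zero_mem' := by simp
  add_mem' := by
    intro f g hf hg
    simpa using TemperedDistribution.MemSobolev.add hf hg
  smul_mem' := by
    intro c f hf
    simpa using TemperedDistribution.MemSobolev.smul c hf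

/-- The distributional Laplacian on `H²(ℝ^ν)`, as a linear map into the tempered distributions. -/
def distLaplacian (ν : ℕ) : sobolevH2 ν →ₗ[ℂ] 𝓢'(Space ν, ℂ) :=
  (LineDeriv.laplacianCLM ℂ (Space ν) 𝓢'(Space ν, ℂ)).toLinearMap ∘ₗ
    toDistribution ν ∘ₗ (sobolevH2 ν).subtype

theorem distLaplacian_apply {ν : ℕ} (ψ : sobolevH2 ν) :
    distLaplacian ν ψ = Δ (toDistribution ν ψ) :=
  TemperedDistribution.laplacianCLM_apply _

theorem distLaplacian_mem_range {ν : ℕ} (ψ : sobolevH2 ν) :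
    distLaplacian ν ψ ∈ LinearMap.range (toDistribution ν) := by
  have h : TemperedDistribution.MemSobolev (2 - 2) 2 (Δ (toDistribution ν ψ)) :=
    TemperedDistribution.MemSobolev.laplacian ψ.2
  rw [sub_self, TemperedDistribution.memSobolev_zero_iff] at h
  obtain ⟨f, hf⟩ := h
  exact ⟨f, by rw [distLaplacian_apply, hf]; rfl⟩

/-- The operator `-Δ` in `L²(ℝ^ν)` with domain `H²(ℝ^ν)`. The value at `ψ` is the `L²` function that
represents the tempered distribution `-Δψ`, see `toDistribution_negLaplacian`. -/
def negLaplacian (ν : ℕ) : L2 ν →ₗ.[ℂ] L2 ν where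
  domain := sobolevH2 ν
  toFun := -((LinearEquiv.ofInjective (toDistribution ν)
      (toDistribution_injective ν)).symm.toLinearMap ∘ₗ
    LinearMap.codRestrict (LinearMap.range (toDistribution ν)) (distLaplacian ν)
      distLaplacian_mem_range)

theorem toDistribution_negLaplacian {ν : ℕ} (ψ : sobolevH2 ν) :
    toDistribution ν (negLaplacian ν ψ) = -Δ (toDistribution ν ψ) := by
  have h := congrArg Subtype.val
    ((LinearEquiv.ofInjective (toDistribution ν) (toDistribution_injective ν)).apply_symm_apply
      ⟨distLaplacian ν ψ, distLaplacian_mem_range ψ⟩)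
  rw [LinearEquiv.ofInjective_apply] at h
  refine (map_neg (toDistribution ν) _).trans (congrArg Neg.neg ?_)
  rw [← distLaplacian_apply]
  exact h

/-- The subspace `{ψ ∈ L² | q ψ ∈ L²}`. -/
def mulDomain {ν : ℕ} (q : Space ν → ℝ) : Submodule ℂ (L2 ν) where
  carrier := {ψ | MemLp (fun x => (q x : ℂ) * ψ x) 2 volume}
  zero_mem' := by
    refine MemLp.ae_eq (f := (0 : Space ν → ℂ)) ?_ MemLp.zero
    filter_upwards [Lp.coeFn_zero ℂ 2 (volume : Measure (Space ν))] with x hx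
    simp only [hx, Pi.zero_apply, mul_zero]
  add_mem' := by
    intro f g hf hg
    refine MemLp.ae_eq ?_ (MemLp.add hf hg)
    filter_upwards [Lp.coeFn_add f g] with x hx
    simp only [hx, Pi.add_apply, mul_add]
  smul_mem' := by
    intro c f hf
    refine MemLp.ae_eq ?_ (MemLp.const_smul hf c)
    filter_upwards [Lp.coeFn_smul c f] with x hx
    simp only [hx, Pi.smul_apply, smul_eq_mul]
    ring

/-- The product `q ψ` as an element of `L²`. -/
def mulFun {ν : ℕ} (q : Space ν → ℝ) (ψ : mulDomain q) : L2 ν :=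
  MemLp.toLp (fun x => (q x : ℂ) * (ψ : L2 ν) x) ψ.2

theorem coeFn_mulFun {ν : ℕ} (q : Space ν → ℝ) (ψ : mulDomain q) :
    mulFun q ψ =ᵐ[volume] fun x => (q x : ℂ) * (ψ : L2 ν) x :=
  MemLp.coeFn_toLp _

theorem mulFun_add {ν : ℕ} (q : Space ν → ℝ) (f g : mulDomain q) :
    mulFun q (f + g) = mulFun q f + mulFun q g := by
  refine Lp.ext ?_
  filter_upwards [coeFn_mulFun q (f + g), coeFn_mulFun q f, coeFn_mulFun q g,
    Lp.coeFn_add (mulFun q f) (mulFun q g), Lp.coeFn_add (f : L2 ν) (g : L2 ν)] with x h1 h2 h3 h4 h5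
  rw [h1, h4, Pi.add_apply, h2, h3, Submodule.coe_add, h5, Pi.add_apply, mul_add]

theorem mulFun_smul {ν : ℕ} (q : Space ν → ℝ) (c : ℂ) (f : mulDomain q) :
    mulFun q (c • f) = c • mulFun q f := by
  refine Lp.ext ?_
  filter_upwards [coeFn_mulFun q (c • f), coeFn_mulFun q f,
    Lp.coeFn_smul c (mulFun q f), Lp.coeFn_smul c (f : L2 ν)] with x h1 h2 h3 h4
  rw [h1, h3, Pi.smul_apply, h2, Submodule.coe_smul, h4, Pi.smul_apply, smul_eq_mul, smul_eq_mul]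
  ring

/-- The maximal operator of multiplication by the real function `q`, with domain
`{ψ ∈ L² | q ψ ∈ L²}`. -/
def mulOperator {ν : ℕ} (q : Space ν → ℝ) : L2 ν →ₗ.[ℂ] L2 ν where
  domain := mulDomain q
  toFun :=
    { toFun := mulFun q
      map_add' := mulFun_add q
      map_smul' := mulFun_smul q }

/-- The Schrödinger operator `-Δ - q` in `L²(ℝ^ν)`, as a sum of unbounded operators: its domain is
`{ψ ∈ H²(ℝ^ν) | q ψ ∈ L²(ℝ^ν)}`. (This is all of `H²(ℝ^ν)` when `ν ≤ 3` and `q` is uniformly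
locally square integrable.) -/
def schrodinger {ν : ℕ} (q : Space ν → ℝ) : L2 ν →ₗ.[ℂ] L2 ν :=
  negLaplacian ν - mulOperator q

/-! ### Chains of potential wells along a curve -/

/-- The radial well `x ↦ V(|x - y|)` cut off to the open ball `B_ρ(y)`. -/
def well {ν : ℕ} (V : ℝ → ℝ) (ρ : ℝ) (y : Space ν) : Space ν → ℝ :=
  (Metric.ball y ρ).indicator fun x => V (dist x y)

/-- The array potential `V_Y = ∑ᵢ Vᵢ`. For disjoint balls at most one summand is nonzero at each
point. -/
def arrayPotential {ν : ℕ} (V : ℝ → ℝ) (ρ : ℝ) (Y : ℤ → Space ν) (x : Space ν) : ℝ :=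
  ∑' i, well V ρ (Y i) x

/-- The operator `H_{V,Y} = -Δ - ∑ᵢ Vᵢ`. -/
def chainOperator {ν : ℕ} (V : ℝ → ℝ) (ρ : ℝ) (Y : ℤ → Space ν) : L2 ν →ₗ.[ℂ] L2 ν :=
  schrodinger (arrayPotential V ρ Y)

/-- The points of the curve `Γ` at the parameter values `i a`, `i ∈ ℤ`. -/
def chainPoints {ν : ℕ} (Γ : ℝ → Space ν) (a : ℝ) (i : ℤ) : Space ν := Γ (i * a)

/-- A continuous, piecewise `C¹` curve parametrized by arc length: there is a locally finite set `F`
of break points such that `Γ` is `C¹`, up to the end points, on every compact interval without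
break points inside, and `|Γ'| = 1` off `F`. -/
def IsUnitSpeedPiecewiseC1 {ν : ℕ} (Γ : ℝ → Space ν) : Prop :=
  Continuous Γ ∧ ∃ F : Set ℝ, (∀ u v : ℝ, (F ∩ Set.Icc u v).Finite) ∧
    (∀ u v : ℝ, u < v → Disjoint (Set.Ioo u v) F → ContDiffOn ℝ 1 Γ (Set.Icc u v)) ∧
    ∀ s ∉ F, ‖deriv Γ s‖ = 1

/-- The curve is straight outside a compact set: it is affine on `[S, ∞)` and on `(-∞, -S]` for some
`S`. -/
def IsStraightOutsideCompact {ν : ℕ} (Γ : ℝ → Space ν) : Prop :=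
  ∃ (S : ℝ) (p q u v : Space ν),
    (∀ s, S ≤ s → Γ s = p + s • u) ∧ ∀ s, s ≤ -S → Γ s = q + s • v

/-- The straight line through `p` with direction `e`. -/
def lineCurve {ν : ℕ} (p e : Space ν) (s : ℝ) : Space ν := p + s • e

end BentChain

end

/-! Both sides are identified with one set: the approximate eigenvalues, with Schwartz approximate
eigenfunctions, of a straight chain. This set does not depend on the position of the straight chain,
since `-Δ` is invariant under isometries.

Geometry. Let `u` and `v` be the velocities of `Γ` near `+∞` and `-∞`. Divergence of `|Γ(s) -
Γ(-s)|` forces `u + v ≠ 0`, and as both are unit vectors, the functional `L = ⟨u + v, ·⟩` is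
positive on `u` and on `v`. Hence `L` tends to `±∞` along the two ends of the chain, every slab `|L|
≤ M` meets finitely many wells, and for large `L` (for large `-L`) the potential is exactly that of
a straight chain in direction `u` (direction `v`).

From straight to bent (`IsRelativelyBounded.mem_essentialSpectrum`): an approximate eigenfunction of
the straight chain is cut off to a slab and translated by multiples of the period towards one end.
The translates have disjoint supports and equally small residuals, which excludes both the resolvent
set and the discrete spectrum.

From bent to straight (`IsRelativelyBounded.isApproxEigenvalue_or`): a point of the essential
spectrum has a weakly null singular sequence. It is split by a slowly varying partition of unity in
the variable `L`. The commutators are small because the cutoffs vary slowly; in the slab the change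
of potential is an `L²` function, whose effect vanishes by dominated convergence. One of the two
halves keeps a positive norm, so it is an approximate eigenfunction for one of the straight ends.

Analytic basis. The wells are merely `L²`. In dimension at most three the symbol of `(-Δ +
(2πk)²)⁻¹` is square integrable with norm tending to zero as `k → ∞`, so functions are bounded
pointwise by this norm times the `L²` norm of `(-Δ + (2πk)²) φ`. Localizing to the separated balls
gives a relative bound `1/2` for the whole array (`exists_isRelativelyBounded`). A Neumann series
then yields a bounded self-adjoint resolvent, and the continuous functional calculus of this
resolvent supplies the Weyl criterion for the unbounded operator. -/

noncomputable section

namespace BentChain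

open FourierTransform ENNReal
open scoped Real LineDeriv ContDiff

section FreeResolvent

/-! ### The free resolvent -/

/-- The symbol `4π²|ξ|² + (2πk)²` of `-Δ + (2πk)²`. -/
def freeSymbol {ν : ℕ} (k : ℝ) (ξ : Space ν) : ℝ := (2 * π) ^ 2 * ‖ξ‖ ^ 2 + (2 * π * k) ^ 2

/-- The symbol of `(-Δ + (2πk)²)⁻¹`. -/
def resolventSymbol {ν : ℕ} (k : ℝ) (ξ : Space ν) : ℝ := (freeSymbol k ξ)⁻¹

variable {ν : ℕ} {k : ℝ}

theorem freeSymbol_pos (hk : 0 < k) (ξ : Space ν) : 0 < freeSymbol k ξ := by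
  unfold freeSymbol; positivity

theorem resolventSymbol_pos (hk : 0 < k) (ξ : Space ν) : 0 < resolventSymbol k ξ :=
  inv_pos.mpr (freeSymbol_pos hk ξ)

theorem freeSymbol_mul_resolventSymbol (hk : 0 < k) (ξ : Space ν) :
    freeSymbol k ξ * resolventSymbol k ξ = 1 :=
  mul_inv_cancel₀ (freeSymbol_pos hk ξ).ne'

theorem hasTemperateGrowth_freeSymbol (k : ℝ) :
    (freeSymbol k : Space ν → ℝ).HasTemperateGrowth := by
  unfold freeSymbol; fun_prop

/-- A dilated copy of the weight `(1 + |ξ|²)⁻¹`, from which temperate growth is inherited. -/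
theorem resolventSymbol_eq (hk : 0 < k) (ξ : Space ν) :
    resolventSymbol k ξ = ((2 * π * k) ^ 2)⁻¹ * (1 + ‖k⁻¹ • ξ‖ ^ 2) ^ (-1 : ℝ) := by
  rw [resolventSymbol, freeSymbol, Real.rpow_neg_one, ← mul_inv, norm_smul]
  congr 1
  have : ‖k⁻¹‖ = k⁻¹ := by rw [Real.norm_eq_abs, abs_of_pos (by positivity)]
  rw [this]
  field_simp
  ring

theorem hasTemperateGrowth_resolventSymbol (hk : 0 < k) :
    (resolventSymbol k : Space ν → ℝ).HasTemperateGrowth := by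
  have h : (resolventSymbol k : Space ν → ℝ) =
      fun ξ => ((2 * π * k) ^ 2)⁻¹ * (1 + ‖k⁻¹ • ξ‖ ^ 2) ^ (-1 : ℝ) :=
    funext (resolventSymbol_eq hk)
  rw [h]
  have h2 : (fun ξ : Space ν => (1 + ‖k⁻¹ • ξ‖ ^ 2) ^ (-1 : ℝ)).HasTemperateGrowth :=
    (Function.hasTemperateGrowth_one_add_norm_sq_rpow (Space ν) (-1)).comp
      (f := fun ξ : Space ν => k⁻¹ • ξ) (by fun_prop)
  fun_prop

theorem hasTemperateGrowth_ofReal {g : Space ν → ℝ} (hg : g.HasTemperateGrowth) :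
    (fun ξ => (g ξ : ℂ)).HasTemperateGrowth := by
  fun_prop

theorem resolventSymbol_le (hk : 0 < k) (ξ : Space ν) :
    resolventSymbol k ξ ≤ ((2 * π * k) ^ 2)⁻¹ := by
  unfold resolventSymbol freeSymbol
  gcongr
  have : 0 ≤ (2 * π) ^ 2 * ‖ξ‖ ^ 2 := by positivity
  linarith

theorem memLp_top_resolventSymbol (hk : 0 < k) :
    MemLp (fun ξ : Space ν => (resolventSymbol k ξ : ℂ)) ⊤ volume := by
  refine memLp_top_of_bound ?_ ((2 * π * k) ^ 2)⁻¹ (ae_of_all _ fun ξ => ?_)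
  · exact (hasTemperateGrowth_ofReal
      (hasTemperateGrowth_resolventSymbol hk)).1.continuous.aestronglyMeasurable
  · rw [Complex.norm_real, Real.norm_of_nonneg (resolventSymbol_pos hk ξ).le]
    exact resolventSymbol_le hk ξ

/-- Multiplication by a bounded function on `L²`. -/
def mulLinf {m : Space ν → ℂ} (hm : MemLp m ⊤ volume) : L2 ν →L[ℂ] L2 ν :=
  LinearMap.mkContinuous
    { toFun := fun f => hm.toLp m • f
      map_add' := fun f g => Lp.add_smul _ f g
      map_smul' := fun c f => (Lp.smul_comm c _ f).symm } ‖hm.toLp m‖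
    fun f => Lp.norm_smul_le _ f

theorem coeFn_mulLinf {m : Space ν → ℂ} (hm : MemLp m ⊤ volume) (f : L2 ν) :
    mulLinf hm f =ᵐ[volume] fun x => m x * f x := by
  filter_upwards [Lp.coeFn_lpSMul (r := 2) (hm.toLp m) f, hm.coeFn_toLp] with x h1 h2
  change (hm.toLp m • f : L2 ν) x = _
  rw [h1, Pi.smul_apply', h2, smul_eq_mul]

theorem inner_mulLinf_ofReal {m : Space ν → ℝ} (hm : MemLp (fun x => (m x : ℂ)) ⊤ volume)
    (f g : L2 ν) : inner ℂ (mulLinf hm f) g = inner ℂ f (mulLinf hm g) := by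
  rw [L2.inner_def, L2.inner_def]
  refine integral_congr_ae ?_
  filter_upwards [coeFn_mulLinf hm f, coeFn_mulLinf hm g] with x h1 h2
  rw [h1, h2, RCLike.inner_apply, RCLike.inner_apply, map_mul, Complex.conj_ofReal]
  ring

/-- The free resolvent `(-Δ + (2πk)²)⁻¹` on `L²`. -/
def freeResolvent (ν : ℕ) (hk : 0 < k) : L2 ν →L[ℂ] L2 ν :=
  ((Lp.fourierTransformₗᵢ (Space ν) ℂ).symm : L2 ν →L[ℂ] L2 ν) ∘L
    mulLinf (memLp_top_resolventSymbol hk) ∘L (Lp.fourierTransformₗᵢ (Space ν) ℂ : L2 ν →L[ℂ] L2 ν)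

theorem fourier_freeResolvent (hk : 0 < k) (f : L2 ν) :
    𝓕 (freeResolvent ν hk f) = mulLinf (memLp_top_resolventSymbol hk) (𝓕 f) :=
  (Lp.fourierTransformₗᵢ (Space ν) ℂ).apply_symm_apply _

theorem isSymmetric_freeResolvent (hk : 0 < k) (f g : L2 ν) :
    inner ℂ (freeResolvent ν hk f) g = inner ℂ f (freeResolvent ν hk g) := by
  rw [← Lp.inner_fourier_eq, ← Lp.inner_fourier_eq f, fourier_freeResolvent,
    fourier_freeResolvent]
  exact inner_mulLinf_ofReal _ _ _

/-- Links the `L²` operator with multipliers on distributions, where the unbounded symbol is allowed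
too and inverting `-Δ + (2πk)²` becomes multiplication of symbols. -/
theorem toDistribution_freeResolvent (hk : 0 < k) (f : L2 ν) :
    toDistribution ν (freeResolvent ν hk f) =
      TemperedDistribution.fourierMultiplierCLM ℂ (fun ξ => (resolventSymbol k ξ : ℂ))
        (toDistribution ν f) := by
  have h1 := Lp.fourierInv_toTemperedDistribution_eq
    ((memLp_top_resolventSymbol (ν := ν) hk).toLp _ • (𝓕 f : L2 ν) : L2 ν)
  rw [Lp.toTemperedDistribution_smul_eq (hasTemperateGrowth_ofReal
      (hasTemperateGrowth_resolventSymbol hk)), ← Lp.fourier_toTemperedDistribution_eq] at h1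
  exact h1.symm

theorem fourierMultiplier_freeSymbol (k : ℝ) (u : 𝓢'(Space ν, ℂ)) :
    TemperedDistribution.fourierMultiplierCLM ℂ (fun ξ => (freeSymbol k ξ : ℂ)) u =
      -Δ u + (((2 * π * k) ^ 2 : ℝ) : ℂ) • u := by
  have h : (fun ξ : Space ν => (freeSymbol k ξ : ℂ)) =
      fun ξ => ∑ i : Fin 2, (![fun ξ : Space ν => (((2 * π) ^ 2 : ℝ) : ℂ) * ((‖ξ‖ ^ 2 : ℝ) : ℂ),
        fun _ => (((2 * π * k) ^ 2 : ℝ) : ℂ)] i) ξ := by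
    ext ξ; simp [freeSymbol]
  have h3 : (fun ξ : Space ν => (((2 * π) ^ 2 : ℝ) : ℂ) * ((‖ξ‖ ^ 2 : ℝ) : ℂ)) =
      (((2 * π) ^ 2 : ℝ) : ℂ) • (fun ξ : Space ν => ((‖ξ‖ ^ 2 : ℝ) : ℂ)) := by
    ext; simp
  rw [h, TemperedDistribution.fourierMultiplierCLM_sum]
  · rw [Fin.sum_univ_two]
    simp only [Matrix.cons_val_zero, Matrix.cons_val_one]
    rw [h3, TemperedDistribution.fourierMultiplierCLM_smul (by fun_prop),
      TemperedDistribution.fourierMultiplierCLM_const,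
      TemperedDistribution.laplacian_eq_fourierMultiplierCLM]
    ext φ
    simp
  · intro i _
    fin_cases i
    · simp only [Fin.zero_eta, Matrix.cons_val_zero]; fun_prop
    · exact Function.HasTemperateGrowth.const _

theorem fourierMultiplier_free_resolvent (hk : 0 < k) (u : 𝓢'(Space ν, ℂ)) :
    TemperedDistribution.fourierMultiplierCLM ℂ (fun ξ => (freeSymbol k ξ : ℂ))
      (TemperedDistribution.fourierMultiplierCLM ℂ (fun ξ => (resolventSymbol k ξ : ℂ)) u) = u := by
  rw [TemperedDistribution.fourierMultiplierCLM_fourierMultiplierCLM_apply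
    (hasTemperateGrowth_ofReal (hasTemperateGrowth_resolventSymbol hk))
    (hasTemperateGrowth_ofReal (hasTemperateGrowth_freeSymbol k))]
  have h : ((fun ξ => (resolventSymbol k ξ : ℂ)) * fun ξ => (freeSymbol k ξ : ℂ)) =
      fun _ : Space ν => (1 : ℂ) := by
    ext ξ
    rw [Pi.mul_apply, mul_comm, ← Complex.ofReal_mul, freeSymbol_mul_resolventSymbol hk,
      Complex.ofReal_one]
  rw [h, TemperedDistribution.fourierMultiplierCLM_const]
  simp

theorem fourierMultiplier_resolvent_free (hk : 0 < k) (u : 𝓢'(Space ν, ℂ)) :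
    TemperedDistribution.fourierMultiplierCLM ℂ (fun ξ => (resolventSymbol k ξ : ℂ))
      (TemperedDistribution.fourierMultiplierCLM ℂ (fun ξ => (freeSymbol k ξ : ℂ)) u) = u := by
  rw [TemperedDistribution.fourierMultiplierCLM_fourierMultiplierCLM_apply
    (hasTemperateGrowth_ofReal (hasTemperateGrowth_freeSymbol k))
    (hasTemperateGrowth_ofReal (hasTemperateGrowth_resolventSymbol hk)), mul_comm,
    ← TemperedDistribution.fourierMultiplierCLM_fourierMultiplierCLM_apply
    (hasTemperateGrowth_ofReal (hasTemperateGrowth_resolventSymbol hk))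
    (hasTemperateGrowth_ofReal (hasTemperateGrowth_freeSymbol k)),
    fourierMultiplier_free_resolvent hk]

theorem freeResolvent_mem (hk : 0 < k) (f : L2 ν) : freeResolvent ν hk f ∈ sobolevH2 ν := by
  change TemperedDistribution.MemSobolev 2 2 (toDistribution ν (freeResolvent ν hk f))
  rw [toDistribution_freeResolvent]
  have h0 : TemperedDistribution.MemSobolev 0 2 (toDistribution ν f) :=
    TemperedDistribution.memSobolev_zero_iff.mpr ⟨f, rfl⟩
  have h2 : TemperedDistribution.MemSobolev 0 2 (TemperedDistribution.besselPotential (Space ν) ℂ 2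
      (TemperedDistribution.fourierMultiplierCLM ℂ (fun ξ => (resolventSymbol k ξ : ℂ))
        (toDistribution ν f))) := by
    rw [TemperedDistribution.besselPotential,
      TemperedDistribution.fourierMultiplierCLM_fourierMultiplierCLM_apply
        (hasTemperateGrowth_ofReal (hasTemperateGrowth_resolventSymbol hk)) (by fun_prop)]
    refine h0.fourierMultiplierCLM_of_bounded
      ((hasTemperateGrowth_ofReal (hasTemperateGrowth_resolventSymbol hk)).mul (by fun_prop))
      -- The two terms bound `|ξ|²` and `1`, respectively, divided by the free symbol.
      ⟨((2 * π) ^ 2)⁻¹ + ((2 * π * k) ^ 2)⁻¹, fun ξ => ?_⟩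
    have hp := freeSymbol_pos hk ξ
    rw [Pi.mul_apply, ← Complex.ofReal_mul, Complex.norm_real,
      Real.norm_of_nonneg (mul_nonneg (resolventSymbol_pos hk ξ).le (by positivity)),
      div_self two_ne_zero, Real.rpow_one, resolventSymbol, inv_mul_le_iff₀ hp, freeSymbol]
    have h1 : 0 < (2 * π) ^ 2 := by positivity
    have h3 : 0 < (2 * π * k) ^ 2 := by positivity
    have : ((2 * π) ^ 2 * ‖ξ‖ ^ 2 + (2 * π * k) ^ 2) * (((2 * π) ^ 2)⁻¹ + ((2 * π * k) ^ 2)⁻¹) =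
      ‖ξ‖ ^ 2 + 1 + ((2 * π) ^ 2 * ‖ξ‖ ^ 2 * ((2 * π * k) ^ 2)⁻¹
        + (2 * π * k) ^ 2 * ((2 * π) ^ 2)⁻¹) := by
      field_simp
      ring
    rw [this]
    have : 0 ≤ (2 * π) ^ 2 * ‖ξ‖ ^ 2 * ((2 * π * k) ^ 2)⁻¹
        + (2 * π * k) ^ 2 * ((2 * π) ^ 2)⁻¹ := by positivity
    linarith
  rw [TemperedDistribution.memSobolev_besselPotential_iff] at h2
  simpa using h2

theorem negLaplacian_freeResolvent (hk : 0 < k) (f : L2 ν) :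
    negLaplacian ν ⟨freeResolvent ν hk f, freeResolvent_mem hk f⟩ +
      (((2 * π * k) ^ 2 : ℝ) : ℂ) • freeResolvent ν hk f = f := by
  refine toDistribution_injective ν ?_
  have h := toDistribution_negLaplacian
    (⟨freeResolvent ν hk f, freeResolvent_mem hk f⟩ : sobolevH2 ν)
  rw [map_add, map_smul]
  refine (congrArg (· + _) h).trans ?_
  change -Δ (toDistribution ν (freeResolvent ν hk f)) + _ = _
  rw [← fourierMultiplier_freeSymbol, toDistribution_freeResolvent,
    fourierMultiplier_free_resolvent hk]

theorem freeResolvent_negLaplacian (hk : 0 < k) (ψ : sobolevH2 ν) :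
    freeResolvent ν hk (negLaplacian ν ψ + (((2 * π * k) ^ 2 : ℝ) : ℂ) • (ψ : L2 ν)) = ψ := by
  refine toDistribution_injective ν ?_
  rw [toDistribution_freeResolvent, map_add, map_smul, toDistribution_negLaplacian,
    ← fourierMultiplier_freeSymbol, fourierMultiplier_resolvent_free hk]

/-- The operator `(-Δ + (2πk)²)⁻¹` on Schwartz functions. -/
def schwartzResolvent (k : ℝ) : 𝓢(Space ν, ℂ) →L[ℂ] 𝓢(Space ν, ℂ) :=
  SchwartzMap.fourierMultiplierCLM ℂ (fun ξ => (resolventSymbol k ξ : ℂ))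

theorem toDistribution_toLp (φ : 𝓢(Space ν, ℂ)) :
    toDistribution ν (φ.toLp 2) = SchwartzMap.toTemperedDistributionCLM (Space ν) ℂ volume φ :=
  Lp.toTemperedDistribution_toLp_eq φ

theorem freeResolvent_toLp (hk : 0 < k) (φ : 𝓢(Space ν, ℂ)) :
    freeResolvent ν hk (φ.toLp 2) = (schwartzResolvent k φ).toLp 2 := by
  refine toDistribution_injective ν ?_
  rw [toDistribution_freeResolvent, toDistribution_toLp, toDistribution_toLp]
  exact TemperedDistribution.fourierMultiplierCLM_toTemperedDistributionCLM_eq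
    (hasTemperateGrowth_ofReal (hasTemperateGrowth_resolventSymbol hk)) φ

/-- The operator `-Δ + (2πk)²` on Schwartz functions. -/
def schwartzFree (k : ℝ) (φ : 𝓢(Space ν, ℂ)) : 𝓢(Space ν, ℂ) :=
  -Δ φ + (((2 * π * k) ^ 2 : ℝ) : ℂ) • φ

theorem toDistribution_toLp_injective :
    Function.Injective (SchwartzMap.toTemperedDistributionCLM (Space ν) ℂ volume) := by
  intro φ χ h
  rw [← toDistribution_toLp, ← toDistribution_toLp] at h
  exact SchwartzMap.injective_toLp 2 volume (toDistribution_injective ν h)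

theorem toDistribution_schwartzFree (k : ℝ) (φ : 𝓢(Space ν, ℂ)) :
    SchwartzMap.toTemperedDistributionCLM (Space ν) ℂ volume (schwartzFree k φ) =
      TemperedDistribution.fourierMultiplierCLM ℂ (fun ξ => (freeSymbol k ξ : ℂ))
        (SchwartzMap.toTemperedDistributionCLM (Space ν) ℂ volume φ) := by
  rw [fourierMultiplier_freeSymbol, schwartzFree, map_add, map_neg, map_smul,
    TemperedDistribution.laplacian_toTemperedDistributionCLM_eq]

theorem schwartzFree_eq_fourierMultiplier (k : ℝ) (φ : 𝓢(Space ν, ℂ)) :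
    schwartzFree k φ = SchwartzMap.fourierMultiplierCLM ℂ (fun ξ => (freeSymbol k ξ : ℂ)) φ := by
  refine toDistribution_toLp_injective ?_
  rw [toDistribution_schwartzFree]
  exact TemperedDistribution.fourierMultiplierCLM_toTemperedDistributionCLM_eq
    (hasTemperateGrowth_ofReal (hasTemperateGrowth_freeSymbol k)) φ

theorem schwartzFree_schwartzResolvent (hk : 0 < k) (φ : 𝓢(Space ν, ℂ)) :
    schwartzFree k (schwartzResolvent k φ) = φ := by
  refine toDistribution_toLp_injective ?_
  rw [toDistribution_schwartzFree, schwartzResolvent,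
    ← TemperedDistribution.fourierMultiplierCLM_toTemperedDistributionCLM_eq
      (hasTemperateGrowth_ofReal (hasTemperateGrowth_resolventSymbol hk)),
    fourierMultiplier_free_resolvent hk]

theorem schwartzResolvent_schwartzFree (hk : 0 < k) (φ : 𝓢(Space ν, ℂ)) :
    schwartzResolvent k (schwartzFree k φ) = φ := by
  refine toDistribution_toLp_injective ?_
  rw [schwartzResolvent,
    ← TemperedDistribution.fourierMultiplierCLM_toTemperedDistributionCLM_eq
      (hasTemperateGrowth_ofReal (hasTemperateGrowth_resolventSymbol hk)),
    toDistribution_schwartzFree, fourierMultiplier_resolvent_free hk]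

end FreeResolvent

/-! ### Spectral theory of operators with a normal resolvent -/

section Abstract

variable {H : Type*} [NormedAddCommGroup H] [InnerProductSpace ℂ H] [CompleteSpace H]

/-- `A` is the resolvent `(T - z)⁻¹`. -/
structure IsResolventAt (T : H →ₗ.[ℂ] H) (z : ℂ) (A : H →L[ℂ] H) : Prop where
  right_inv : ∀ f : H, ∃ h : A f ∈ T.domain, T ⟨A f, h⟩ - z • A f = f
  left_inv : ∀ ψ : T.domain, A (T ψ - z • (ψ : H)) = ψ

variable {T : H →ₗ.[ℂ] H} {z : ℂ} {A : H →L[ℂ] H}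

theorem IsResolventAt.sub_apply (hA : IsResolventAt T z A) (w : ℂ) (f : H) :
    ∃ h : A f ∈ T.domain, T ⟨A f, h⟩ - w • A f = (1 - (w - z) • A) f := by
  obtain ⟨h, h1⟩ := hA.right_inv f
  refine ⟨h, ?_⟩
  have : T ⟨A f, h⟩ = f + z • A f := sub_eq_iff_eq_add.mp h1
  rw [this]
  simp only [_root_.sub_apply, one_apply_eq_self,
    _root_.smul_apply, sub_smul]
  abel

/-- The factorization `T - w = (1 - (w - z) A) (T - z)` moves invertibility from `T - w` to a
bounded operator. The inverse of `1 - (w - z) A` is `1 + (w - z) R`, with `R` the resolvent at `w`.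
-/
theorem IsResolventAt.isUnit_iff (hA : IsResolventAt T z A) (w : ℂ) :
    IsUnit (1 - (w - z) • A) ↔ w ∈ resolventSet T := by
  constructor
  · rintro ⟨u, hu⟩
    refine ⟨A * ↑u⁻¹, fun f => ?_, fun ψ => ?_⟩
    · obtain ⟨h, h1⟩ := hA.sub_apply w ((↑u⁻¹ : H →L[ℂ] H) f)
      refine ⟨h, h1.trans ?_⟩
      rw [← hu, ← mul_apply_eq_comp, u.mul_inv, one_apply_eq_self]
    · have h2 : T ψ - w • (ψ : H) = (u : H →L[ℂ] H) (T ψ - z • (ψ : H)) := by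
        rw [hu, _root_.sub_apply, _root_.smul_apply, hA.left_inv]
        simp only [one_apply_eq_self, sub_smul]
        abel
      rw [h2, mul_apply_eq_comp, ← mul_apply_eq_comp (↑u⁻¹ : H →L[ℂ] H),
        u.inv_mul, one_apply_eq_self, hA.left_inv]
  · rintro ⟨R, hR1, hR2⟩
    have e1 : ∀ f, R f = A f + (w - z) • A (R f) := by
      intro f
      obtain ⟨h, h1⟩ := hR1 f
      have h2 := hA.left_inv ⟨R f, h⟩
      have h3 : T ⟨R f, h⟩ = f + w • R f := sub_eq_iff_eq_add.mp h1
      rw [h3] at h2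
      simp only [map_sub, map_add, map_smul] at h2
      rw [sub_smul, ← add_sub_assoc, h2]
    have e2 : ∀ f, R f = A f + (w - z) • R (A f) := by
      intro f
      obtain ⟨h, h1⟩ := hA.sub_apply w f
      have h2 := hR2 ⟨A f, h⟩
      simp only at h2
      rw [h1] at h2
      simp only [_root_.sub_apply, one_apply_eq_self,
        _root_.smul_apply, map_sub, map_smul] at h2
      exact sub_eq_iff_eq_add.mp h2
    refine ⟨⟨1 - (w - z) • A, 1 + (w - z) • R, ?_, ?_⟩, rfl⟩
    · ext f
      have := e1 f
      simp only [mul_apply_eq_comp, _root_.sub_apply,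
        one_apply_eq_self, _root_.add_apply,
        _root_.smul_apply, map_add, map_smul]
      have h3 : R f - (w - z) • A (R f) = A f := sub_eq_iff_eq_add.mpr this
      rw [h3]
      simp
    · ext f
      have := e2 f
      simp only [mul_apply_eq_comp, _root_.sub_apply,
        one_apply_eq_self, _root_.add_apply,
        _root_.smul_apply, map_sub, map_smul]
      rw [← this]
      simp

theorem isStarNormal_one_sub_smul (hn : IsStarNormal A) (ζ : ℂ) : IsStarNormal (1 - ζ • A) := by
  refine ⟨?_⟩
  rw [star_sub, star_one, star_smul]
  have := hn.star_comm_self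
  exact ((Commute.one_left _).sub_left
    (((Commute.one_right _).sub_right ((this.smul_left _).smul_right _))))

/-- Spectral mapping for the resolvent, normalized so that the point `z + ζ` under study corresponds
to `0`. -/
theorem IsResolventAt.mem_spectrum_iff (hA : IsResolventAt T z A) {ζ ζ' : ℂ} (hζ : ζ ≠ 0)
    (hζ' : ζ' ≠ 0) :
    z + ζ' ∈ spectrum T ↔ 1 - ζ / ζ' ∈ _root_.spectrum ℂ (1 - ζ • A) := by
  rw [spectrum, Set.mem_compl_iff, ← hA.isUnit_iff, _root_.spectrum.mem_iff, not_iff_not]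
  have h : algebraMap ℂ (H →L[ℂ] H) (1 - ζ / ζ') - (1 - ζ • A) =
      (-(ζ / ζ')) • (1 - (z + ζ' - z) • A) := by
    ext f
    simp only [Algebra.algebraMap_eq_smul_one, _root_.sub_apply,
      _root_.smul_apply, one_apply_eq_self, smul_sub, sub_smul, one_smul,
      smul_smul, neg_smul, add_sub_cancel_left]
    rw [neg_mul, div_mul_cancel₀ _ hζ']
    simp only [_root_.neg_apply, _root_.smul_apply, one_apply_eq_self, neg_smul]
    abel
  rw [h]
  have h0 : -(ζ / ζ') ≠ 0 := neg_ne_zero.mpr (div_ne_zero hζ hζ')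
  exact (isUnit_smul_iff (Units.mk0 _ h0) (1 - (z + ζ' - z) • A)).symm

theorem IsResolventAt.sub_ne_zero (hA : IsResolventAt T z A) {w : ℂ} (hw : w ∈ spectrum T) :
    w - z ≠ 0 := by
  intro h
  refine hw ?_
  rw [← hA.isUnit_iff, h]
  simp

theorem IsResolventAt.isolated_zero (hA : IsResolventAt T z A) {w : ℂ} (hw : w ∈ spectrum T)
    {ε : ℝ} (hε : 0 < ε) (h : ∀ w' ∈ spectrum T, dist w' w < ε → w' = w) :
    ∃ δ > 0, ∀ v ∈ _root_.spectrum ℂ (1 - (w - z) • A), ‖v‖ < δ → v = 0 := by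
  have hζ := hA.sub_ne_zero hw
  set ζ := w - z with hζd
  have hζn : 0 < ‖ζ‖ := norm_pos_iff.mpr hζ
  -- A spectral value `v` comes from `z + ζ / (1 - v)`, at distance `|ζ v / (1 - v)|` from `w`; for
  -- `|v| < 1/2` this is at most `2 |ζ| |v|`.
  refine ⟨min (1 / 2) (ε / (2 * ‖ζ‖)), by positivity, fun v hv hvn => ?_⟩
  have hv1 : ‖v‖ < 1 / 2 := hvn.trans_le (min_le_left _ _)
  have hv2 : ‖v‖ < ε / (2 * ‖ζ‖) := hvn.trans_le (min_le_right _ _)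
  have hv3 : 1 / 2 ≤ ‖1 - v‖ := by
    have := norm_sub_norm_le (1 : ℂ) v
    rw [norm_one] at this
    linarith
  have hv4 : 1 - v ≠ 0 := by
    intro h0
    rw [h0, norm_zero] at hv3
    linarith
  have hm : z + ζ / (1 - v) ∈ spectrum T := by
    rw [hA.mem_spectrum_iff hζ (div_ne_zero hζ hv4)]
    convert hv using 1
    field_simp
    ring
  have hd : z + ζ / (1 - v) - w = ζ * v / (1 - v) := by
    have : w = z + ζ := by rw [hζd]; ring
    rw [this]
    field_simp
    ring
  have heq := h _ hm (by
    rw [dist_eq_norm, hd, norm_div, norm_mul, div_lt_iff₀ (by linarith)]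
    rw [lt_div_iff₀ (by positivity)] at hv2
    nlinarith)
  rw [heq, sub_self] at hd
  have := (div_eq_zero_iff.mp hd.symm).resolve_right hv4
  exact (mul_eq_zero.mp this).resolve_left hζ

theorem IsResolventAt.mem_eigenspace (hA : IsResolventAt T z A) {w : ℂ} {f : H}
    (hf : (1 - (w - z) • A) f = 0) :
    f ∈ (eigenspace T w).map T.domain.subtype := by
  have h1 : f = A ((w - z) • f) := by
    rw [map_smul]
    simpa [sub_eq_zero] using hf
  obtain ⟨h, h2⟩ := hA.sub_apply w ((w - z) • f)
  rw [map_smul (1 - (w - z) • A), hf, smul_zero] at h2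
  refine ⟨⟨A ((w - z) • f), h⟩, ?_, h1.symm⟩
  exact h2

/-- Continuity relative to `s` is automatic at an isolated point, so functions such as `x⁻¹` become
admissible in the functional calculus. -/
theorem continuousOn_of_isolated {s : Set ℂ} {δ : ℝ} (hδ : 0 < δ)
    (h : ∀ v ∈ s, ‖v‖ < δ → v = 0) {f : ℂ → ℂ} (hf : ∀ x, x ≠ 0 → ContinuousAt f x) :
    ContinuousOn f s := by
  intro x hx
  by_cases h0 : x = 0
  · subst h0
    have : f =ᶠ[nhdsWithin 0 s] fun _ => f 0 := by
      filter_upwards [self_mem_nhdsWithin,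
        mem_nhdsWithin_of_mem_nhds (Metric.ball_mem_nhds (0 : ℂ) hδ)] with v hv hv2
      rw [h v hv (by simpa using hv2)]
    exact continuousWithinAt_const.congr_of_eventuallyEq this rfl
  · exact (hf x h0).continuousWithinAt

/-- The Riesz projection of a normal operator at an isolated point `0` of its spectrum. -/
theorem exists_kernel_projection {C : H →L[ℂ] H} (hC : IsStarNormal C) {δ : ℝ} (hδ : 0 < δ)
    (h : ∀ v ∈ _root_.spectrum ℂ C, ‖v‖ < δ → v = 0) :
    ∃ P G : H →L[ℂ] H, C * P = 0 ∧ G * C = 1 - P ∧ (0 ∈ _root_.spectrum ℂ C → P ≠ 0) := by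
  let p : ℂ → ℂ := fun x => if x = 0 then 1 else 0
  have hp : ContinuousOn p (_root_.spectrum ℂ C) := by
    refine continuousOn_of_isolated hδ h fun x hx => ?_
    have : p =ᶠ[nhds x] fun _ => 0 := by
      filter_upwards [isOpen_ne.mem_nhds hx] with y hy
      exact if_neg hy
    exact continuousAt_const.congr this.symm
  have hi : ContinuousOn (fun x : ℂ => x⁻¹) (_root_.spectrum ℂ C) :=
    continuousOn_of_isolated hδ h fun x hx => continuousAt_inv₀ hx
  have hid : ContinuousOn (fun x : ℂ => x) (_root_.spectrum ℂ C) := continuousOn_id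
  -- With the convention `0⁻¹ = 0` one has `x⁻¹ * x = 1 - p x` everywhere, so `cfc (fun x => x⁻¹) C`
  -- inverts `C` off the range of the projection.
  refine ⟨cfc p C, cfc (fun x : ℂ => x⁻¹) C, ?_, ?_, ?_⟩
  · have h1 := cfc_mul (fun x => x) p C hid hp
    rw [cfc_id' ℂ C hC] at h1
    have h2 : (fun x => x * p x) = fun _ => 0 := by
      ext x; by_cases h : x = 0 <;> simp [p, h]
    rw [← h1, h2, cfc_const_zero]
  · have h1 := cfc_mul (fun x : ℂ => x⁻¹) (fun x => x) C hi hid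
    rw [cfc_id' ℂ C hC] at h1
    have h2 : (fun x : ℂ => x⁻¹ * x) = fun x => 1 - p x := by
      ext x; by_cases h : x = 0 <;> simp [p, h]
    rw [← h1, h2, cfc_sub (fun _ => 1) p C continuousOn_const hp, cfc_const_one ℂ C hC]
  · intro h0 hP
    have h1 := cfc_map_spectrum p C hC hp
    rw [hP] at h1
    have h2 : (1 : ℂ) ∈ p '' _root_.spectrum ℂ C := ⟨0, h0, if_pos rfl⟩
    rw [← h1] at h2
    rcases subsingleton_or_nontrivial (H →L[ℂ] H) with hs | hs
    · rw [_root_.spectrum.of_subsingleton] at h2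
      exact h2
    · rw [_root_.spectrum.zero_eq] at h2
      exact one_ne_zero h2

/-- At a point of the discrete spectrum, `T - w` controls the distance to the eigenspace. -/
theorem IsResolventAt.dist_eigenspace_le (hA : IsResolventAt T z A) (hn : IsStarNormal A) {w : ℂ}
    (hw : w ∈ discreteSpectrum T) :
    ∃ N : Submodule ℂ H, FiniteDimensional ℂ N ∧ ∃ K : ℝ, 0 ≤ K ∧ ∀ ψ : T.domain, ∃ n ∈ N,
      ‖(ψ : H) - n‖ ≤ K * ‖T ψ - w • (ψ : H)‖ := by
  obtain ⟨hs, ⟨ε, hε, hiso⟩, -, hfin⟩ := hw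
  obtain ⟨δ, hδ, hδ2⟩ := hA.isolated_zero hs hε hiso
  refine ⟨(eigenspace T w).map T.domain.subtype, inferInstance, ?_⟩
  obtain ⟨P, G, hP, hG, -⟩ :=
    exists_kernel_projection (isStarNormal_one_sub_smul hn (w - z)) hδ hδ2
  refine ⟨‖G‖ * ‖A‖, by positivity, fun ψ => ⟨P ψ, ?_, ?_⟩⟩
  · refine hA.mem_eigenspace ?_
    rw [← mul_apply_eq_comp, hP]
    simp
  · have h3 : (1 - (w - z) • A) (ψ : H) = A (T ψ - w • (ψ : H)) := by
      have h4 : T ψ - w • (ψ : H) = (T ψ - z • (ψ : H)) - (w - z) • (ψ : H) := by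
        rw [sub_smul]; abel
      rw [h4, map_sub, hA.left_inv, map_smul]
      simp
    -- `G` undoes `1 - (w - z) A` up to the eigenprojection `P`.
    have h5 : (ψ : H) - P (ψ : H) = G (A (T ψ - w • (ψ : H))) := by
      rw [← h3, ← mul_apply_eq_comp, hG]
      simp
    rw [h5, mul_assoc]
    exact (ContinuousLinearMap.le_opNorm _ _).trans
      (mul_le_mul_of_nonneg_left (ContinuousLinearMap.le_opNorm _ _) (norm_nonneg _))

theorem exists_orthonormal_of_not_finiteDimensional {K : Submodule ℂ H}
    (hK : ¬ FiniteDimensional ℂ K) : ∃ φ : ℕ → H, Orthonormal ℂ φ ∧ ∀ n, φ n ∈ K := by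
  let b := Module.Basis.ofVectorSpace ℂ K
  have hinf : Infinite (Module.Basis.ofVectorSpaceIndex ℂ K) := by
    by_contra hfin
    rw [not_infinite_iff_finite] at hfin
    exact hK (Module.Finite.of_basis b)
  let e := Infinite.natEmbedding (Module.Basis.ofVectorSpaceIndex ℂ K)
  have hl : LinearIndependent ℂ (fun n => b (e n)) := b.linearIndependent.comp e e.injective
  have ho := InnerProductSpace.gramSchmidtNormed_orthonormal hl
  exact ⟨_, ho.comp_linearIsometry K.subtypeₗᵢ, fun n => Subtype.property _⟩

/-- The ratio `4` makes the discs of radius `‖v n‖ / 4` about the points `v n` pairwise disjoint. -/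
theorem exists_decreasing_sequence {s : Set ℂ} (h : ∀ r > 0, ∃ v ∈ s, v ≠ 0 ∧ ‖v‖ < r) :
    ∃ v : ℕ → ℂ, (∀ n, v n ∈ s ∧ v n ≠ 0) ∧ (∀ m n, m < n → ‖v n‖ < ‖v m‖ / 4) ∧
      Tendsto v atTop (nhds 0) := by
  choose! pick h1 h2 h3 using h
  let v : ℕ → ℂ := fun n => Nat.rec (pick 1) (fun _ x => pick (‖x‖ / 4)) n
  have hv : ∀ n, v n ∈ s ∧ v n ≠ 0 := by
    intro n
    induction n with
    | zero => exact ⟨h1 1 one_pos, h2 1 one_pos⟩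
    | succ n ih =>
      have : 0 < ‖v n‖ / 4 := by have := norm_pos_iff.mpr ih.2; positivity
      exact ⟨h1 _ this, h2 _ this⟩
  have hstep : ∀ n, ‖v (n + 1)‖ < ‖v n‖ / 4 := fun n =>
    h3 _ (by have := norm_pos_iff.mpr (hv n).2; positivity)
  have hlt : ∀ m n, m < n → ‖v n‖ < ‖v m‖ / 4 := by
    intro m n hmn
    induction n, hmn using Nat.le_induction with
    | base => exact hstep m
    | succ n _ ih =>
      have := hstep n
      have := norm_nonneg (v n)
      linarith
  refine ⟨v, hv, hlt, ?_⟩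
  rw [tendsto_zero_iff_norm_tendsto_zero]
  have hb : ∀ n, ‖v n‖ ≤ ‖v 0‖ * (1 / 4) ^ n := by
    intro n
    induction n with
    | zero => simp
    | succ n ih =>
      have := hstep n
      rw [pow_succ]
      linarith
  refine squeeze_zero (fun n => norm_nonneg _) hb ?_
  have := (tendsto_pow_atTop_nhds_zero_of_lt_one (r := (1 / 4 : ℝ)) (by norm_num)
    (by norm_num)).const_mul ‖v 0‖
  simpa using this

/-- A continuous bump function centred at `v`, supported in the ball of radius `‖v‖ / 4`. -/
def spectralBump (v x : ℂ) : ℂ := ((max 0 (1 - 4 * ‖x - v‖ / ‖v‖) : ℝ) : ℂ)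

theorem continuous_spectralBump (v : ℂ) : Continuous (spectralBump v) := by
  unfold spectralBump; fun_prop

theorem spectralBump_self (v : ℂ) : spectralBump v v = 1 := by simp [spectralBump]

theorem norm_sub_lt_of_spectralBump_ne_zero {v x : ℂ} (hv : v ≠ 0) (h : spectralBump v x ≠ 0) :
    4 * ‖x - v‖ < ‖v‖ := by
  by_contra! hle
  refine h ?_
  have hv' := norm_pos_iff.mpr hv
  have : 1 ≤ 4 * ‖x - v‖ / ‖v‖ := by rwa [le_div_iff₀ hv', one_mul]
  rw [spectralBump, max_eq_left (by linarith), Complex.ofReal_zero]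

theorem spectralBump_mul_spectralBump {v w : ℂ} (hv : v ≠ 0) (hw : w ≠ 0) (h : ‖w‖ < ‖v‖ / 4)
    (x : ℂ) : spectralBump v x * spectralBump w x = 0 := by
  by_contra hne
  have h1 := norm_sub_lt_of_spectralBump_ne_zero hv (left_ne_zero_of_mul hne)
  have h2 := norm_sub_lt_of_spectralBump_ne_zero hw (right_ne_zero_of_mul hne)
  have h3 : ‖v‖ ≤ ‖x - v‖ + ‖x - w‖ + ‖w‖ := by
    calc ‖v‖ = ‖-(x - v) + (x - w) + w‖ := by congr 1; ring
      _ ≤ ‖-(x - v) + (x - w)‖ + ‖w‖ := norm_add_le _ _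
      _ ≤ ‖-(x - v)‖ + ‖x - w‖ + ‖w‖ := by gcongr; exact norm_add_le _ _
      _ = _ := by rw [norm_neg]
  have := norm_nonneg v
  linarith

/-- The function `x` truncated in norm at height `r`. -/
def truncId (r : ℝ) (x : ℂ) : ℂ := ((r / max r ‖x‖ : ℝ) : ℂ) * x

theorem continuous_truncId {r : ℝ} (hr : 0 < r) : Continuous (truncId r) := by
  unfold truncId
  refine (Complex.continuous_ofReal.comp ?_).mul continuous_id
  exact continuous_const.div (by fun_prop) fun x => (hr.trans_le (le_max_left _ _)).ne'

theorem norm_truncId_le {r : ℝ} (hr : 0 < r) (x : ℂ) : ‖truncId r x‖ ≤ r := by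
  have h : 0 < max r ‖x‖ := hr.trans_le (le_max_left _ _)
  rw [truncId, norm_mul, Complex.norm_real, Real.norm_of_nonneg (by positivity),
    div_mul_eq_mul_div, div_le_iff₀ h]
  exact mul_le_mul_of_nonneg_left (le_max_right _ _) hr.le

/-- On the support of the bump `|x| < 5/4 |v|`, so truncating at height `2 |v|` changes nothing. The
truncated function is globally bounded and thus gives an operator norm bound for `C` on the range of
the bump operator. -/
theorem truncId_mul_spectralBump {v : ℂ} (hv : v ≠ 0) (x : ℂ) :
    truncId (2 * ‖v‖) x * spectralBump v x = x * spectralBump v x := by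
  by_cases h : spectralBump v x = 0
  · simp [h]
  · have h1 := norm_sub_lt_of_spectralBump_ne_zero hv h
    have hv' := norm_pos_iff.mpr hv
    have h2 : ‖x‖ ≤ ‖x - v‖ + ‖v‖ := by simpa using norm_add_le (x - v) v
    rw [truncId, max_eq_left (by linarith), div_self (by positivity)]
    simp

/-- If `0` is an accumulation point of the spectrum of a normal operator `C`, then there is an
orthonormal sequence along which `C` tends to zero. -/
theorem exists_orthonormal_of_accumulation {C : H →L[ℂ] H} (hC : IsStarNormal C)
    (h : ∀ r > 0, ∃ v ∈ _root_.spectrum ℂ C, v ≠ 0 ∧ ‖v‖ < r) :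
    ∃ φ : ℕ → H, Orthonormal ℂ φ ∧ Tendsto (fun n => C (φ n)) atTop (nhds 0) := by
  obtain ⟨v, hv, hlt, hv0⟩ := exists_decreasing_sequence h
  have hcont : ∀ n, ContinuousOn (spectralBump (v n)) (_root_.spectrum ℂ C) := fun n =>
    (continuous_spectralBump _).continuousOn
  -- By spectral mapping `1` lies in the spectrum of the bump operator, which therefore is nonzero.
  have hne : ∀ n, ∃ x, cfc (spectralBump (v n)) C x ≠ 0 := by
    intro n
    by_contra! h0
    have hz : cfc (spectralBump (v n)) C = 0 := by ext x; exact h0 x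
    have h1 := cfc_map_spectrum (spectralBump (v n)) C hC (hcont n)
    rw [hz] at h1
    have h2 : (1 : ℂ) ∈ spectralBump (v n) '' _root_.spectrum ℂ C :=
      ⟨v n, (hv n).1, spectralBump_self _⟩
    rw [← h1] at h2
    rcases subsingleton_or_nontrivial (H →L[ℂ] H) with hs | hs
    · rw [_root_.spectrum.of_subsingleton] at h2
      exact h2
    · rw [_root_.spectrum.zero_eq] at h2
      exact one_ne_zero h2
  choose x hx using hne
  -- The bumps are real with disjoint supports, so the bump operators are self-adjoint with product
  -- zero and have orthogonal ranges.
  have horth : ∀ m n, m ≠ n →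
      inner ℂ (cfc (spectralBump (v m)) C (x m)) (cfc (spectralBump (v n)) C (x n)) = 0 := by
    intro m n hmn
    have hstar : star (cfc (spectralBump (v m)) C) = cfc (spectralBump (v m)) C := by
      rw [← cfc_star]
      congr 1
      ext y
      simp [spectralBump]
    have hmul : cfc (spectralBump (v m)) C * cfc (spectralBump (v n)) C = 0 := by
      rw [← cfc_mul _ _ C (hcont m) (hcont n)]
      have : (fun y => spectralBump (v m) y * spectralBump (v n) y) = fun _ => 0 := by
        ext y
        rcases lt_or_gt_of_ne hmn with hl | hl
        · exact spectralBump_mul_spectralBump (hv m).2 (hv n).2 (hlt m n hl) y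
        · rw [mul_comm]
          exact spectralBump_mul_spectralBump (hv n).2 (hv m).2 (hlt n m hl) y
      rw [this, cfc_const_zero]
    rw [← ContinuousLinearMap.adjoint_inner_right, ← ContinuousLinearMap.star_eq_adjoint, hstar,
      ← mul_apply_eq_comp, hmul]
    simp
  let φ : ℕ → H := fun n => ((‖cfc (spectralBump (v n)) C (x n)‖⁻¹ : ℝ) : ℂ) •
    cfc (spectralBump (v n)) C (x n)
  have hφ1 : ∀ n, ‖φ n‖ = 1 := by
    intro n
    have := norm_pos_iff.mpr (hx n)
    simp only [φ, norm_smul, Complex.norm_real, norm_inv, norm_norm]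
    exact inv_mul_cancel₀ this.ne'
  have hCφ : ∀ n, ‖C (φ n)‖ ≤ 2 * ‖v n‖ := by
    intro n
    have hvp := norm_pos_iff.mpr (hv n).2
    have ht : ContinuousOn (truncId (2 * ‖v n‖)) (_root_.spectrum ℂ C) :=
      (continuous_truncId (by positivity)).continuousOn
    have h1 : C * cfc (spectralBump (v n)) C =
        cfc (truncId (2 * ‖v n‖)) C * cfc (spectralBump (v n)) C := by
      rw [← cfc_mul _ _ C ht (hcont n)]
      simp_rw [truncId_mul_spectralBump (hv n).2]
      rw [cfc_mul (fun y => y) _ C continuousOn_id (hcont n), cfc_id' ℂ C hC]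
    have h2 : C (φ n) = cfc (truncId (2 * ‖v n‖)) C (φ n) := by
      simp only [φ, map_smul]
      rw [← mul_apply_eq_comp, h1, mul_apply_eq_comp]
    rw [h2]
    refine (ContinuousLinearMap.le_opNorm _ _).trans ?_
    rw [hφ1, mul_one]
    exact norm_cfc_le (by positivity) fun y _ => norm_truncId_le (by positivity) y
  refine ⟨φ, ⟨hφ1, fun m n hmn => ?_⟩, ?_⟩
  · simp only [φ, inner_smul_left, inner_smul_right, horth m n hmn, mul_zero]
  · refine squeeze_zero_norm hCφ ?_
    simpa using hv0.norm.const_mul 2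

/-- One half of the Weyl criterion. If `w` is isolated in the spectrum, the Riesz projection makes
it an eigenvalue, necessarily of infinite multiplicity; an orthonormal sequence of eigenvectors
serves. Otherwise nearby spectral values supply almost orthogonal spectral subspaces of `1 - (w - z)
A`, in fact exactly orthogonal ones. -/
theorem IsResolventAt.exists_singular_sequence (hA : IsResolventAt T z A) (hn : IsStarNormal A)
    {w : ℂ} (hw : w ∈ essentialSpectrum T) :
    ∃ φ : ℕ → H, Orthonormal ℂ φ ∧
      Tendsto (fun n => (1 - (w - z) • A) (φ n)) atTop (nhds 0) := by
  obtain ⟨hs, hd⟩ := hw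
  have hCn : IsStarNormal (1 - (w - z) • A) := isStarNormal_one_sub_smul hn (w - z)
  have hζ := hA.sub_ne_zero hs
  by_cases hiso : ∃ ε > 0, ∀ w' ∈ spectrum T, dist w' w < ε → w' = w
  · have hiso' := hiso
    obtain ⟨ε, hε, hiso⟩ := hiso
    obtain ⟨δ, hδ, hδ2⟩ := hA.isolated_zero hs hε hiso
    obtain ⟨P, G, hP, hG, hP0⟩ := exists_kernel_projection hCn hδ hδ2
    have h0 : (0 : ℂ) ∈ _root_.spectrum ℂ (1 - (w - z) • A) := by
      have h1 : z + (w - z) ∈ spectrum T := by simpa using hs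
      rw [hA.mem_spectrum_iff hζ hζ, div_self hζ, sub_self] at h1
      exact h1
    have hPne := hP0 h0
    have hne : eigenspace T w ≠ ⊥ := by
      intro hbot
      refine hPne ?_
      ext f
      have : P f ∈ (eigenspace T w).map T.domain.subtype := by
        refine hA.mem_eigenspace ?_
        rw [← mul_apply_eq_comp, hP]
        simp
      rw [hbot, Submodule.map_bot, Submodule.mem_bot] at this
      simpa using this
    have hinf : ¬ FiniteDimensional ℂ (eigenspace T w) := fun hfin =>
      hd ⟨hs, hiso', hne, hfin⟩
    have hinf2 : ¬ FiniteDimensional ℂ ((eigenspace T w).map T.domain.subtype) := by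
      intro hfin
      refine hinf ?_
      exact Module.Finite.equiv (Submodule.equivMapOfInjective T.domain.subtype
        T.domain.injective_subtype (eigenspace T w)).symm
    obtain ⟨φ, ho, hm⟩ := exists_orthonormal_of_not_finiteDimensional hinf2
    refine ⟨φ, ho, ?_⟩
    have : ∀ n, (1 - (w - z) • A) (φ n) = 0 := by
      intro n
      obtain ⟨ψ, hψ, hψ2⟩ := hm n
      have h1 : T ψ - w • (ψ : H) = 0 := hψ
      have h2 := hA.left_inv ψ
      rw [sub_eq_zero.mp h1, ← sub_smul, map_smul] at h2
      rw [← hψ2]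
      simp [h2]
    simp [this]
  · refine exists_orthonormal_of_accumulation hCn fun r hr => ?_
    push Not at hiso
    -- This map carries the spectrum of `T` into that of `1 - (w - z) A` and is injective, so
    -- accumulation at `w` becomes accumulation at `0`.
    have hcont : ContinuousAt (fun x : ℂ => 1 - (w - z) / (x - z)) w :=
      continuousAt_const.sub (continuousAt_const.div (by fun_prop) hζ)
    have h0 : (1 - (w - z) / (w - z)) = 0 := by rw [div_self hζ, sub_self]
    rw [Metric.continuousAt_iff] at hcont
    obtain ⟨ε, hε, h1⟩ := hcont r hr
    obtain ⟨w', hw', hd', hne⟩ := hiso ε hε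
    have h2 := h1 hd'
    simp only [h0, dist_zero_right] at h2
    have hζ' := hA.sub_ne_zero hw'
    refine ⟨_, (hA.mem_spectrum_iff hζ hζ').mp (by simpa using hw'), ?_, h2⟩
    intro h3
    refine hne ?_
    rw [sub_eq_zero, eq_comm, div_eq_one_iff_eq hζ'] at h3
    exact (sub_left_inj.mp h3).symm

end Abstract

section PointwiseBounds

/-! ### Pointwise bounds in dimension at most three -/

variable {ν : ℕ} {k : ℝ}

theorem resolventSymbol_le_rpow (hk : 1 ≤ k) (ξ : Space ν) :
    resolventSymbol k ξ ≤ (1 + ‖ξ‖ ^ 2) ^ (-1 : ℝ) := by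
  rw [Real.rpow_neg_one, resolventSymbol, freeSymbol, mul_pow (2 * π), ← mul_add]
  have h1 : 1 ≤ (2 * π) ^ 2 := one_le_pow₀ (by linarith [Real.pi_gt_three])
  have h2 : 1 ≤ k ^ 2 := one_le_pow₀ hk
  have h3 : 0 ≤ ‖ξ‖ ^ 2 := by positivity
  gcongr
  nlinarith

/-- The restriction on the dimension enters here: `(1 + |ξ|²)⁻²` is integrable only for `ν < 4`. -/
theorem integrable_rpow_sq (hν : ν ≤ 3) :
    Integrable (fun ξ : Space ν => ((1 + ‖ξ‖ ^ 2) ^ (-1 : ℝ)) ^ 2) volume := by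
  have h := integrable_rpow_neg_one_add_norm_sq (E := Space ν) (r := 4) (μ := volume) (by
    rw [finrank_euclideanSpace_fin]
    have : (ν : ℝ) ≤ 3 := by exact_mod_cast hν
    linarith)
  refine h.congr (ae_of_all _ fun ξ => ?_)
  simp only
  rw [← Real.rpow_mul_natCast (by positivity)]
  norm_num

theorem resolventSymbol_sq_le (hk : 1 ≤ k) (ξ : Space ν) :
    resolventSymbol k ξ ^ 2 ≤ ((1 + ‖ξ‖ ^ 2) ^ (-1 : ℝ)) ^ 2 :=
  pow_le_pow_left₀ (resolventSymbol_pos (by linarith) ξ).le (resolventSymbol_le_rpow hk ξ) 2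

theorem continuous_resolventSymbol (hk : 1 ≤ k) : Continuous (resolventSymbol k : Space ν → ℝ) :=
  (hasTemperateGrowth_resolventSymbol (by linarith)).1.continuous

theorem integrable_resolventSymbol_sq (hν : ν ≤ 3) (hk : 1 ≤ k) :
    Integrable (fun ξ : Space ν => resolventSymbol k ξ ^ 2) volume := by
  refine (integrable_rpow_sq hν).mono
    ((continuous_resolventSymbol hk).pow 2).aestronglyMeasurable (ae_of_all _ fun ξ => ?_)
  rw [Real.norm_of_nonneg (by positivity), Real.norm_of_nonneg (by positivity)]
  exact resolventSymbol_sq_le hk ξ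

/-- The `L²` norm of the symbol of the free resolvent. -/
def resolventNorm (ν : ℕ) (k : ℝ) : ℝ := √(∫ ξ : Space ν, resolventSymbol k ξ ^ 2)

/-- Dominated convergence as `k → ∞`. This smallness is what makes the relative bound of the
potential less than one. -/
theorem exists_resolventNorm_le (hν : ν ≤ 3) {ε : ℝ} (hε : 0 < ε) :
    ∃ k : ℝ, 1 ≤ k ∧ resolventNorm ν k ≤ ε := by
  have h1 : ∀ n : ℕ, (1 : ℝ) ≤ (n : ℝ) + 1 := fun n => by
    have : (0 : ℝ) ≤ n := n.cast_nonneg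
    linarith
  have h : Tendsto (fun n : ℕ => ∫ ξ : Space ν, resolventSymbol ((n : ℝ) + 1) ξ ^ 2) atTop
      (nhds (∫ _ : Space ν, (0 : ℝ))) := by
    refine tendsto_integral_of_dominated_convergence
      (fun ξ : Space ν => ((1 + ‖ξ‖ ^ 2) ^ (-1 : ℝ)) ^ 2)
      (fun n => ((continuous_resolventSymbol (h1 n)).pow 2).aestronglyMeasurable)
      (integrable_rpow_sq hν) (fun n => ae_of_all _ fun ξ => ?_) (ae_of_all _ fun ξ => ?_)
    · rw [Real.norm_of_nonneg (by positivity)]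
      exact resolventSymbol_sq_le (h1 n) ξ
    · have hb : Tendsto (fun n : ℕ => ((n : ℝ) + 1)⁻¹) atTop (nhds 0) := by
        simpa using tendsto_one_div_add_atTop_nhds_zero_nat (𝕜 := ℝ)
      have hc : Tendsto (fun n : ℕ => resolventSymbol ((n : ℝ) + 1) ξ) atTop (nhds 0) := by
        refine squeeze_zero (fun n => (resolventSymbol_pos (by linarith [h1 n]) ξ).le)
          (fun n => ?_) hb
        refine (resolventSymbol_le (by linarith [h1 n]) ξ).trans ?_
        have h2 : 1 ≤ 2 * π := by linarith [Real.pi_gt_three]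
        have h3 : (n : ℝ) + 1 ≤ (2 * π * ((n : ℝ) + 1)) ^ 2 := by
          have h4 : (n : ℝ) + 1 ≤ 2 * π * ((n : ℝ) + 1) :=
            le_mul_of_one_le_left (by linarith [h1 n]) h2
          exact h4.trans (le_self_pow₀ ((h1 n).trans h4) two_ne_zero)
        have := h1 n
        gcongr
      simpa using hc.pow 2
  rw [integral_zero] at h
  obtain ⟨n, hn⟩ := ((tendsto_order.mp h).2 (ε ^ 2) (by positivity)).exists
  refine ⟨(n : ℝ) + 1, h1 n, ?_⟩
  rw [resolventNorm]
  exact Real.sqrt_le_iff.mpr ⟨hε.le, hn.le⟩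

theorem norm_evaluation_kernel (k : ℝ) (x ξ : Space ν) :
    ‖Complex.exp (↑(-(2 * π * inner ℝ ξ x)) * Complex.I) * (resolventSymbol k ξ : ℂ)‖ =
      |resolventSymbol k ξ| := by
  rw [norm_mul, Complex.norm_exp_ofReal_mul_I, one_mul, Complex.norm_real, Real.norm_eq_abs]

theorem memLp_evaluation_kernel (hν : ν ≤ 3) (hk : 1 ≤ k) (x : Space ν) :
    MemLp (fun ξ : Space ν => Complex.exp (↑(-(2 * π * inner ℝ ξ x)) * Complex.I) *
      (resolventSymbol k ξ : ℂ)) 2 volume := by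
  rw [memLp_two_iff_integrable_sq_norm]
  · refine (integrable_resolventSymbol_sq hν hk).congr (ae_of_all _ fun ξ => ?_)
    simp only [norm_evaluation_kernel, sq_abs]
  · have := continuous_resolventSymbol (ν := ν) hk
    exact Continuous.aestronglyMeasurable (by fun_prop)

/-- The vector representing the evaluation of `(-Δ + (2πk)²)⁻¹ h` at `x` in Fourier space. -/
def evaluationKernel (hν : ν ≤ 3) (hk : 1 ≤ k) (x : Space ν) : L2 ν :=
  (memLp_evaluation_kernel hν hk x).toLp _

theorem norm_evaluationKernel (hν : ν ≤ 3) (hk : 1 ≤ k) (x : Space ν) :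
    ‖evaluationKernel hν hk x‖ = resolventNorm ν k := by
  rw [evaluationKernel, Lp.norm_toLp,
    (memLp_evaluation_kernel hν hk x).eLpNorm_eq_integral_rpow_norm (by simp) (by simp),
    ENNReal.toReal_ofReal (by positivity), resolventNorm, Real.sqrt_eq_rpow]
  simp only [ENNReal.toReal_ofNat, Real.rpow_ofNat, one_div, norm_evaluation_kernel, sq_abs]

/-- Fourier inversion read as an inner product; the kernel carries the opposite phase because the
inner product conjugates its first entry. -/
theorem schwartzResolvent_apply (hν : ν ≤ 3) (hk : 1 ≤ k) (h : 𝓢(Space ν, ℂ)) (x : Space ν) :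
    schwartzResolvent k h x = inner ℂ (evaluationKernel hν hk x) (𝓕 (h.toLp 2 volume)) := by
  rw [schwartzResolvent, SchwartzMap.fourierMultiplierCLM_apply, SchwartzMap.fourierInv_coe,
    Real.fourierInv_eq', SchwartzMap.toLp_fourier_eq, L2.inner_def]
  refine integral_congr_ae ?_
  filter_upwards [(memLp_evaluation_kernel hν hk x).coeFn_toLp,
    SchwartzMap.coeFn_toLp (𝓕 h) 2 volume] with ξ h1 h2
  rw [evaluationKernel, h1, h2, SchwartzMap.smulLeftCLM_apply_apply
    (hasTemperateGrowth_ofReal (hasTemperateGrowth_resolventSymbol (by linarith))),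
    RCLike.inner_apply, map_mul, Complex.conj_ofReal, ← Complex.exp_conj, map_mul,
    Complex.conj_ofReal, Complex.conj_I]
  simp only [smul_eq_mul, Complex.ofReal_neg, neg_mul_neg]
  ring

theorem norm_schwartzResolvent_le (hν : ν ≤ 3) (hk : 1 ≤ k) (h : 𝓢(Space ν, ℂ)) (x : Space ν) :
    ‖schwartzResolvent k h x‖ ≤ resolventNorm ν k * ‖(h.toLp 2 volume)‖ := by
  rw [schwartzResolvent_apply hν hk]
  refine (norm_inner_le_norm _ _).trans ?_
  rw [norm_evaluationKernel, Lp.norm_fourier_eq]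

theorem norm_schwartz_le (hν : ν ≤ 3) (hk : 1 ≤ k) (φ : 𝓢(Space ν, ℂ)) (x : Space ν) :
    ‖φ x‖ ≤ resolventNorm ν k * ‖((schwartzFree k φ).toLp 2 volume)‖ := by
  have := norm_schwartzResolvent_le hν hk (schwartzFree k φ) x
  rwa [schwartzResolvent_schwartzFree (by linarith)] at this

/-- Weak convergence to zero in `L²`. -/
def WeaklyNull (f : ℕ → L2 ν) : Prop :=
  ∀ g : L2 ν, Tendsto (fun n => inner ℂ g (f n)) atTop (nhds 0)

/-- Evaluation at `x` after the resolvent is a bounded functional on `L²`, so weak convergence gives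
pointwise convergence. -/
theorem tendsto_schwartzResolvent_apply (hν : ν ≤ 3) (hk : 1 ≤ k) {h : ℕ → 𝓢(Space ν, ℂ)}
    (hw : WeaklyNull fun n => ((h n).toLp 2 volume)) (x : Space ν) :
    Tendsto (fun n => schwartzResolvent k (h n) x) atTop (nhds 0) := by
  refine (hw (𝓕⁻ (evaluationKernel hν hk x))).congr fun n => ?_
  rw [schwartzResolvent_apply hν hk, ← Lp.inner_fourier_eq, fourier_fourierInv_eq]

/-- Dominated convergence with majorant `K |W|`. Together with the uniform and pointwise estimates
for the resolvent it plays the role of relative compactness of an `L²` potential. -/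
theorem tendsto_eLpNorm_mul {W : Space ν → ℝ} (hW : MemLp W 2 volume) {f : ℕ → Space ν → ℂ}
    (hf : ∀ n, Continuous (f n)) {K : ℝ} (hK : ∀ n x, ‖f n x‖ ≤ K)
    (h0 : ∀ x, Tendsto (fun n => f n x) atTop (nhds 0)) :
    Tendsto (fun n => eLpNorm (fun x => (W x : ℂ) * f n x) 2 volume) atTop (nhds 0) := by
  have h1 : Tendsto (fun n => ∫⁻ x, ‖(W x : ℂ) * f n x‖ₑ ^ (2 : ℝ)) atTop
      (nhds (∫⁻ _ : Space ν, 0)) := by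
    refine tendsto_lintegral_of_dominated_convergence'
      (fun x => (‖W x‖ₑ * ENNReal.ofReal K) ^ (2 : ℝ)) (fun n => ?_) (fun n => ?_) ?_ ?_
    · have := (Complex.continuous_ofReal.comp_aestronglyMeasurable hW.1).mul
        (hf n).aestronglyMeasurable (μ := volume)
      exact this.enorm.pow_const _
    · refine ae_of_all _ fun x => ?_
      simp only
      rw [enorm_mul]
      gcongr
      · rw [← ofReal_norm, ← ofReal_norm, Complex.norm_real]
      · rw [← ofReal_norm]
        exact ENNReal.ofReal_le_ofReal (hK n x)
    · have h3 := lintegral_rpow_enorm_lt_top_of_eLpNorm_lt_top (p := 2) (by simp) (by simp) hW.2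
      simp_rw [ENNReal.mul_rpow_of_nonneg _ _ zero_le_two]
      rw [lintegral_mul_const' _ _ (by simp)]
      exact ENNReal.mul_ne_top (by simpa using h3.ne) (by simp)
    · refine ae_of_all _ fun x => ?_
      have h2 : Tendsto (fun n => (W x : ℂ) * f n x) atTop (nhds 0) := by
        simpa using (h0 x).const_mul (W x : ℂ)
      have h3 := (h2.enorm).ennrpow_const 2
      simpa using h3
  rw [lintegral_zero] at h1
  have h2 := h1.ennrpow_const (1 / 2)
  rw [ENNReal.zero_rpow_of_pos (by norm_num)] at h2
  refine h2.congr fun n => ?_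
  rw [eLpNorm_eq_lintegral_rpow_enorm_toReal (by simp) (by simp)]
  simp

end PointwiseBounds

section Cutoffs

/-! ### Cutoff functions -/

theorem _root_.Function.HasTemperateGrowth.fderiv {E F : Type*} [NormedAddCommGroup E]
    [NormedSpace ℝ E] [NormedAddCommGroup F] [NormedSpace ℝ F] {f : E → F}
    (hf : f.HasTemperateGrowth) : (fderiv ℝ f).HasTemperateGrowth := by
  refine ⟨hf.1.fderiv_right (by simp), fun n => ?_⟩
  obtain ⟨k, C, h⟩ := hf.2 (n + 1)
  refine ⟨k, C, fun x => ?_⟩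
  rw [norm_iteratedFDeriv_fderiv]
  exact h x

variable {ν : ℕ} {k : ℝ}

/-- Multiplication of a Schwartz function by a real function of temperate growth. -/
def cutoffMul (χ : Space ν → ℝ) : 𝓢(Space ν, ℂ) →L[ℝ] 𝓢(Space ν, ℂ) :=
  SchwartzMap.smulLeftCLM ℂ χ

theorem cutoffMul_apply {χ : Space ν → ℝ} (hχ : χ.HasTemperateGrowth) (φ : 𝓢(Space ν, ℂ))
    (x : Space ν) : cutoffMul χ φ x = (χ x : ℂ) * φ x := by
  rw [cutoffMul, SchwartzMap.smulLeftCLM_apply_apply hχ, Complex.real_smul]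

theorem hasTemperateGrowth_partial {χ : Space ν → ℝ} (hχ : χ.HasTemperateGrowth) (m : Space ν) :
    (fun x => fderiv ℝ χ x m).HasTemperateGrowth :=
  ((ContinuousLinearMap.apply ℝ ℝ m).hasTemperateGrowth).comp hχ.fderiv

theorem lineDeriv_cutoffMul {χ : Space ν → ℝ} (hχ : χ.HasTemperateGrowth) (φ : 𝓢(Space ν, ℂ))
    (m : Space ν) :
    ∂_{m} (cutoffMul χ φ) =
      cutoffMul χ (∂_{m} φ) + cutoffMul (fun x => fderiv ℝ χ x m) φ := by
  ext x
  have h1 : HasFDerivAt χ (fderiv ℝ χ x) x :=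
    (hχ.1.differentiable (by simp)).differentiableAt.hasFDerivAt
  have h2 : HasFDerivAt (cutoffMul χ φ) (χ x • fderiv ℝ φ x + (fderiv ℝ χ x).smulRight (φ x)) x := by
    have e : ⇑(cutoffMul χ φ) = fun x => χ x • φ x := SchwartzMap.smulLeftCLM_apply hχ φ
    rw [e]
    exact h1.smul (φ.hasFDerivAt x)
  rw [SchwartzMap.lineDerivOp_apply_eq_fderiv, h2.fderiv, _root_.add_apply, _root_.add_apply,
    cutoffMul_apply hχ, cutoffMul_apply (hasTemperateGrowth_partial hχ m), SchwartzMap.lineDerivOp_apply_eq_fderiv]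
  simp

/-- Leibniz rule for the Laplacian. -/
theorem laplacian_cutoffMul {χ : Space ν → ℝ} (hχ : χ.HasTemperateGrowth) (φ : 𝓢(Space ν, ℂ))
    (x : Space ν) :
    Δ (cutoffMul χ φ) x = (χ x : ℂ) * Δ φ x +
      ∑ i, (2 * (fderiv ℝ χ x (EuclideanSpace.basisFun (Fin ν) ℝ i) : ℂ) *
          (∂_{EuclideanSpace.basisFun (Fin ν) ℝ i} φ) x +
        (fderiv ℝ (fderiv ℝ χ) x (EuclideanSpace.basisFun (Fin ν) ℝ i)
          (EuclideanSpace.basisFun (Fin ν) ℝ i) : ℂ) * φ x) := by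
  rw [SchwartzMap.laplacian_eq_sum (EuclideanSpace.basisFun (Fin ν) ℝ),
    SchwartzMap.laplacian_eq_sum (EuclideanSpace.basisFun (Fin ν) ℝ), _root_.sum_apply,
    _root_.sum_apply, Finset.mul_sum, ← Finset.sum_add_distrib]
  refine Finset.sum_congr rfl fun i _ => ?_
  set m := EuclideanSpace.basisFun (Fin ν) ℝ i
  have hm := hasTemperateGrowth_partial hχ m
  have hmm := hasTemperateGrowth_partial hm m
  have h2 : fderiv ℝ (fun x => fderiv ℝ χ x m) x m = fderiv ℝ (fderiv ℝ χ) x m m := by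
    have h3 : HasFDerivAt (fderiv ℝ χ) (fderiv ℝ (fderiv ℝ χ) x) x :=
      (hχ.fderiv.1.differentiable (by simp)).differentiableAt.hasFDerivAt
    have h4 := h3.clm_apply (hasFDerivAt_const m x)
    rw [h4.fderiv]
    simp
  rw [lineDeriv_cutoffMul hχ, LineDeriv.lineDerivOp_add, lineDeriv_cutoffMul hχ, lineDeriv_cutoffMul hm]
  simp only [_root_.add_apply, cutoffMul_apply hχ, cutoffMul_apply hm, cutoffMul_apply hmm, h2]
  ring

/-- A smooth cutoff function with first and second derivatives bounded by `K`. -/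
structure IsCutoff {E : Type*} [NormedAddCommGroup E] [NormedSpace ℝ E] (χ : E → ℝ) (K : ℝ) :
    Prop where
  growth : χ.HasTemperateGrowth
  abs_le_one : ∀ x, |χ x| ≤ 1
  bound_one : ∀ x, ‖iteratedFDeriv ℝ 1 χ x‖ ≤ K
  bound_two : ∀ x, ‖iteratedFDeriv ℝ 2 χ x‖ ≤ K

/-- The first order expression that controls commutators of `-Δ` with cutoff functions. -/
def gradientMajorant (φ : 𝓢(Space ν, ℂ)) (x : Space ν) : ℝ :=
  ∑ i, (2 * ‖(∂_{EuclideanSpace.basisFun (Fin ν) ℝ i} φ) x‖ + ‖φ x‖)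

theorem gradientMajorant_nonneg (φ : 𝓢(Space ν, ℂ)) (x : Space ν) : 0 ≤ gradientMajorant φ x :=
  Finset.sum_nonneg fun _ _ => by positivity

/-- The commutator contains only derivatives of `χ`. The indicator of `tsupport χ` is kept so that
the bounds for many wells can be added up. -/
theorem norm_laplacian_cutoffMul_sub_le {χ : Space ν → ℝ} {K : ℝ} (hχ : IsCutoff χ K)
    (φ : 𝓢(Space ν, ℂ)) (x : Space ν) :
    ‖Δ (cutoffMul χ φ) x - (χ x : ℂ) * Δ φ x‖ ≤
      (tsupport χ).indicator (fun x => K * gradientMajorant φ x) x := by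
  rw [laplacian_cutoffMul hχ.growth, add_sub_cancel_left]
  have hb1 : ‖fderiv ℝ χ x‖ = ‖iteratedFDeriv ℝ 1 χ x‖ := by
    rw [← norm_iteratedFDeriv_fderiv, norm_iteratedFDeriv_zero]
  have hb2 : ‖fderiv ℝ (fderiv ℝ χ) x‖ = ‖iteratedFDeriv ℝ 2 χ x‖ := by
    rw [← norm_iteratedFDeriv_fderiv, ← norm_iteratedFDeriv_fderiv, norm_iteratedFDeriv_zero]
  by_cases hx : x ∈ tsupport χ
  · rw [Set.indicator_of_mem hx, gradientMajorant, Finset.mul_sum]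
    refine norm_sum_le_of_le _ fun i _ => ?_
    set m := EuclideanSpace.basisFun (Fin ν) ℝ i
    have hm : ‖m‖ = 1 := (EuclideanSpace.basisFun (Fin ν) ℝ).norm_eq_one i
    have h1 : |fderiv ℝ χ x m| ≤ K := by
      have := (fderiv ℝ χ x).le_opNorm m
      rw [hm, mul_one, hb1] at this
      exact this.trans (hχ.bound_one x)
    have h2 : |fderiv ℝ (fderiv ℝ χ) x m m| ≤ K := by
      have := (fderiv ℝ (fderiv ℝ χ) x).le_opNorm₂ m m
      rw [hm, mul_one, mul_one, hb2] at this
      exact this.trans (hχ.bound_two x)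
    refine (norm_add_le _ _).trans ?_
    rw [norm_mul, norm_mul, norm_mul, Complex.norm_real, Complex.norm_real, Complex.norm_ofNat,
      Real.norm_eq_abs, Real.norm_eq_abs]
    calc _ ≤ 2 * K * ‖(∂_{m} φ) x‖ + K * ‖φ x‖ := by gcongr
      _ = _ := by ring
  · rw [Set.indicator_of_notMem hx]
    have h1 : fderiv ℝ χ x = 0 := by
      rw [← norm_eq_zero, hb1, norm_eq_zero]
      by_contra h
      exact hx (support_iteratedFDeriv_subset 1 h)
    have h3 : iteratedFDeriv ℝ 2 χ x = 0 := by
      by_contra h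
      exact hx (support_iteratedFDeriv_subset 2 h)
    have h2 : ∀ m, fderiv ℝ (fderiv ℝ χ) x m m = 0 := by
      intro m
      have := (fderiv ℝ (fderiv ℝ χ) x).le_opNorm₂ m m
      rw [hb2, h3, norm_zero, zero_mul, zero_mul] at this
      exact norm_le_zero_iff.mp this
    simp [h1, h2]

/-! ### Norm bounds in terms of the free operator -/

theorem norm_toLp_le_of_fourier_le {φ χ : 𝓢(Space ν, ℂ)} (h : ∀ ξ, ‖𝓕 φ ξ‖ ≤ ‖𝓕 χ ξ‖) :
    ‖(φ.toLp 2 volume)‖ ≤ ‖(χ.toLp 2 volume)‖ := by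
  rw [← SchwartzMap.norm_fourier_toL2_eq φ, ← SchwartzMap.norm_fourier_toL2_eq χ]
  refine Lp.norm_le_norm_of_ae_le ?_
  filter_upwards [SchwartzMap.coeFn_toLp (𝓕 φ) 2 volume, SchwartzMap.coeFn_toLp (𝓕 χ) 2 volume]
    with ξ h1 h2
  rw [h1, h2]
  exact h ξ

theorem norm_fourier_schwartzFree (hk : 0 < k) (φ : 𝓢(Space ν, ℂ)) (ξ : Space ν) :
    ‖𝓕 (schwartzFree k φ) ξ‖ = freeSymbol k ξ * ‖𝓕 φ ξ‖ := by
  rw [schwartzFree_eq_fourierMultiplier, SchwartzMap.fourierMultiplierCLM_apply,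
    fourier_fourierInv_eq, SchwartzMap.smulLeftCLM_apply_apply
      (hasTemperateGrowth_ofReal (hasTemperateGrowth_freeSymbol k)), norm_smul, Complex.norm_real,
    Real.norm_of_nonneg (freeSymbol_pos hk ξ).le]

theorem one_le_freeSymbol (hk : 1 ≤ k) (ξ : Space ν) : 1 ≤ freeSymbol k ξ := by
  have h1 : 1 ≤ 2 * π * k := by
    have := Real.pi_gt_three
    nlinarith
  have h2 : 1 ≤ (2 * π * k) ^ 2 := one_le_pow₀ h1
  have : 0 ≤ (2 * π) ^ 2 * ‖ξ‖ ^ 2 := by positivity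
  unfold freeSymbol
  linarith

theorem norm_toLp_le_schwartzFree (hk : 1 ≤ k) (φ : 𝓢(Space ν, ℂ)) :
    ‖(φ.toLp 2 volume)‖ ≤ ‖((schwartzFree k φ).toLp 2 volume)‖ := by
  refine norm_toLp_le_of_fourier_le fun ξ => ?_
  rw [norm_fourier_schwartzFree (by linarith)]
  exact le_mul_of_one_le_left (norm_nonneg _) (one_le_freeSymbol hk ξ)

theorem norm_lineDeriv_toLp_le_schwartzFree (hk : 1 ≤ k) (φ : 𝓢(Space ν, ℂ)) {m : Space ν}
    (hm : ‖m‖ = 1) :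
    ‖((∂_{m} φ : 𝓢(Space ν, ℂ)).toLp 2 volume)‖ ≤ ‖((schwartzFree k φ).toLp 2 volume)‖ := by
  refine norm_toLp_le_of_fourier_le fun ξ => ?_
  rw [norm_fourier_schwartzFree (by linarith), SchwartzMap.fourier_lineDerivOp_eq,
    _root_.smul_apply, SchwartzMap.smulLeftCLM_apply_apply (by fun_prop), norm_smul, norm_smul,
    ← mul_assoc]
  gcongr
  have h1 : ‖(2 * π * Complex.I : ℂ)‖ = 2 * π := by
    rw [norm_mul, Complex.norm_I, mul_one, norm_mul, Complex.norm_real, Complex.norm_ofNat,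
      Real.norm_of_nonneg Real.pi_pos.le]
  rw [h1]
  have h2 : ‖inner ℝ ξ m‖ ≤ ‖ξ‖ := by simpa [hm] using norm_inner_le_norm (𝕜 := ℝ) ξ m
  have h3 : 1 ≤ (2 * π * k) ^ 2 := one_le_pow₀ (by
    have := Real.pi_gt_three
    nlinarith)
  have h4 : 2 * π * ‖inner ℝ ξ m‖ ≤ 2 * π * ‖ξ‖ := by gcongr
  unfold freeSymbol
  -- This is `t ≤ t² + 1` for `t = 2π‖ξ‖`.
  nlinarith [sq_nonneg (2 * π * ‖ξ‖ - 1)]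

theorem eLpNorm_toLp (φ : 𝓢(Space ν, ℂ)) :
    eLpNorm φ 2 volume = ENNReal.ofReal ‖(φ.toLp 2 volume)‖ := by
  rw [SchwartzMap.norm_toLp, ENNReal.ofReal_toReal]
  exact (φ.memLp 2 volume).2.ne

theorem continuous_gradientMajorant (φ : 𝓢(Space ν, ℂ)) : Continuous (gradientMajorant φ) := by
  unfold gradientMajorant
  refine continuous_finsetSum _ fun i _ => ?_
  have := (∂_{EuclideanSpace.basisFun (Fin ν) ℝ i} φ : 𝓢(Space ν, ℂ)).continuous
  have := φ.continuous
  fun_prop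

theorem eLpNorm_gradientMajorant_le (hk : 1 ≤ k) (φ : 𝓢(Space ν, ℂ)) :
    eLpNorm (gradientMajorant φ) 2 volume ≤
      ENNReal.ofReal (3 * ν * ‖((schwartzFree k φ).toLp 2 volume)‖) := by
  have h : gradientMajorant φ = ∑ i, fun x =>
      (2 * ‖(∂_{EuclideanSpace.basisFun (Fin ν) ℝ i} φ) x‖ + ‖φ x‖) := by
    ext x; simp [gradientMajorant]
  set N := ‖((schwartzFree k φ).toLp 2 volume)‖
  have hN : 0 ≤ N := norm_nonneg _
  rw [h]
  have hφ := φ.continuous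
  have h1 : ∀ i : Fin ν, eLpNorm (fun x =>
      (2 * ‖(∂_{EuclideanSpace.basisFun (Fin ν) ℝ i} φ) x‖ + ‖φ x‖)) 2 volume ≤
        ENNReal.ofReal (3 * N) := by
    intro i
    set m := EuclideanSpace.basisFun (Fin ν) ℝ i
    have hm : ‖m‖ = 1 := (EuclideanSpace.basisFun (Fin ν) ℝ).norm_eq_one i
    have hc := (∂_{m} φ : 𝓢(Space ν, ℂ)).continuous
    have e1 : eLpNorm (fun x => (2 : ℝ) * ‖(∂_{m} φ) x‖) 2 volume ≤ ENNReal.ofReal (2 * N) := by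
      have := eLpNorm_const_smul (2 : ℝ) (fun x => ‖(∂_{m} φ) x‖) 2 (volume : Measure (Space ν))
      refine this.le.trans ?_
      rw [eLpNorm_norm, eLpNorm_toLp, ENNReal.ofReal_mul zero_le_two, ← ofReal_norm]
      gcongr
      · simp
      · exact norm_lineDeriv_toLp_le_schwartzFree hk φ hm
    have e2 : eLpNorm (fun x => ‖φ x‖) 2 volume ≤ ENNReal.ofReal N := by
      rw [eLpNorm_norm, eLpNorm_toLp]
      exact ENNReal.ofReal_le_ofReal (norm_toLp_le_schwartzFree hk φ)
    refine (eLpNorm_add_le (by fun_prop) (by fun_prop) (by norm_num)).trans ?_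
    refine (add_le_add e1 e2).trans ?_
    rw [← ENNReal.ofReal_add (by positivity) hN]
    exact ENNReal.ofReal_le_ofReal (by linarith)
  refine (eLpNorm_sum_le (fun i _ => ?_) (by norm_num)).trans ?_
  · have hc := (∂_{EuclideanSpace.basisFun (Fin ν) ℝ i} φ : 𝓢(Space ν, ℂ)).continuous
    exact Continuous.aestronglyMeasurable (by fun_prop)
  · refine (Finset.sum_le_sum fun i _ => h1 i).trans ?_
    rw [Finset.sum_const, Finset.card_univ, Fintype.card_fin, nsmul_eq_mul,
      ← ENNReal.ofReal_natCast, ← ENNReal.ofReal_mul (by positivity)]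
    exact ENNReal.ofReal_le_ofReal (by linarith)

end Cutoffs

section RelativeBound

/-! ### Construction of cutoff functions: bumps, smooth steps, and their compositions with linear
functionals. -/

section CutoffConstruction

variable {E : Type*} [NormedAddCommGroup E] [NormedSpace ℝ E]

/-- Compact support is required of the derivative only, so that smooth steps are covered as well as
bumps. -/
theorem exists_isCutoff {f : E → ℝ} (hf : ContDiff ℝ ∞ f) (h1 : ∀ x, |f x| ≤ 1)
    (hc : HasCompactSupport (fderiv ℝ f)) : ∃ K, 0 ≤ K ∧ IsCutoff f K := by
  have hd : ContDiff ℝ ∞ (fderiv ℝ f) := hf.fderiv_right (by simp)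
  obtain ⟨K0, hK0⟩ := hd.continuous.bounded_above_of_compact_support hc
  obtain ⟨K1, hK1⟩ := (hd.continuous_iteratedFDeriv (m := 1)
    (mod_cast le_top)).bounded_above_of_compact_support (hc.iteratedFDeriv 1)
  refine ⟨max K0 K1, ((norm_nonneg _).trans (hK0 0)).trans (le_max_left _ _), ?_, h1,
    fun x => ?_, fun x => ?_⟩
  · exact Function.HasTemperateGrowth.of_fderiv (hc.hasTemperateGrowth hd)
      (hf.differentiable (by simp)) (k := 0) (C := 1) (fun x => by simpa using h1 x)
  · rw [← norm_iteratedFDeriv_fderiv, norm_iteratedFDeriv_zero]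
    exact (hK0 x).trans (le_max_left _ _)
  · rw [← norm_iteratedFDeriv_fderiv]
    exact (hK1 x).trans (le_max_right _ _)

theorem IsCutoff.comp_sub {χ : E → ℝ} {K : ℝ} (hχ : IsCutoff χ K) (y : E) :
    IsCutoff (fun x => χ (x - y)) K where
  growth := hχ.growth.comp (f := fun x => x - y) (by fun_prop)
  abs_le_one x := hχ.abs_le_one _
  bound_one x := by rw [iteratedFDeriv_comp_sub]; exact hχ.bound_one _
  bound_two x := by rw [iteratedFDeriv_comp_sub]; exact hχ.bound_two _

theorem norm_iteratedFDeriv_comp_clm_le {η : ℝ → ℝ} (hη : ContDiff ℝ ∞ η) (L : E →L[ℝ] ℝ) (x : E)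
    (i : ℕ) : ‖iteratedFDeriv ℝ i (fun x => η (L x)) x‖ ≤
      ‖iteratedFDeriv ℝ i η (L x)‖ * ‖L‖ ^ i := by
  have h := L.iteratedFDeriv_comp_right hη x (i := i) (mod_cast le_top)
  rw [Function.comp_def] at h
  rw [h]
  refine (ContinuousMultilinearMap.norm_compContinuousLinearMap_le _ _).trans ?_
  rw [Finset.prod_const, Finset.card_univ, Fintype.card_fin]

/-- Composition with a small functional makes the cutoff vary slowly. The condition `‖L‖ ≤ 1` lets
the factor `‖L‖²` of the second derivative be absorbed into `‖L‖`. -/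
theorem IsCutoff.comp_clm {η : ℝ → ℝ} {K : ℝ} (hK : 0 ≤ K) (hη : IsCutoff η K) {L : E →L[ℝ] ℝ}
    (hL : ‖L‖ ≤ 1) : IsCutoff (fun x => η (L x)) (K * ‖L‖) where
  growth := hη.growth.comp L.hasTemperateGrowth
  abs_le_one x := hη.abs_le_one _
  bound_one x := by
    refine (norm_iteratedFDeriv_comp_clm_le hη.growth.1 L x 1).trans ?_
    rw [pow_one]
    exact mul_le_mul_of_nonneg_right (hη.bound_one _) (norm_nonneg _)
  bound_two x := by
    refine (norm_iteratedFDeriv_comp_clm_le hη.growth.1 L x 2).trans ?_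
    refine mul_le_mul (hη.bound_two _) ?_ (by positivity) hK
    rw [sq]
    exact mul_le_of_le_one_left (norm_nonneg _) hL

theorem exists_ball_cutoff [FiniteDimensional ℝ E] [HasContDiffBump E] {r : ℝ} (hr : 0 < r) :
    ∃ (χ : E → ℝ) (K : ℝ), 0 ≤ K ∧ IsCutoff χ K ∧ (∀ x ∈ Metric.ball (0 : E) r, χ x = 1) ∧
      tsupport χ ⊆ Metric.closedBall 0 (2 * r) := by
  let f : ContDiffBump (0 : E) := ⟨r, 2 * r, hr, by linarith⟩
  obtain ⟨K, hK, hf⟩ := exists_isCutoff (f := f) f.contDiff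
    (fun x => abs_le.mpr ⟨by linarith [f.nonneg (x := x)], f.le_one⟩)
    (f.hasCompactSupport.fderiv (𝕜 := ℝ))
  exact ⟨f, K, hK, hf, fun x hx => f.one_of_mem_closedBall (Metric.ball_subset_closedBall hx),
    f.tsupport_eq.le⟩

theorem hasCompactSupport_fderiv_smoothTransition :
    HasCompactSupport (fderiv ℝ Real.smoothTransition) := by
  refine HasCompactSupport.intro (isCompact_Icc (a := (0 : ℝ)) (b := 1)) fun x hx => ?_
  rw [Set.mem_Icc, not_and_or, not_le, not_le] at hx
  rcases hx with hx | hx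
  · have : Real.smoothTransition =ᶠ[nhds x] fun _ => 0 := by
      filter_upwards [gt_mem_nhds hx] with y hy
      exact Real.smoothTransition.zero_of_nonpos hy.le
    rw [this.fderiv_eq]; simp
  · have : Real.smoothTransition =ᶠ[nhds x] fun _ => 1 := by
      filter_upwards [lt_mem_nhds hx] with y hy
      exact Real.smoothTransition.one_of_one_le hy.le
    rw [this.fderiv_eq]; simp

/-- A partition of unity of the line into a part supported in `[0, ∞)` and a part supported in
`(-∞, 1]`. -/
theorem exists_partition : ∃ (η : ℝ → ℝ) (K : ℝ), 0 ≤ K ∧ IsCutoff η K ∧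
    IsCutoff (fun t => 1 - η t) K ∧ (∀ t ≤ 0, η t = 0) ∧ ∀ t, 1 ≤ t → η t = 1 := by
  obtain ⟨K1, hK1, h1⟩ := exists_isCutoff (f := Real.smoothTransition)
    Real.smoothTransition.contDiff (fun x => abs_le.mpr
      ⟨by linarith [Real.smoothTransition.nonneg x], Real.smoothTransition.le_one x⟩)
    hasCompactSupport_fderiv_smoothTransition
  obtain ⟨K2, hK2, h2⟩ := exists_isCutoff (f := fun t => 1 - Real.smoothTransition t)
    (contDiff_const.sub Real.smoothTransition.contDiff) (fun x => abs_le.mpr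
      ⟨by linarith [Real.smoothTransition.le_one x], by linarith [Real.smoothTransition.nonneg x]⟩)
    (by
      have : fderiv ℝ (fun t => 1 - Real.smoothTransition t) = -fderiv ℝ Real.smoothTransition := by
        ext x
        simp [fderiv_const_sub]
      rw [this]
      exact hasCompactSupport_fderiv_smoothTransition.neg)
  have hmono : ∀ {g : ℝ → ℝ} {K K' : ℝ}, K ≤ K' → IsCutoff g K → IsCutoff g K' :=
    fun hle hg => ⟨hg.growth, hg.abs_le_one, fun x => (hg.bound_one x).trans hle,
      fun x => (hg.bound_two x).trans hle⟩
  exact ⟨_, max K1 K2, hK1.trans (le_max_left _ _), hmono (le_max_left _ _) h1,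
    hmono (le_max_right _ _) h2, fun t => Real.smoothTransition.zero_of_nonpos,
    fun t => Real.smoothTransition.one_of_one_le⟩

end CutoffConstruction

/-! ### The relative bound for arrays of separated wells -/

variable {ν : ℕ} {k : ℝ}

/-- Bounded overlap of the doubled balls. After rescaling by `(2ρ)⁻¹` about `x`, the relevant
centres are `1`-separated points of a fixed ball, and a volume count bounds their number. -/
theorem sum_indicator_le {Y : ℤ → Space ν} {ρ : ℝ} (hρ : 0 < ρ)
    (hY : ∀ i j, i ≠ j → 2 * ρ ≤ dist (Y i) (Y j)) (x : Space ν) :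
    ∑' i, (Metric.closedBall (Y i) (2 * ρ)).indicator (fun _ => (1 : ℝ≥0∞)) x ≤ 5 ^ ν := by
  classical
  rw [ENNReal.tsum_eq_iSup_sum]
  refine iSup_le fun s => ?_
  have h1 : ∑ i ∈ s, (Metric.closedBall (Y i) (2 * ρ)).indicator (fun _ => (1 : ℝ≥0∞)) x =
      ((s.filter fun i => x ∈ Metric.closedBall (Y i) (2 * ρ)).card : ℝ≥0∞) := by
    simp [Set.indicator_apply]
  rw [h1]
  set t := s.filter fun i => x ∈ Metric.closedBall (Y i) (2 * ρ)
  let g : ℤ → Space ν := fun i => (2 * ρ)⁻¹ • (Y i - x)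
  have hg : ∀ i j, ‖g i - g j‖ = (2 * ρ)⁻¹ * dist (Y i) (Y j) := by
    intro i j
    simp only [g]
    rw [← smul_sub, sub_sub_sub_cancel_right, norm_smul, dist_eq_norm,
      Real.norm_of_nonneg (by positivity)]
  have hsep : ∀ i j, i ≠ j → 1 ≤ ‖g i - g j‖ := by
    intro i j hij
    rw [hg, ← div_eq_inv_mul, one_le_div (by positivity)]
    exact hY i j hij
  have hinj : Function.Injective g := by
    intro i j hij
    by_contra hne
    have := hsep i j hne
    rw [hij, sub_self, norm_zero] at this
    linarith
  have h2 := Besicovitch.card_le_of_separated (t.image g) (by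
    intro c hc
    obtain ⟨i, hi, rfl⟩ := Finset.mem_image.mp hc
    have hi2 := (Finset.mem_filter.mp hi).2
    rw [Metric.mem_closedBall, dist_comm, dist_eq_norm] at hi2
    simp only [g]
    rw [norm_smul, Real.norm_of_nonneg (by positivity), inv_mul_le_iff₀ (by positivity)]
    linarith) (by
    intro c hc d hd hcd
    obtain ⟨i, hi, rfl⟩ := Finset.mem_image.mp hc
    obtain ⟨j, hj, rfl⟩ := Finset.mem_image.mp hd
    exact hsep i j fun h => hcd (by rw [h]))
  rw [Finset.card_image_of_injective _ hinj, finrank_euclideanSpace_fin] at h2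
  exact_mod_cast h2

theorem eLpNorm_two_sq {F : Type*} [NormedAddCommGroup F] (f : Space ν → F) :
    eLpNorm f 2 volume ^ 2 = ∫⁻ x, ‖f x‖ₑ ^ 2 := by
  rw [eLpNorm_eq_lintegral_rpow_enorm_toReal (by simp) (by simp), ← ENNReal.rpow_natCast,
    ← ENNReal.rpow_mul]
  simp

/-- A family of wells supported in disjoint balls, with uniformly bounded `L²` norms. -/
structure IsWellFamily (Y : ℤ → Space ν) (ρ v : ℝ) (W : ℤ → Space ν → ℝ) : Prop where
  separated : ∀ i j, i ≠ j → 2 * ρ ≤ dist (Y i) (Y j)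
  measurable : ∀ i, AEStronglyMeasurable (W i) volume
  support : ∀ i x, x ∉ Metric.ball (Y i) ρ → W i x = 0
  norm_le : ∀ i, eLpNorm (W i) 2 volume ≤ ENNReal.ofReal v

theorem IsWellFamily.eq_single {Y : ℤ → Space ν} {ρ v : ℝ} {W : ℤ → Space ν → ℝ}
    (hW : IsWellFamily Y ρ v W) {x : Space ν} {i : ℤ} (hx : x ∈ Metric.ball (Y i) ρ) :
    ∀ j, j ≠ i → W j x = 0 := by
  intro j hj
  refine hW.support j x fun hxj => ?_
  have h1 := hW.separated j i hj
  have h2 := dist_triangle_left (Y j) (Y i) x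
  rw [Metric.mem_ball] at hx hxj
  linarith

/-- At most one term is nonzero at each point, so squaring commutes with the sum. -/
theorem IsWellFamily.enorm_tsum_mul_sq {Y : ℤ → Space ν} {ρ v : ℝ} {W : ℤ → Space ν → ℝ}
    (hW : IsWellFamily Y ρ v W) (x : Space ν) (c : ℂ) :
    ‖((∑' i, W i x : ℝ) : ℂ) * c‖ₑ ^ 2 = ∑' i, ‖(W i x : ℂ) * c‖ₑ ^ 2 := by
  by_cases h : ∃ i, x ∈ Metric.ball (Y i) ρ
  · obtain ⟨i, hi⟩ := h
    rw [tsum_eq_single i (hW.eq_single hi), tsum_eq_single i]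
    intro j hj
    rw [hW.eq_single hi j hj]
    simp
  · push Not at h
    have : ∀ i, W i x = 0 := fun i => hW.support i x (h i)
    simp [this]

theorem eLpNorm_well_mul_le {W : Space ν → ℝ} {y : Space ν} {ρ v S : ℝ}
    (hs : ∀ x, x ∉ Metric.ball y ρ → W x = 0) (hv : eLpNorm W 2 volume ≤ ENNReal.ofReal v)
    {f : Space ν → ℂ} (hf : ∀ x ∈ Metric.ball y ρ, ‖f x‖ ≤ S) :
    ∫⁻ x, ‖(W x : ℂ) * f x‖ₑ ^ 2 ≤ ENNReal.ofReal v ^ 2 * ENNReal.ofReal S ^ 2 := by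
  calc ∫⁻ x, ‖(W x : ℂ) * f x‖ₑ ^ 2 ≤ ∫⁻ x, ‖W x‖ₑ ^ 2 * ENNReal.ofReal S ^ 2 := by
        refine lintegral_mono fun x => ?_
        simp only
        rw [enorm_mul, mul_pow]
        by_cases hx : x ∈ Metric.ball y ρ
        · gcongr
          · rw [← ofReal_norm, ← ofReal_norm, Complex.norm_real]
          · rw [← ofReal_norm]
            exact ENNReal.ofReal_le_ofReal (hf x hx)
        · simp [hs x hx]
    _ = eLpNorm W 2 volume ^ 2 * ENNReal.ofReal S ^ 2 := by
        rw [lintegral_mul_const' _ _ (by simp), eLpNorm_two_sq]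
    _ ≤ _ := by gcongr

theorem schwartzFree_apply (k : ℝ) (φ : 𝓢(Space ν, ℂ)) (x : Space ν) :
    schwartzFree k φ x = -Δ φ x + (((2 * π * k) ^ 2 : ℝ) : ℂ) * φ x := by
  simp [schwartzFree]

theorem norm_schwartzFree_cutoffMul_sub_le {χ : Space ν → ℝ} {K : ℝ} (hχ : IsCutoff χ K) (k : ℝ)
    (φ : 𝓢(Space ν, ℂ)) (x : Space ν) :
    ‖schwartzFree k (cutoffMul χ φ) x - (χ x : ℂ) * schwartzFree k φ x‖ ≤
      (tsupport χ).indicator (fun x => K * gradientMajorant φ x) x := by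
  refine le_trans (le_of_eq ?_) (norm_laplacian_cutoffMul_sub_le hχ φ x)
  rw [schwartzFree_apply, schwartzFree_apply, cutoffMul_apply hχ.growth, ← norm_neg]
  congr 1
  ring

theorem enorm_schwartzFree_cutoffMul_sq_le {χ : Space ν → ℝ} {K : ℝ} (hK : 0 ≤ K)
    (hχ : IsCutoff χ K) {s : Set (Space ν)} (hs : tsupport χ ⊆ s) (k : ℝ) (φ : 𝓢(Space ν, ℂ))
    (x : Space ν) :
    ‖schwartzFree k (cutoffMul χ φ) x‖ₑ ^ 2 ≤
      s.indicator (fun _ => (1 : ℝ≥0∞)) x * ‖‖schwartzFree k φ x‖ + K * gradientMajorant φ x‖ₑ ^ 2 := by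
  have h1 := norm_schwartzFree_cutoffMul_sub_le hχ k φ x
  have hG := gradientMajorant_nonneg φ x
  by_cases hx : x ∈ s
  · rw [Set.indicator_of_mem hx, one_mul]
    gcongr
    rw [← ofReal_norm, ← ofReal_norm]
    refine ENNReal.ofReal_le_ofReal ?_
    rw [Real.norm_of_nonneg (by positivity)]
    have h2 : (tsupport χ).indicator (fun x => K * gradientMajorant φ x) x ≤
        K * gradientMajorant φ x := Set.indicator_le_self'
        (fun _ _ => mul_nonneg hK (gradientMajorant_nonneg φ _)) x
    have h3 : ‖(χ x : ℂ) * schwartzFree k φ x‖ ≤ ‖schwartzFree k φ x‖ := by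
      rw [norm_mul, Complex.norm_real]
      exact mul_le_of_le_one_left (norm_nonneg _) (hχ.abs_le_one x)
    have h4 := norm_le_norm_add_norm_sub' (schwartzFree k (cutoffMul χ φ) x)
      ((χ x : ℂ) * schwartzFree k φ x)
    linarith
  · have hx' : x ∉ tsupport χ := fun h => hx (hs h)
    rw [Set.indicator_of_notMem hx', image_eq_zero_of_notMem_tsupport hx'] at h1
    simp only [Complex.ofReal_zero, zero_mul, sub_zero] at h1
    rw [norm_le_zero_iff.mp h1]
    simp

theorem eLpNorm_free_add_majorant_le {K : ℝ} (hK : 0 ≤ K) (hk : 1 ≤ k) (φ : 𝓢(Space ν, ℂ)) :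
    eLpNorm (fun x => ‖schwartzFree k φ x‖ + K * gradientMajorant φ x) 2 volume ≤
      ENNReal.ofReal ((1 + 3 * ν * K) * ‖((schwartzFree k φ).toLp 2 volume)‖) := by
  have hc := (schwartzFree k φ).continuous
  have hG := continuous_gradientMajorant φ
  refine (eLpNorm_add_le (by fun_prop) (by fun_prop) (by norm_num)).trans ?_
  have e1 := (eLpNorm_const_smul K (gradientMajorant φ) 2 (volume : Measure (Space ν))).le.trans
    (mul_le_mul_right (eLpNorm_gradientMajorant_le hk φ) _)
  rw [← ofReal_norm, Real.norm_of_nonneg hK, ← ENNReal.ofReal_mul hK] at e1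
  rw [eLpNorm_norm, eLpNorm_toLp]
  refine (add_le_add le_rfl e1).trans ?_
  rw [← ENNReal.ofReal_add (by positivity) (by positivity)]
  exact ENNReal.ofReal_le_ofReal (by linarith)

/-- On the `i`-th ball `φ` equals `χi i φ`, and its supremum is controlled by the `L²` norm of `(-Δ
+ (2πk)²)(χi i φ)`. That norm only sees the doubled ball, so the squares of the local bounds add up
to a multiple of the global norm by bounded overlap. -/
theorem IsWellFamily.eLpNorm_mul_le (hν : ν ≤ 3) {Y : ℤ → Space ν} {ρ v : ℝ} (hρ : 0 < ρ)
    (hv : 0 ≤ v) {W : ℤ → Space ν → ℝ} (hW : IsWellFamily Y ρ v W) {χ : Space ν → ℝ} {K : ℝ}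
    (hK : 0 ≤ K) (hχ : IsCutoff χ K) (hχ1 : ∀ x ∈ Metric.ball (0 : Space ν) ρ, χ x = 1)
    (hχs : tsupport χ ⊆ Metric.closedBall 0 (2 * ρ)) (hk : 1 ≤ k) (φ : 𝓢(Space ν, ℂ)) :
    eLpNorm (fun x => ((∑' i, W i x : ℝ) : ℂ) * φ x) 2 volume ≤
      ENNReal.ofReal (v * resolventNorm ν k * 5 ^ ν * (1 + 3 * ν * K) *
        ‖((schwartzFree k φ).toLp 2 volume)‖) := by
  have hM : 0 ≤ resolventNorm ν k := Real.sqrt_nonneg _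
  let χi : ℤ → Space ν → ℝ := fun i x => χ (x - Y i)
  have hχi : ∀ i, IsCutoff (χi i) K := fun i => hχ.comp_sub (Y i)
  have hsupp : ∀ i, tsupport (χi i) ⊆ Metric.closedBall (Y i) (2 * ρ) := by
    intro i
    refine closure_minimal (fun x hx => ?_) Metric.isClosed_closedBall
    have := hχs (subset_tsupport _ (Function.mem_support.mpr hx))
    rwa [mem_closedBall_zero_iff, ← dist_eq_norm] at this
  let F : Space ν → ℝ≥0∞ := fun x => ‖‖schwartzFree k φ x‖ + K * gradientMajorant φ x‖ₑ ^ 2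
  have hF : Measurable F := by
    have hc := (schwartzFree k φ).continuous
    have hG := continuous_gradientMajorant φ
    exact (Continuous.measurable (by fun_prop)).enorm.pow_const _
  have h1 : ∀ i, ∫⁻ x, ‖(W i x : ℂ) * φ x‖ₑ ^ 2 ≤
      ENNReal.ofReal v ^ 2 * ENNReal.ofReal (resolventNorm ν k) ^ 2 *
        ∫⁻ x, (Metric.closedBall (Y i) (2 * ρ)).indicator (fun _ => (1 : ℝ≥0∞)) x * F x := by
    intro i
    have e1 := eLpNorm_well_mul_le (hW.support i) (hW.norm_le i)
      (f := φ) (S := resolventNorm ν k *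
        ‖((schwartzFree k (cutoffMul (χi i) φ)).toLp 2 volume)‖) (by
      intro x hx
      have := norm_schwartz_le hν hk (cutoffMul (χi i) φ) x
      rw [cutoffMul_apply (hχi i).growth] at this
      have hone : χi i x = 1 := hχ1 _ (by
        rw [mem_ball_zero_iff, ← dist_eq_norm]; exact hx)
      rwa [hone, Complex.ofReal_one, one_mul] at this)
    refine e1.trans ?_
    rw [ENNReal.ofReal_mul hM, mul_pow, ← mul_assoc, ← eLpNorm_toLp, eLpNorm_two_sq]
    gcongr with x
    exact enorm_schwartzFree_cutoffMul_sq_le hK (hχi i) (hsupp i) k φ x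
  have h2 : ∑' i, ∫⁻ x, (Metric.closedBall (Y i) (2 * ρ)).indicator (fun _ => (1 : ℝ≥0∞)) x * F x ≤
      5 ^ ν * ∫⁻ x, F x := by
    have e := lintegral_tsum (μ := (volume : Measure (Space ν))) (f := fun i x =>
      (Metric.closedBall (Y i) (2 * ρ)).indicator (fun _ => (1 : ℝ≥0∞)) x * F x) fun i =>
        ((measurable_const.indicator Metric.isClosed_closedBall.measurableSet).mul hF).aemeasurable
    rw [← e, ← lintegral_const_mul _ hF]
    refine lintegral_mono fun x => ?_
    rw [ENNReal.tsum_mul_right]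
    exact mul_le_mul_left (sum_indicator_le hρ hW.separated x) _
  have h3 : ∫⁻ x, F x ≤
      ENNReal.ofReal ((1 + 3 * ν * K) * ‖((schwartzFree k φ).toLp 2 volume)‖) ^ 2 := by
    rw [← eLpNorm_two_sq]
    gcongr
    exact eLpNorm_free_add_majorant_le hK hk φ
  have h4 : eLpNorm (fun x => ((∑' i, W i x : ℝ) : ℂ) * φ x) 2 volume ^ 2 ≤
      ENNReal.ofReal (v * resolventNorm ν k * 5 ^ ν * (1 + 3 * ν * K) *
        ‖((schwartzFree k φ).toLp 2 volume)‖) ^ 2 := by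
    rw [eLpNorm_two_sq]
    simp_rw [hW.enorm_tsum_mul_sq]
    rw [lintegral_tsum fun i => by
      have := (Complex.continuous_ofReal.comp_aestronglyMeasurable (hW.measurable i)).mul
        φ.continuous.aestronglyMeasurable
      exact this.enorm.pow_const _]
    refine (ENNReal.tsum_le_tsum h1).trans ?_
    rw [ENNReal.tsum_mul_left]
    refine (mul_le_mul_right (h2.trans (mul_le_mul_right h3 _)) _).trans ?_
    -- A crude bound that makes the overlap constant a square, like all other factors.
    have h5 : (5 : ℝ≥0∞) ^ ν ≤ ENNReal.ofReal (5 ^ ν) ^ 2 := by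
      rw [ENNReal.ofReal_pow (by norm_num)]
      have : ENNReal.ofReal 5 = 5 := by simp
      rw [this]
      exact le_self_pow₀ (one_le_pow₀ (by norm_num)) two_ne_zero
    refine (mul_le_mul_right (mul_le_mul_left h5 _) _).trans ?_
    rw [← mul_pow, ← mul_pow, ← mul_pow, ← ENNReal.ofReal_mul hv, ← ENNReal.ofReal_mul (by positivity),
      ← ENNReal.ofReal_mul (by positivity)]
    refine le_of_eq ?_
    congr 2
    ring
  exact (ENNReal.pow_le_pow_left_iff two_ne_zero).mp h4

end RelativeBound

section Wells

/-! ### The potential of an array of wells -/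

variable {ν : ℕ} {V : ℝ → ℝ} {ρ : ℝ}

theorem IsWellFamily.hasSum {Y : ℤ → Space ν} {v : ℝ} {W : ℤ → Space ν → ℝ}
    (hW : IsWellFamily Y ρ v W) (x : Space ν) : HasSum (fun i => W i x) (∑' i, W i x) := by
  by_cases h : ∃ i, x ∈ Metric.ball (Y i) ρ
  · obtain ⟨i, hi⟩ := h
    rw [tsum_eq_single i (hW.eq_single hi)]
    exact hasSum_single i (hW.eq_single hi)
  · push Not at h
    have : ∀ i, W i x = 0 := fun i => hW.support i x (h i)
    simp only [this, tsum_zero]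
    exact hasSum_zero

theorem IsWellFamily.aestronglyMeasurable_tsum {Y : ℤ → Space ν} {v : ℝ} {W : ℤ → Space ν → ℝ}
    (hW : IsWellFamily Y ρ v W) : AEStronglyMeasurable (fun x => ∑' i, W i x) volume := by
  refine aestronglyMeasurable_of_tendsto_ae (atTop : Filter (Finset ℤ))
    (f := fun s x => ∑ i ∈ s, W i x) (fun s => ?_) (.of_forall fun x => hW.hasSum x)
  exact Finset.aestronglyMeasurable_fun_sum s fun i _ => hW.measurable i

theorem well_eq_sub (y x : Space ν) : well V ρ y x = well V ρ 0 (x - y) := by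
  unfold well
  by_cases hx : x ∈ Metric.ball y ρ
  · have hx' : x - y ∈ Metric.ball (0 : Space ν) ρ := by
      rwa [mem_ball_zero_iff, ← dist_eq_norm]
    rw [Set.indicator_of_mem hx, Set.indicator_of_mem hx', dist_zero_right, dist_eq_norm]
  · have hx' : x - y ∉ Metric.ball (0 : Space ν) ρ := by
      rwa [mem_ball_zero_iff, ← dist_eq_norm]
    rw [Set.indicator_of_notMem hx, Set.indicator_of_notMem hx']

/-- In polar coordinates the weight `r ^ (ν - 1)` is bounded by `ρ ^ (ν - 1)` on `(0, ρ)`. The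
argument is applied to `V`, for measurability, and to `V²`. -/
theorem memLp_well_zero (hν : 1 ≤ ν) (hV : MemLp V 2 (volume.restrict (Set.Ioo 0 ρ))) :
    MemLp (well V ρ (0 : Space ν)) 2 volume := by
  have hn : Nontrivial (Space ν) := by
    have : Nonempty (Fin ν) := ⟨⟨0, hν⟩⟩
    infer_instance
  have key : ∀ f : ℝ → ℝ, IntegrableOn f (Set.Ioo 0 ρ) →
      IntegrableOn (fun x : Space ν => f ‖x‖) (Metric.ball 0 ρ) := by
    intro f hf
    rw [integrableOn_fun_norm_addHaar]
    refine hf.bdd_mul (c := ρ ^ (Module.finrank ℝ (Space ν) - 1))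
      (Continuous.aestronglyMeasurable (by fun_prop)) ?_
    filter_upwards [ae_restrict_mem measurableSet_Ioo] with y hy
    rw [norm_pow, Real.norm_of_nonneg hy.1.le]
    exact pow_le_pow_left₀ hy.1.le hy.2.le _
  have h1 := key V (hV.integrable (by norm_num))
  have h2 := key (fun r => V r ^ 2) hV.integrable_sq
  have h3 : MemLp (fun x : Space ν => V ‖x‖) 2 (volume.restrict (Metric.ball 0 ρ)) :=
    (memLp_two_iff_integrable_sq h1.aestronglyMeasurable).mpr h2
  unfold well
  simp only [dist_zero_right]
  exact (memLp_indicator_iff_restrict measurableSet_ball).mpr h3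

theorem measurePreserving_sub_const (y : Space ν) :
    MeasurePreserving (fun x : Space ν => x - y) volume volume :=
  measurePreserving_sub_right volume y

theorem memLp_well (hν : 1 ≤ ν) (hV : MemLp V 2 (volume.restrict (Set.Ioo 0 ρ))) (y : Space ν) :
    MemLp (well V ρ y) 2 volume := by
  have := (memLp_well_zero (ν := ν) hν hV).comp_measurePreserving (measurePreserving_sub_const y)
  exact this.ae_eq (.of_forall fun x => (well_eq_sub y x).symm)

theorem eLpNorm_well (hν : 1 ≤ ν) (hV : MemLp V 2 (volume.restrict (Set.Ioo 0 ρ))) (y : Space ν) :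
    eLpNorm (well V ρ y) 2 volume = eLpNorm (well V ρ (0 : Space ν)) 2 volume := by
  rw [← eLpNorm_comp_measurePreserving (memLp_well_zero hν hV).1 (measurePreserving_sub_const y)]
  exact eLpNorm_congr_ae (.of_forall fun x => well_eq_sub y x)

theorem isWellFamily_well (hν : 1 ≤ ν) (hV : MemLp V 2 (volume.restrict (Set.Ioo 0 ρ)))
    {Y : ℤ → Space ν} (hY : ∀ i j, i ≠ j → 2 * ρ ≤ dist (Y i) (Y j)) :
    IsWellFamily Y ρ (eLpNorm (well V ρ (0 : Space ν)) 2 volume).toReal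
      (fun i => well V ρ (Y i)) where
  separated := hY
  measurable i := (memLp_well hν hV (Y i)).1
  support i x hx := Set.indicator_of_notMem hx _
  norm_le i := by rw [eLpNorm_well hν hV, ENNReal.ofReal_toReal (memLp_well_zero hν hV).2.ne]

/-- The potential `q` is bounded relative to `-Δ + (2πk)²` on Schwartz functions, with relative
bound `1/2`. -/
structure IsRelativelyBounded (k : ℝ) (q : Space ν → ℝ) : Prop where
  measurable : AEStronglyMeasurable q volume
  bound : ∀ φ : 𝓢(Space ν, ℂ), eLpNorm (fun x => (q x : ℂ) * φ x) 2 volume ≤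
    ENNReal.ofReal (1 / 2 * ‖((schwartzFree k φ).toLp 2 volume)‖)

/-- The array potentials of all separated arrays are relatively bounded, with a uniform bound. -/
theorem exists_isRelativelyBounded (hν1 : 1 ≤ ν) (hν : ν ≤ 3) (hρ : 0 < ρ)
    (hV : MemLp V 2 (volume.restrict (Set.Ioo 0 ρ))) :
    ∃ k : ℝ, 1 ≤ k ∧ ∀ Y : ℤ → Space ν, (∀ i j, i ≠ j → 2 * ρ ≤ dist (Y i) (Y j)) →
      IsRelativelyBounded k (arrayPotential V ρ Y) := by
  obtain ⟨χ, K, hK, hχ, hχ1, hχs⟩ := exists_ball_cutoff (E := Space ν) hρ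
  set v := (eLpNorm (well V ρ (0 : Space ν)) 2 volume).toReal
  have hv : 0 ≤ v := ENNReal.toReal_nonneg
  set C : ℝ := v * 5 ^ ν * (1 + 3 * ν * K)
  have hC : 0 ≤ C := by positivity
  -- `k` depends on `V` and `ρ` but not on the array; `C + 1` avoids a division by zero when the
  -- wells vanish.
  obtain ⟨k, hk, hkC⟩ := exists_resolventNorm_le hν (ε := 1 / (2 * (C + 1))) (by positivity)
  refine ⟨k, hk, fun Y hY => ?_⟩
  have hW := isWellFamily_well (ν := ν) hν1 hV hY
  refine ⟨hW.aestronglyMeasurable_tsum, fun φ => ?_⟩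
  refine (hW.eLpNorm_mul_le hν hρ hv hK hχ hχ1 hχs hk φ).trans (ENNReal.ofReal_le_ofReal ?_)
  refine mul_le_mul_of_nonneg_right ?_ (norm_nonneg _)
  calc v * resolventNorm ν k * 5 ^ ν * (1 + 3 * ν * K) = C * resolventNorm ν k := by
        simp only [C]; ring
    _ ≤ C * (1 / (2 * (C + 1))) := mul_le_mul_of_nonneg_left hkC hC
    _ ≤ 1 / 2 := by
        rw [mul_one_div, div_le_div_iff₀ (by positivity) (by norm_num)]
        linarith

end Wells

/-! ### Schrödinger operators with relatively bounded potentials -/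

section RelativelyBounded

variable {ν : ℕ} {k : ℝ} {q : Space ν → ℝ}

theorem denseRange_toLp : DenseRange fun h : 𝓢(Space ν, ℂ) => (h.toLp 2 volume) :=
  SchwartzMap.denseRange_toLpCLM (F := ℂ) (p := 2) (by simp)

theorem exists_tendsto_toLp (f : L2 ν) :
    ∃ h : ℕ → 𝓢(Space ν, ℂ), Tendsto (fun n => ((h n).toLp 2 volume)) atTop (nhds f) := by
  obtain ⟨u, hu, hlim⟩ := mem_closure_iff_seq_limit.mp (denseRange_toLp f)
  choose h hh using hu
  exact ⟨h, by simpa only [hh] using hlim⟩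

theorem IsRelativelyBounded.eLpNorm_mul_schwartzResolvent_le (hq : IsRelativelyBounded k q)
    (hk : 0 < k) (h : 𝓢(Space ν, ℂ)) :
    eLpNorm (fun x => (q x : ℂ) * schwartzResolvent k h x) 2 volume ≤
      ENNReal.ofReal (1 / 2 * ‖(h.toLp 2 volume)‖) := by
  have := hq.bound (schwartzResolvent k h)
  rwa [schwartzFree_schwartzResolvent hk] at this

/-- Extension from Schwartz functions by density. As `q` is unbounded, the limit is taken along an
almost everywhere convergent subsequence with Fatou's lemma. -/
theorem IsRelativelyBounded.eLpNorm_mul_freeResolvent_le (hq : IsRelativelyBounded k q)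
    (hk : 0 < k) (f : L2 ν) :
    eLpNorm (fun x => (q x : ℂ) * freeResolvent ν hk f x) 2 volume ≤
      ENNReal.ofReal (1 / 2 * ‖f‖) := by
  obtain ⟨h, hh⟩ := exists_tendsto_toLp f
  have hR := ((freeResolvent ν hk).continuous.tendsto f).comp hh
  obtain ⟨ns, hns, hae⟩ := (tendstoInMeasure_of_tendsto_Lp hR).exists_seq_tendsto_ae
  have hlim : ∀ᵐ x : Space ν, Tendsto
      (fun n => (q x : ℂ) * schwartzResolvent k (h (ns n)) x) atTop
      (nhds ((q x : ℂ) * freeResolvent ν hk f x)) := by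
    have hall : ∀ᵐ x : Space ν, ∀ n, freeResolvent ν hk ((h n).toLp 2) x =
        schwartzResolvent k (h n) x := by
      refine ae_all_iff.mpr fun n => ?_
      rw [freeResolvent_toLp]
      exact SchwartzMap.coeFn_toLp _ _ _
    filter_upwards [hae, hall] with x hx hx2
    refine Tendsto.const_mul _ (hx.congr fun n => ?_)
    exact hx2 (ns n)
  refine (Lp.eLpNorm_lim_le_liminf_eLpNorm (p := 2) (fun n =>
    (Complex.continuous_ofReal.comp_aestronglyMeasurable hq.measurable).mul
      (schwartzResolvent k (h (ns n))).continuous.aestronglyMeasurable) _ hlim).trans ?_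
  refine (liminf_le_liminf (.of_forall fun n =>
    hq.eLpNorm_mul_schwartzResolvent_le hk (h (ns n)))).trans (le_of_eq ?_)
  exact (ENNReal.tendsto_ofReal ((hh.comp hns.tendsto_atTop).norm.const_mul _)).liminf_eq

theorem IsRelativelyBounded.freeResolvent_mem_mulDomain (hq : IsRelativelyBounded k q)
    (hk : 0 < k) (f : L2 ν) : freeResolvent ν hk f ∈ mulDomain q :=
  ⟨(Complex.continuous_ofReal.comp_aestronglyMeasurable hq.measurable).mul
    (Lp.aestronglyMeasurable _), (hq.eLpNorm_mul_freeResolvent_le hk f).trans_lt ofReal_lt_top⟩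

theorem norm_mulFun (ψ : mulDomain q) :
    ENNReal.ofReal ‖mulFun q ψ‖ = eLpNorm (fun x => (q x : ℂ) * (ψ : L2 ν) x) 2 volume := by
  exact (congrArg ENNReal.ofReal (Lp.norm_toLp _ ψ.2)).trans (ENNReal.ofReal_toReal ψ.2.2.ne)

theorem mem_sobolevH2_of_mem_domain (ψ : (schrodinger q).domain) : (ψ : L2 ν) ∈ sobolevH2 ν :=
  (Submodule.mem_inf.mp (show (ψ : L2 ν) ∈ (negLaplacian ν).domain ⊓ (mulOperator q).domain from
    ψ.2)).1

theorem mem_mulDomain_of_mem_domain (ψ : (schrodinger q).domain) : (ψ : L2 ν) ∈ mulDomain q :=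
  (Submodule.mem_inf.mp (show (ψ : L2 ν) ∈ (negLaplacian ν).domain ⊓ (mulOperator q).domain from
    ψ.2)).2

theorem schrodinger_apply (ψ : (schrodinger q).domain) :
    schrodinger q ψ = negLaplacian ν ⟨ψ, mem_sobolevH2_of_mem_domain ψ⟩ -
      mulFun q ⟨ψ, mem_mulDomain_of_mem_domain ψ⟩ := rfl

/-- The bounded operator `q (-Δ + (2πk)²)⁻¹`. -/
def IsRelativelyBounded.relative (hq : IsRelativelyBounded k q) (hk : 0 < k) : L2 ν →L[ℂ] L2 ν :=
  LinearMap.mkContinuous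
    { toFun := fun f => mulFun q ⟨freeResolvent ν hk f, hq.freeResolvent_mem_mulDomain hk f⟩
      map_add' := fun f g => by
        rw [← mulFun_add]
        congr 1
        exact Subtype.ext (map_add _ _ _)
      map_smul' := fun c f => by
        rw [RingHom.id_apply, ← mulFun_smul]
        congr 1
        exact Subtype.ext (map_smul _ _ _) }
    (1 / 2) fun f => by
      have h := hq.eLpNorm_mul_freeResolvent_le hk f
      have h2 := norm_mulFun ⟨freeResolvent ν hk f, hq.freeResolvent_mem_mulDomain hk f⟩
      exact (ENNReal.ofReal_le_ofReal_iff (by positivity)).mp (h2.le.trans h)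

theorem IsRelativelyBounded.relative_apply (hq : IsRelativelyBounded k q) (hk : 0 < k) (f : L2 ν) :
    hq.relative hk f =
      mulFun q ⟨freeResolvent ν hk f, hq.freeResolvent_mem_mulDomain hk f⟩ := rfl

theorem IsRelativelyBounded.coeFn_relative (hq : IsRelativelyBounded k q) (hk : 0 < k) (f : L2 ν) :
    hq.relative hk f =ᵐ[volume] fun x => (q x : ℂ) * freeResolvent ν hk f x :=
  coeFn_mulFun q ⟨freeResolvent ν hk f, hq.freeResolvent_mem_mulDomain hk f⟩

theorem IsRelativelyBounded.norm_relative_lt_one (hq : IsRelativelyBounded k q) (hk : 0 < k) :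
    ‖hq.relative hk‖ < 1 :=
  (LinearMap.mkContinuous_norm_le _ (by norm_num) _).trans_lt (by norm_num)

/-- The bounded operator `(1 - q (-Δ + (2πk)²)⁻¹)⁻¹`. -/
def IsRelativelyBounded.neumann (hq : IsRelativelyBounded k q) (hk : 0 < k) : L2 ν →L[ℂ] L2 ν :=
  ((Units.oneSub (hq.relative hk) (hq.norm_relative_lt_one hk))⁻¹ : (L2 ν →L[ℂ] L2 ν)ˣ)

theorem IsRelativelyBounded.neumann_sub_relative (hq : IsRelativelyBounded k q) (hk : 0 < k)
    (f : L2 ν) : hq.neumann hk (f - hq.relative hk f) = f :=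
  DFunLike.congr_fun (Units.oneSub (hq.relative hk) (hq.norm_relative_lt_one hk)).inv_mul f

theorem IsRelativelyBounded.neumann_sub (hq : IsRelativelyBounded k q) (hk : 0 < k)
    (f : L2 ν) : hq.neumann hk f - hq.relative hk (hq.neumann hk f) = f :=
  DFunLike.congr_fun (Units.oneSub (hq.relative hk) (hq.norm_relative_lt_one hk)).mul_inv f

/-- The resolvent `(-Δ - q + (2πk)²)⁻¹`. -/
def IsRelativelyBounded.resolvent (hq : IsRelativelyBounded k q) (hk : 0 < k) : L2 ν →L[ℂ] L2 ν :=
  freeResolvent ν hk ∘L hq.neumann hk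

theorem IsRelativelyBounded.resolvent_apply (hq : IsRelativelyBounded k q) (hk : 0 < k)
    (f : L2 ν) : hq.resolvent hk f = freeResolvent ν hk (hq.neumann hk f) := rfl

/-- With `R` the free resolvent, `-Δ - q + (2πk)² = (1 - q R) (-Δ + (2πk)²)` on the domain, and the
first factor is inverted by the Neumann series. -/
theorem IsRelativelyBounded.isResolventAt (hq : IsRelativelyBounded k q) (hk : 0 < k) :
    IsResolventAt (schrodinger q) (-(((2 * π * k) ^ 2 : ℝ) : ℂ)) (hq.resolvent hk) where
  right_inv f := by
    refine ⟨⟨freeResolvent_mem hk _, hq.freeResolvent_mem_mulDomain hk _⟩, ?_⟩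
    rw [schrodinger_apply]
    have h1 := negLaplacian_freeResolvent hk (hq.neumann hk f)
    have h2 := hq.neumann_sub hk f
    rw [hq.relative_apply] at h2
    rw [neg_smul, sub_neg_eq_add, sub_add_eq_add_sub]
    exact (congrArg (· - _) h1).trans h2
  left_inv ψ := by
    have hs := mem_sobolevH2_of_mem_domain (q := q) ψ
    have h1 : freeResolvent ν hk (negLaplacian ν ⟨ψ, hs⟩ +
        (((2 * π * k) ^ 2 : ℝ) : ℂ) • (ψ : L2 ν)) = ψ := freeResolvent_negLaplacian hk ⟨(ψ : L2 ν), hs⟩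
    rw [schrodinger_apply, neg_smul, sub_neg_eq_add, sub_add_eq_add_sub]
    have h2 : hq.relative hk (negLaplacian ν ⟨ψ, mem_sobolevH2_of_mem_domain ψ⟩ +
        (((2 * π * k) ^ 2 : ℝ) : ℂ) • (ψ : L2 ν)) =
          mulFun q ⟨ψ, mem_mulDomain_of_mem_domain ψ⟩ := by
      rw [hq.relative_apply hk]
      exact congrArg (mulFun q) (Subtype.ext h1)
    rw [← h2, hq.resolvent_apply, hq.neumann_sub_relative]
    exact h1

theorem inner_mulFun (ψ φ : mulDomain q) :
    inner ℂ (mulFun q ψ) (φ : L2 ν) = inner ℂ (ψ : L2 ν) (mulFun q φ) := by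
  rw [L2.inner_def, L2.inner_def]
  refine integral_congr_ae ?_
  filter_upwards [coeFn_mulFun q ψ, coeFn_mulFun q φ] with x h1 h2
  rw [h1, h2]
  simp only [RCLike.inner_apply, map_mul, Complex.conj_ofReal]
  ring

theorem IsRelativelyBounded.inner_relative (hq : IsRelativelyBounded k q) (hk : 0 < k)
    (f g : L2 ν) : inner ℂ (freeResolvent ν hk f) (hq.relative hk g) =
      inner ℂ (hq.relative hk f) (freeResolvent ν hk g) :=
  (inner_mulFun (q := q) ⟨freeResolvent ν hk f, hq.freeResolvent_mem_mulDomain hk f⟩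
    ⟨freeResolvent ν hk g, hq.freeResolvent_mem_mulDomain hk g⟩).symm

/-- Writing `f = (1 - q R) f'` and `g = (1 - q R) g'` reduces the symmetry to that of `R` and of
multiplication by the real function `q`. -/
theorem IsRelativelyBounded.isStarNormal_resolvent (hq : IsRelativelyBounded k q) (hk : 0 < k) :
    IsStarNormal (hq.resolvent hk) := by
  have hs : IsSelfAdjoint (hq.resolvent hk) := by
    rw [ContinuousLinearMap.isSelfAdjoint_iff_isSymmetric]
    intro f g
    change inner ℂ (freeResolvent ν hk (hq.neumann hk f)) g =
      inner ℂ f (freeResolvent ν hk (hq.neumann hk g))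
    have h1 := hq.neumann_sub hk f
    have h2 := hq.neumann_sub hk g
    set f' := hq.neumann hk f
    set g' := hq.neumann hk g
    rw [← h1, ← h2, inner_sub_left, inner_sub_right, isSymmetric_freeResolvent,
      hq.inner_relative]
  exact hs.isStarNormal

/-! ### Approximate eigenfunctions -/

/-- The function `(-Δ - q - w) φ`. -/
def residual (q : Space ν → ℝ) (w : ℂ) (φ : 𝓢(Space ν, ℂ)) (x : Space ν) : ℂ :=
  -Δ φ x - (q x : ℂ) * φ x - w * φ x

/-- The number `w` is an approximate eigenvalue of `-Δ - q`, with approximate eigenfunctions in the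
Schwartz space. -/
def IsApproxEigenvalue (q : Space ν → ℝ) (w : ℂ) : Prop :=
  ∀ ε > 0, ∃ φ : 𝓢(Space ν, ℂ), φ ≠ 0 ∧
    eLpNorm (residual q w φ) 2 volume ≤ ENNReal.ofReal (ε * ‖(φ.toLp 2 volume)‖)

theorem toLp_zero : ((0 : 𝓢(Space ν, ℂ)).toLp 2 volume) = 0 :=
  map_zero (SchwartzMap.toLpCLM ℝ ℂ 2 (volume : Measure (Space ν)))

theorem norm_toLp_pos {φ : 𝓢(Space ν, ℂ)} (hφ : φ ≠ 0) : 0 < ‖(φ.toLp 2 volume)‖ :=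
  norm_pos_iff.mpr fun h0 => hφ <|
    SchwartzMap.injective_toLp 2 (volume : Measure (Space ν)) (h0.trans toLp_zero.symm)

theorem not_isApproxEigenvalue_iff {w : ℂ} : ¬ IsApproxEigenvalue q w ↔
    ∃ c > 0, ∀ φ : 𝓢(Space ν, ℂ),
      ENNReal.ofReal (c * ‖(φ.toLp 2 volume)‖) ≤ eLpNorm (residual q w φ) 2 volume := by
  unfold IsApproxEigenvalue
  push Not
  constructor
  · rintro ⟨c, hc, h⟩
    refine ⟨c, hc, fun φ => ?_⟩
    by_cases hφ : φ = 0
    · subst hφ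
      rw [toLp_zero]
      simp
    · exact (h φ hφ).le
  · rintro ⟨c, hc, h⟩
    -- Halving `c` makes the inequality strict for nonzero `φ`.
    refine ⟨c / 2, by positivity, fun φ hφ => lt_of_lt_of_le ?_ (h φ)⟩
    have hpos := norm_toLp_pos hφ
    exact (ENNReal.ofReal_lt_ofReal_iff (by positivity)).mpr
      (mul_lt_mul_of_pos_right (by linarith) hpos)

/-- The value of `(-Δ - q - w) (-Δ + (2πk)²)⁻¹`. -/
def IsRelativelyBounded.shifted (hq : IsRelativelyBounded k q) (hk : 0 < k) (w : ℂ) :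
    L2 ν →L[ℂ] L2 ν :=
  1 - hq.relative hk - (w - (-(((2 * π * k) ^ 2 : ℝ) : ℂ))) • freeResolvent ν hk

theorem IsRelativelyBounded.shifted_apply (hq : IsRelativelyBounded k q) (hk : 0 < k) (w : ℂ)
    (f : L2 ν) : hq.shifted hk w f =
      f - hq.relative hk f - (w - (-(((2 * π * k) ^ 2 : ℝ) : ℂ))) • freeResolvent ν hk f := by
  simp only [shifted, _root_.sub_apply, one_apply_eq_self, _root_.smul_apply]

theorem IsRelativelyBounded.one_sub_smul_resolvent (hq : IsRelativelyBounded k q) (hk : 0 < k)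
    (w : ℂ) (f : L2 ν) :
    (1 - (w - (-(((2 * π * k) ^ 2 : ℝ) : ℂ))) • hq.resolvent hk) f =
      hq.shifted hk w (hq.neumann hk f) := by
  rw [hq.shifted_apply, hq.neumann_sub]
  simp only [_root_.sub_apply, one_apply_eq_self, _root_.smul_apply, hq.resolvent_apply]

theorem IsRelativelyBounded.exists_sub_smul_eq_shifted (hq : IsRelativelyBounded k q) (hk : 0 < k)
    (w : ℂ) (g : L2 ν) : ∃ h : freeResolvent ν hk g ∈ (schrodinger q).domain,
      schrodinger q ⟨freeResolvent ν hk g, h⟩ - w • freeResolvent ν hk g = hq.shifted hk w g := by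
  have h : freeResolvent ν hk g ∈ (schrodinger q).domain :=
    ⟨freeResolvent_mem hk g, hq.freeResolvent_mem_mulDomain hk g⟩
  refine ⟨h, ?_⟩
  have h1 := negLaplacian_freeResolvent hk g
  rw [hq.shifted_apply, hq.relative_apply]
  rw [schrodinger_apply, sub_smul, neg_smul]
  have h2 : negLaplacian ν ⟨freeResolvent ν hk g, freeResolvent_mem hk g⟩ =
    g - (((2 * π * k) ^ 2 : ℝ) : ℂ) • freeResolvent ν hk g := eq_sub_of_add_eq h1
  refine (congrArg (fun u => u - _ - _) h2).trans ?_
  abel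

theorem IsRelativelyBounded.coeFn_shifted (hq : IsRelativelyBounded k q) (hk : 0 < k) (w : ℂ)
    (h : 𝓢(Space ν, ℂ)) :
    hq.shifted hk w (h.toLp 2) =ᵐ[volume] residual q w (schwartzResolvent k h) := by
  have h1 := hq.coeFn_relative hk (h.toLp 2)
  have h2 : freeResolvent ν hk (h.toLp 2) =ᵐ[volume] schwartzResolvent k h := by
    rw [freeResolvent_toLp]
    exact SchwartzMap.coeFn_toLp _ _ _
  have h3 : (h.toLp 2 volume) =ᵐ[volume] h := SchwartzMap.coeFn_toLp _ _ _
  rw [hq.shifted_apply]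
  generalize (h.toLp 2 volume) = f at h1 h2 h3 ⊢
  generalize hq.relative hk f = b at h1 ⊢
  generalize freeResolvent ν hk f = g at h1 h2 ⊢
  generalize hc : w - (-(((2 * π * k) ^ 2 : ℝ) : ℂ)) = c
  filter_upwards [h1, h2, h3, Lp.coeFn_sub (f - b) (c • g), Lp.coeFn_sub f b, Lp.coeFn_smul c g]
    with x e1 e2 e3 e4 e5 e6
  have e7 := schwartzFree_apply k (schwartzResolvent k h) x
  rw [schwartzFree_schwartzResolvent hk h] at e7
  rw [e4, Pi.sub_apply, e5, Pi.sub_apply, e6, Pi.smul_apply, e3, e1, e2, smul_eq_mul, residual, e7,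
    ← hc]
  ring

theorem IsRelativelyBounded.eLpNorm_residual (hq : IsRelativelyBounded k q) (hk : 0 < k) (w : ℂ)
    (h : 𝓢(Space ν, ℂ)) : eLpNorm (residual q w (schwartzResolvent k h)) 2 volume =
      ENNReal.ofReal ‖hq.shifted hk w (h.toLp 2)‖ := by
  rw [← eLpNorm_congr_ae (hq.coeFn_shifted hk w h), Lp.norm_def,
    ENNReal.ofReal_toReal (Lp.eLpNorm_ne_top _)]

end RelativelyBounded

/-! ### Invariance under isometries -/

section Isometry

variable {ν : ℕ}

/-- The composition of a Schwartz function with the isometry `x ↦ e (x - t)`. -/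
def compIsometry (e : Space ν ≃ₗᵢ[ℝ] Space ν) (t : Space ν) (φ : 𝓢(Space ν, ℂ)) : 𝓢(Space ν, ℂ) :=
  (SchwartzMap.compCLMOfContinuousLinearEquiv ℂ e.toContinuousLinearEquiv φ).compSubConstCLM ℂ t

theorem compIsometry_apply (e : Space ν ≃ₗᵢ[ℝ] Space ν) (t : Space ν) (φ : 𝓢(Space ν, ℂ))
    (x : Space ν) : compIsometry e t φ x = φ (e (x - t)) := rfl

theorem laplacian_compIsometry (e : Space ν ≃ₗᵢ[ℝ] Space ν) (t : Space ν) (φ : 𝓢(Space ν, ℂ))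
    (x : Space ν) : Δ (compIsometry e t φ) x = Δ φ (e (x - t)) := by
  let b := EuclideanSpace.basisFun (Fin ν) ℝ
  rw [SchwartzMap.laplacian_apply, SchwartzMap.laplacian_apply,
    -- The Laplacian may be computed in any orthonormal basis; the rotated basis `b.map e` absorbs
    -- the isometry.
    InnerProductSpace.laplacian_eq_iteratedFDeriv_orthonormalBasis _ b,
    InnerProductSpace.laplacian_eq_iteratedFDeriv_orthonormalBasis _ (b.map e)]
  have h1 : (compIsometry e t φ : Space ν → ℂ) = fun x => (φ ∘ e) (x - t) := rfl
  have h2 := (e.toContinuousLinearEquiv : Space ν →L[ℝ] Space ν).iteratedFDeriv_comp_right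
    (n := 2) (φ.smooth 2) (x - t) (i := 2) le_rfl
  simp only [h1, iteratedFDeriv_comp_sub]
  refine Finset.sum_congr rfl fun i _ => ?_
  refine (DFunLike.congr_fun h2 _).trans ?_
  rw [ContinuousMultilinearMap.compContinuousLinearMap_apply]
  refine congrArg (iteratedFDeriv ℝ 2 φ (e (x - t))) (funext fun j => ?_)
  fin_cases j <;> simp [OrthonormalBasis.map_apply]

theorem measurePreserving_isometry (e : Space ν ≃ₗᵢ[ℝ] Space ν) (t : Space ν) :
    MeasurePreserving (fun x => e (x - t)) volume volume :=
  e.measurePreserving.comp (measurePreserving_sub_const t)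

theorem norm_toLp_compIsometry (e : Space ν ≃ₗᵢ[ℝ] Space ν) (t : Space ν) (φ : 𝓢(Space ν, ℂ)) :
    ‖((compIsometry e t φ).toLp 2 volume)‖ = ‖(φ.toLp 2 volume)‖ := by
  have h := eLpNorm_comp_measurePreserving (p := 2) φ.continuous.aestronglyMeasurable
    (measurePreserving_isometry e t)
  rw [SchwartzMap.norm_toLp, SchwartzMap.norm_toLp]
  exact congrArg ENNReal.toReal h

theorem aestronglyMeasurable_residual {q : Space ν → ℝ} (hq : AEStronglyMeasurable q volume)
    (w : ℂ) (φ : 𝓢(Space ν, ℂ)) : AEStronglyMeasurable (residual q w φ) volume := by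
  have h1 := (Complex.continuous_ofReal.comp_aestronglyMeasurable hq).mul
    φ.continuous.aestronglyMeasurable
  have h2 : Continuous fun x => -Δ φ x := (Δ φ).continuous.neg
  have h3 : Continuous fun x => w * φ x := continuous_const.mul φ.continuous
  exact (h2.aestronglyMeasurable.sub h1).sub h3.aestronglyMeasurable

theorem eLpNorm_residual_compIsometry {q : Space ν → ℝ} (hq : AEStronglyMeasurable q volume)
    (w : ℂ) (e : Space ν ≃ₗᵢ[ℝ] Space ν) (t : Space ν) (φ : 𝓢(Space ν, ℂ)) :
    eLpNorm (residual (fun x => q (e (x - t))) w (compIsometry e t φ)) 2 volume =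
      eLpNorm (residual q w φ) 2 volume := by
  rw [← eLpNorm_comp_measurePreserving (aestronglyMeasurable_residual hq w φ)
    (measurePreserving_isometry e t)]
  congr 1
  ext x
  rw [Function.comp_apply, residual, residual, laplacian_compIsometry, compIsometry_apply]

theorem compIsometry_ne_zero (e : Space ν ≃ₗᵢ[ℝ] Space ν) (t : Space ν) {φ : 𝓢(Space ν, ℂ)}
    (hφ : φ ≠ 0) : compIsometry e t φ ≠ 0 := by
  contrapose! hφ
  ext x
  have := DFunLike.congr_fun hφ (e.symm x + t)
  rw [compIsometry_apply] at this
  simpa using this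

theorem IsApproxEigenvalue.comp_isometry {q : Space ν → ℝ} (hq : AEStronglyMeasurable q volume)
    {w : ℂ} (h : IsApproxEigenvalue q w) (e : Space ν ≃ₗᵢ[ℝ] Space ν) (t : Space ν) :
    IsApproxEigenvalue (fun x => q (e (x - t))) w := by
  intro ε hε
  obtain ⟨φ, hφ, h1⟩ := h ε hε
  refine ⟨compIsometry e t φ, compIsometry_ne_zero e t hφ, ?_⟩
  rwa [eLpNorm_residual_compIsometry hq, norm_toLp_compIsometry]

theorem well_eq_of_dist_eq {V : ℝ → ℝ} {ρ : ℝ} {x y x' y' : Space ν} (h : dist x y = dist x' y') :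
    well V ρ y x = well V ρ y' x' := by
  classical
  simp only [well, Set.indicator_apply, Metric.mem_ball, h]

/-- The points of a straight equidistant chain. -/
def lineChain (p u : Space ν) (a : ℝ) (i : ℤ) : Space ν := p + (i * a) • u

theorem dist_lineChain {p u : Space ν} (hu : ‖u‖ = 1) (a : ℝ) (i j : ℤ) :
    dist (lineChain p u a i) (lineChain p u a j) = |(i : ℝ) - j| * |a| := by
  rw [lineChain, lineChain, dist_add_left, dist_eq_norm, ← sub_smul, norm_smul, hu, mul_one,
    ← sub_mul, norm_mul, Real.norm_eq_abs, Real.norm_eq_abs]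

theorem le_dist_lineChain {p u : Space ν} (hu : ‖u‖ = 1) {a b : ℝ} (ha : b ≤ a) (i j : ℤ)
    (hij : i ≠ j) : b ≤ dist (lineChain p u a i) (lineChain p u a j) := by
  rw [dist_lineChain hu]
  have h1 : (1 : ℝ) ≤ |(i : ℝ) - j| := by
    have := Int.one_le_abs (sub_ne_zero.mpr hij)
    exact_mod_cast this
  calc b ≤ |a| := ha.trans (le_abs_self a)
    _ ≤ _ := le_mul_of_one_le_left (abs_nonneg a) h1

/-- The approximate eigenvalues of a straight equidistant chain do not depend on its position. -/
theorem IsApproxEigenvalue.lineChain {V : ℝ → ℝ} {ρ a : ℝ} {p u p' u' : Space ν} (hu : ‖u‖ = 1)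
    (hu' : ‖u'‖ = 1)
    (hq : AEStronglyMeasurable (arrayPotential V ρ (lineChain p u a)) volume) {w : ℂ}
    (h : IsApproxEigenvalue (arrayPotential V ρ (lineChain p u a)) w) :
    IsApproxEigenvalue (arrayPotential V ρ (lineChain p' u' a)) w := by
  -- The reflection exchanging the unit vectors `u` and `u'`; the shift `p' - e.symm p` is chosen so
  -- that `p'` is carried to `p`.
  let e : Space ν ≃ₗᵢ[ℝ] Space ν := (ℝ ∙ (u' - u))ᗮ.reflection
  have he : e u' = u := Submodule.reflection_sub (by rw [hu, hu'])
  have h1 := h.comp_isometry hq e (p' - e.symm p)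
  convert h1 using 1
  ext x
  unfold arrayPotential
  refine tsum_congr fun i => well_eq_of_dist_eq ?_
  have h2 : e (x - (p' - e.symm p)) - BentChain.lineChain p u a i =
      e (x - BentChain.lineChain p' u' a i) := by
    simp only [BentChain.lineChain, map_sub, map_add, map_smul, he, e.apply_symm_apply]
    abel
  rw [dist_eq_norm, dist_eq_norm, h2, e.norm_map]

theorem arrayPotential_lineChain_sub (V : ℝ → ℝ) (ρ a : ℝ) (p u x : Space ν) (n : ℤ) :
    arrayPotential V ρ (lineChain p u a) (x - (n * a) • u) =
      arrayPotential V ρ (lineChain p u a) x := by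
  unfold arrayPotential
  rw [← (Equiv.addRight n).tsum_eq (fun i => well V ρ (lineChain p u a i) x)]
  refine tsum_congr fun i => well_eq_of_dist_eq ?_
  rw [dist_eq_norm, dist_eq_norm, lineChain, lineChain, Equiv.coe_addRight, Int.cast_add, add_mul,
    add_smul]
  congr 1
  abel

end Isometry

/-! ### Localization of approximate eigenfunctions -/

section Localization

variable {ν : ℕ} {k : ℝ}

/-- With `H = -Δ - q` and `H' = -Δ - q'`, this estimates `(H' - w)(χφ) = χ (H - w)φ - [Δ, χ]φ + χ (q
- q')φ` term by term. The potentials need to be comparable only where `χ` is nonzero. -/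
theorem eLpNorm_residual_cutoffMul_le {q q' W : Space ν → ℝ} (hq : AEStronglyMeasurable q volume)
    (hWm : AEStronglyMeasurable W volume) {χ : Space ν → ℝ} {K : ℝ} (hK : 0 ≤ K)
    (hχ : IsCutoff χ K) (hW : ∀ x, |χ x * (q x - q' x)| ≤ |W x|) (hk : 1 ≤ k) (w : ℂ)
    (φ : 𝓢(Space ν, ℂ)) :
    eLpNorm (residual q' w (cutoffMul χ φ)) 2 volume ≤ eLpNorm (residual q w φ) 2 volume +
      ENNReal.ofReal (K * (3 * ν * ‖((schwartzFree k φ).toLp 2 volume)‖)) +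
        eLpNorm (fun x => (W x : ℂ) * φ x) 2 volume := by
  have hG := continuous_gradientMajorant φ
  have hres := aestronglyMeasurable_residual hq w φ
  have hWφ := (Complex.continuous_ofReal.comp_aestronglyMeasurable hWm).mul
    φ.continuous.aestronglyMeasurable
  have hpt : ∀ x, ‖residual q' w (cutoffMul χ φ) x‖ ≤
      ‖residual q w φ x‖ + K * gradientMajorant φ x + ‖(W x : ℂ) * φ x‖ := by
    intro x
    have e : residual q' w (cutoffMul χ φ) x = (χ x : ℂ) * residual q w φ x -
        (Δ (cutoffMul χ φ) x - (χ x : ℂ) * Δ φ x) + ((χ x * (q x - q' x) : ℝ) : ℂ) * φ x := by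
      rw [residual, residual, cutoffMul_apply hχ.growth]
      push_cast
      ring
    rw [e]
    refine (norm_add_le _ _).trans (add_le_add ((norm_sub_le _ _).trans (add_le_add ?_ ?_)) ?_)
    · rw [norm_mul, Complex.norm_real]
      exact mul_le_of_le_one_left (norm_nonneg _) (hχ.abs_le_one x)
    · exact (norm_laplacian_cutoffMul_sub_le hχ φ x).trans
        (Set.indicator_le_self' (fun _ _ => mul_nonneg hK (gradientMajorant_nonneg φ _)) x)
    · rw [norm_mul, norm_mul, Complex.norm_real, Complex.norm_real]
      exact mul_le_mul_of_nonneg_right (hW x) (norm_nonneg _)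
  refine (eLpNorm_mono_real hpt).trans ?_
  refine (eLpNorm_add_le (f := fun x => ‖residual q w φ x‖ + K * gradientMajorant φ x)
    (g := fun x => ‖(W x : ℂ) * φ x‖)
    (hres.norm.add (hG.const_smul K).aestronglyMeasurable) hWφ.norm (by norm_num)).trans ?_
  refine add_le_add ((eLpNorm_add_le (f := fun x => ‖residual q w φ x‖)
    (g := fun x => K * gradientMajorant φ x) hres.norm (hG.const_smul K).aestronglyMeasurable
    (by norm_num)).trans (add_le_add (eLpNorm_norm _).le ?_)) (eLpNorm_norm _).le
  have e1 := (eLpNorm_const_smul K (gradientMajorant φ) 2 (volume : Measure (Space ν))).le.trans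
    (mul_le_mul_right (eLpNorm_gradientMajorant_le hk φ) _)
  rwa [← ofReal_norm, Real.norm_of_nonneg hK, ← ENNReal.ofReal_mul hK] at e1

/-- Bessel's inequality for the vector `A* g`. -/
theorem weaklyNull_of_orthonormal {φ : ℕ → L2 ν} (hφ : Orthonormal ℂ φ) (A : L2 ν →L[ℂ] L2 ν) :
    WeaklyNull fun n => A (φ n) := by
  intro g
  have h1 := (hφ.inner_products_summable (x := A.adjoint g)).tendsto_atTop_zero
  have h2 : Tendsto (fun n => ‖inner ℂ (φ n) (A.adjoint g)‖) atTop (nhds 0) := by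
    have := h1.sqrt
    simpa using this
  refine tendsto_zero_iff_norm_tendsto_zero.mpr (h2.congr fun n => ?_)
  rw [ContinuousLinearMap.adjoint_inner_right, norm_inner_symm]

theorem WeaklyNull.of_sub {f g : ℕ → L2 ν} (hf : WeaklyNull f)
    (h : Tendsto (fun n => g n - f n) atTop (nhds 0)) : WeaklyNull g := by
  intro u
  have h1 : Tendsto (fun n => inner ℂ u (g n - f n)) atTop (nhds (inner ℂ u 0)) :=
    tendsto_const_nhds.inner h
  rw [inner_zero_right] at h1
  have := (hf u).add h1
  rw [add_zero] at this
  refine this.congr fun n => ?_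
  rw [inner_sub_right, add_sub_cancel]

theorem exists_sequence_near (f : ℕ → L2 ν) : ∃ h : ℕ → 𝓢(Space ν, ℂ),
    (∀ n, ‖((h n).toLp 2 volume) - f n‖ ≤ 1) ∧
      Tendsto (fun n => ((h n).toLp 2 volume) - f n) atTop (nhds 0) := by
  have h1 : ∀ n : ℕ, ∃ h : 𝓢(Space ν, ℂ), ‖(h.toLp 2 volume) - f n‖ < 1 / ((n : ℝ) + 1) := by
    intro n
    obtain ⟨h, hh⟩ := Metric.denseRange_iff.mp (denseRange_toLp (ν := ν)) (f n) (1 / ((n : ℝ) + 1))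
      (by positivity)
    exact ⟨h, by rwa [dist_comm, dist_eq_norm] at hh⟩
  choose h hh using h1
  refine ⟨h, fun n => (hh n).le.trans ?_, squeeze_zero_norm (fun n => (hh n).le)
    tendsto_one_div_add_atTop_nhds_zero_nat⟩
  rw [div_le_one (by positivity)]
  linarith [(Nat.cast_nonneg n : (0 : ℝ) ≤ n)]

theorem le_of_one_le_add_mul {a d g : ℝ} (ha : a < 1 / 4) (hd : 0 ≤ d)
    (h : 1 ≤ a + d * (g + 1 / (4 * (d + 1)))) : 1 / (4 * (d + 1)) ≤ g := by
  have e5 : (d + 1) * (1 / (4 * (d + 1))) = 1 / 4 := by field_simp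
  have e7 : 0 < 1 / (4 * (d + 1)) := by positivity
  by_contra hlt
  push Not at hlt
  nlinarith

set_option maxHeartbeats 400000 in
/-- A point of the essential spectrum has a singular sequence of the form `(-Δ + (2πk)²)⁻¹ h n`. -/
theorem IsRelativelyBounded.exists_singular_sequence {q : Space ν → ℝ}
    (hq : IsRelativelyBounded k q) (hk : 0 < k) {w : ℂ}
    (hw : w ∈ essentialSpectrum (schrodinger q)) :
    ∃ (h : ℕ → 𝓢(Space ν, ℂ)) (C s : ℝ), 0 < s ∧ (∀ n, ‖((h n).toLp 2 volume)‖ ≤ C) ∧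
      WeaklyNull (fun n => ((h n).toLp 2 volume)) ∧
      Tendsto (fun n => eLpNorm (residual q w (schwartzResolvent k (h n))) 2 volume) atTop
        (nhds 0) ∧
      ∀ᶠ n in atTop, s ≤ ‖((schwartzResolvent k (h n)).toLp 2 volume)‖ := by
  set z : ℂ := -(((2 * π * k) ^ 2 : ℝ) : ℂ)
  obtain ⟨φ, hφ, hlim⟩ := (hq.isResolventAt hk).exists_singular_sequence
    (hq.isStarNormal_resolvent hk) hw
  -- Schwartz functions replace `hq.neumann hk (φ n)` up to an error tending to zero, which leaves
  -- residuals and weak limits unchanged.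
  obtain ⟨h, hh1, hh⟩ := exists_sequence_near fun n => hq.neumann hk (φ n)
  have hlim1 : Tendsto (fun n => hq.shifted hk w (hq.neumann hk (φ n))) atTop (nhds 0) :=
    hlim.congr fun n => hq.one_sub_smul_resolvent hk w (φ n)
  have hlim2 : Tendsto (fun n => hq.shifted hk w ((h n).toLp 2)) atTop (nhds 0) := by
    have h1 := ((hq.shifted hk w).continuous.tendsto 0).comp hh
    rw [map_zero] at h1
    have := hlim1.add h1
    rw [add_zero] at this
    refine this.congr fun n => ?_
    rw [Function.comp_apply, map_sub, add_sub_cancel]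
  have hfree : Tendsto (fun n => freeResolvent ν hk (((h n).toLp 2 volume) - hq.neumann hk (φ n)))
      atTop (nhds 0) := by
    have h1 := ((freeResolvent ν hk).continuous.tendsto 0).comp hh
    rwa [map_zero] at h1
  refine ⟨h, ‖hq.neumann hk‖ + 1, 1 / (4 * (‖w - z‖ + 1)), by positivity, fun n => ?_,
    (weaklyNull_of_orthonormal hφ (hq.neumann hk)).of_sub hh, ?_, ?_⟩
  · have h1 := (hq.neumann hk).le_opNorm (φ n)
    rw [hφ.1 n, mul_one] at h1
    have h2 := norm_le_norm_add_norm_sub' ((h n).toLp 2 volume) (hq.neumann hk (φ n))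
    linarith [hh1 n]
  · have h1 := ENNReal.tendsto_ofReal hlim2.norm
    rw [norm_zero, ENNReal.ofReal_zero] at h1
    exact h1.congr fun n => (hq.eLpNorm_residual hk w (h n)).symm
  · have hs1 : ∀ᶠ n in atTop, ‖hq.shifted hk w (hq.neumann hk (φ n))‖ < 1 / 4 := by
      have := hlim1.norm
      rw [norm_zero] at this
      exact this.eventually_lt_const (by norm_num)
    have hs2 : ∀ᶠ n in atTop,
        ‖freeResolvent ν hk (((h n).toLp 2 volume) - hq.neumann hk (φ n))‖ <
          1 / (4 * (‖w - z‖ + 1)) := by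
      have := hfree.norm
      rw [norm_zero] at this
      exact this.eventually_lt_const (by positivity)
    filter_upwards [hs1, hs2] with n h1 h2
    -- The first summand tends to zero while `φ n` has norm one, so the free resolvent part stays
    -- bounded away from zero.
    have e1 : φ n = hq.shifted hk w (hq.neumann hk (φ n)) +
        (w - z) • freeResolvent ν hk (hq.neumann hk (φ n)) := by
      rw [hq.shifted_apply, hq.neumann_sub, sub_add_cancel]
    have e2 : 1 ≤ ‖hq.shifted hk w (hq.neumann hk (φ n))‖ +
        ‖w - z‖ * ‖freeResolvent ν hk (hq.neumann hk (φ n))‖ := by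
      have := norm_add_le (hq.shifted hk w (hq.neumann hk (φ n)))
        ((w - z) • freeResolvent ν hk (hq.neumann hk (φ n)))
      rwa [← e1, hφ.1 n, norm_smul] at this
    have e3 : ‖freeResolvent ν hk (hq.neumann hk (φ n))‖ ≤
        ‖((schwartzResolvent k (h n)).toLp 2 volume)‖ + 1 / (4 * (‖w - z‖ + 1)) := by
      rw [map_sub, freeResolvent_toLp] at h2
      have := norm_le_norm_add_norm_sub ((schwartzResolvent k (h n)).toLp 2 volume)
        (freeResolvent ν hk (hq.neumann hk (φ n)))
      linarith
    exact le_of_one_le_add_mul h1 (norm_nonneg _)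
      (e2.trans (add_le_add le_rfl (mul_le_mul_of_nonneg_left e3 (norm_nonneg _))))

set_option maxHeartbeats 400000 in
/-- If the potential `q` agrees with `q₁` at one end and with `q₂` at the other end of space, up to
terms that are square integrable on slabs, then the essential spectrum of `-Δ - q` consists of
approximate eigenvalues of `-Δ - q₁` or `-Δ - q₂`. -/
theorem IsRelativelyBounded.isApproxEigenvalue_or (hν : ν ≤ 3) (hk : 1 ≤ k)
    {q q₁ q₂ : Space ν → ℝ} (hq : IsRelativelyBounded k q) (L : Space ν →L[ℝ] ℝ) {M₀ : ℝ}
    (h₁ : ∀ x, M₀ < L x → q x = q₁ x) (h₂ : ∀ x, L x < -M₀ → q x = q₂ x)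
    (hW₁ : ∀ M, MemLp ({x | |L x| ≤ M}.indicator fun x => q x - q₁ x) 2 volume)
    (hW₂ : ∀ M, MemLp ({x | |L x| ≤ M}.indicator fun x => q x - q₂ x) 2 volume) {w : ℂ}
    (hw : w ∈ essentialSpectrum (schrodinger q)) :
    IsApproxEigenvalue q₁ w ∨ IsApproxEigenvalue q₂ w := by
  by_contra hn
  push Not at hn
  obtain ⟨c₁, hc₁, hn₁⟩ := not_isApproxEigenvalue_iff.mp hn.1
  obtain ⟨c₂, hc₂, hn₂⟩ := not_isApproxEigenvalue_iff.mp hn.2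
  have hk0 : 0 < k := by linarith
  obtain ⟨h, C, s, hs, hC, hnull, hres, hlow⟩ := hq.exists_singular_sequence hk0 hw
  have hC0 : 0 ≤ C := (norm_nonneg _).trans (hC 0)
  obtain ⟨θ, K, hK, hθ, hθ', hθ0, hθ1⟩ := exists_partition
  -- Each half has three errors of size at most `η`: residual, commutator, change of potential.
  -- Hence its norm is at most `3 * η / c`, and the two halves together must fall below the lower
  -- bound `s`.
  obtain ⟨η, hη, hηs⟩ : ∃ η > 0, 3 * η / c₁ + 3 * η / c₂ < s := by
    refine ⟨s / (4 * (3 / c₁ + 3 / c₂)), by positivity, ?_⟩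
    have : 3 * (s / (4 * (3 / c₁ + 3 / c₂))) / c₁ + 3 * (s / (4 * (3 / c₁ + 3 / c₂))) / c₂ = s / 4 := by
      field_simp
    rw [this]
    linarith
  obtain ⟨δ, hδ, hδL, hδη⟩ : ∃ δ : ℝ, 0 < δ ∧ ‖δ • L‖ ≤ 1 ∧ K * ‖δ • L‖ * (3 * ν * C) ≤ η := by
    set η' := min 1 (η / (K * (3 * ν * C) + 1))
    have hη' : 0 < η' := by positivity
    have hle : ‖(η' / (‖L‖ + 1)) • L‖ ≤ η' := by
      rw [norm_smul, Real.norm_of_nonneg (by positivity), div_mul_eq_mul_div, div_le_iff₀ (by positivity)]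
      exact mul_le_mul_of_nonneg_left (by linarith) hη'.le
    refine ⟨η' / (‖L‖ + 1), by positivity, hle.trans (min_le_left _ _), ?_⟩
    have h3 : η' ≤ η / (K * (3 * ν * C) + 1) := min_le_right _ _
    calc K * ‖(η' / (‖L‖ + 1)) • L‖ * (3 * ν * C)
        = K * (3 * ν * C) * ‖(η' / (‖L‖ + 1)) • L‖ := by ring
      _ ≤ (K * (3 * ν * C) + 1) * (η / (K * (3 * ν * C) + 1)) := by
          gcongr
          · linarith
          · exact hle.trans h3
      _ = η := by field_simp
  -- Outside the slab `|L| ≤ M`, at one end the potentials agree and at the other end the cutoff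
  -- vanishes.
  set M := max M₀ (1 / δ)
  have hχ₁ : IsCutoff (fun x => θ ((δ • L) x)) (K * ‖δ • L‖) := hθ.comp_clm hK hδL
  have hχ₂ : IsCutoff (fun x => 1 - θ ((δ • L) x)) (K * ‖δ • L‖) := hθ'.comp_clm hK hδL
  set χ₁ : Space ν → ℝ := fun x => θ ((δ • L) x)
  set χ₂ : Space ν → ℝ := fun x => 1 - θ ((δ • L) x)
  set W₁ := {x | |L x| ≤ M}.indicator fun x => q x - q₁ x
  set W₂ := {x | |L x| ≤ M}.indicator fun x => q x - q₂ x
  have hM0 : 0 < M := lt_of_lt_of_le (by positivity) (le_max_right M₀ (1 / δ))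
  have hb₁ : ∀ x, |χ₁ x * (q x - q₁ x)| ≤ |W₁ x| := by
    intro x
    by_cases hx : |L x| ≤ M
    · simp only [W₁, Set.indicator_of_mem (show x ∈ {x | |L x| ≤ M} from hx)]
      rw [abs_mul]
      exact mul_le_of_le_one_left (abs_nonneg _) (hχ₁.abs_le_one x)
    · have hz : χ₁ x * (q x - q₁ x) = 0 := by
        rw [not_le, lt_abs] at hx
        rcases hx with hx | hx
        · rw [h₁ x ((le_max_left _ _).trans_lt hx), sub_self, mul_zero]
        · have : χ₁ x = 0 := hθ0 _ (by
            rw [_root_.smul_apply, smul_eq_mul]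
            nlinarith)
          rw [this, zero_mul]
      rw [hz, abs_zero]
      exact abs_nonneg _
  have hb₂ : ∀ x, |χ₂ x * (q x - q₂ x)| ≤ |W₂ x| := by
    intro x
    by_cases hx : |L x| ≤ M
    · simp only [W₂, Set.indicator_of_mem (show x ∈ {x | |L x| ≤ M} from hx)]
      rw [abs_mul]
      exact mul_le_of_le_one_left (abs_nonneg _) (hχ₂.abs_le_one x)
    · have hz : χ₂ x * (q x - q₂ x) = 0 := by
        rw [not_le, lt_abs] at hx
        rcases hx with hx | hx
        · have : θ ((δ • L) x) = 1 := hθ1 _ (by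
            rw [_root_.smul_apply, smul_eq_mul]
            have h3 := (le_max_right M₀ (1 / δ)).trans_lt hx
            rw [div_lt_iff₀ hδ] at h3
            linarith)
          simp only [χ₂, this, sub_self, zero_mul]
        · rw [h₂ x (by linarith [le_max_left M₀ (1 / δ)]), sub_self, mul_zero]
      rw [hz, abs_zero]
      exact abs_nonneg _
  have hsmall : ∀ {W : Space ν → ℝ}, MemLp W 2 volume → ∀ᶠ n in atTop,
      eLpNorm (fun x => (W x : ℂ) * schwartzResolvent k (h n) x) 2 volume < ENNReal.ofReal η := by
    intro W hW
    refine (tendsto_eLpNorm_mul hW (fun n => (schwartzResolvent k (h n)).continuous)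
      (K := resolventNorm ν k * C) (fun n x => ?_)
      fun x => tendsto_schwartzResolvent_apply hν hk hnull x).eventually_lt_const (by simpa using hη)
    exact (norm_schwartzResolvent_le hν hk (h n) x).trans
      (mul_le_mul_of_nonneg_left (hC n) (Real.sqrt_nonneg _))
  have hpart : ∀ {χ W q' : Space ν → ℝ} {c : ℝ}, 0 < c → IsCutoff χ (K * ‖δ • L‖) →
      MemLp W 2 volume → (∀ x, |χ x * (q x - q' x)| ≤ |W x|) →
      (∀ φ : 𝓢(Space ν, ℂ),
        ENNReal.ofReal (c * ‖(φ.toLp 2 volume)‖) ≤ eLpNorm (residual q' w φ) 2 volume) →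
      ∀ᶠ n in atTop,
        ‖((cutoffMul χ (schwartzResolvent k (h n))).toLp 2 volume)‖ ≤ 3 * η / c := by
    intro χ W q' c hc hχ hW hb hlow
    filter_upwards [hsmall hW, hres.eventually_lt_const
      (show (0 : ℝ≥0∞) < ENNReal.ofReal η by simpa using hη)] with n h1 h2
    have h3 := (hlow _).trans (eLpNorm_residual_cutoffMul_le hq.measurable hW.1 (by positivity) hχ hb
      hk w (schwartzResolvent k (h n)))
    rw [schwartzFree_schwartzResolvent hk0] at h3
    have h4 : ENNReal.ofReal (K * ‖δ • L‖ * (3 * ν * ‖((h n).toLp 2 volume)‖)) ≤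
        ENNReal.ofReal η := by
      refine ENNReal.ofReal_le_ofReal (le_trans ?_ hδη)
      gcongr
      exact hC n
    have h5 := h3.trans (add_le_add (add_le_add h2.le h4) h1.le)
    rw [← ENNReal.ofReal_add hη.le hη.le, ← ENNReal.ofReal_add (by positivity) hη.le,
      ENNReal.ofReal_le_ofReal_iff (by positivity)] at h5
    rw [le_div_iff₀ hc]
    linarith
  obtain ⟨n, h1, h2, h3⟩ := (hlow.and ((hpart hc₁ hχ₁ (hW₁ M) hb₁ hn₁).and
    (hpart hc₂ hχ₂ (hW₂ M) hb₂ hn₂))).exists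
  set g := schwartzResolvent k (h n)
  have hsum : g = cutoffMul χ₁ g + cutoffMul χ₂ g := by
    ext x
    rw [_root_.add_apply, cutoffMul_apply hχ₁.growth, cutoffMul_apply hχ₂.growth]
    simp only [χ₁, χ₂]
    push_cast
    ring
  have hsum' : (g.toLp 2 volume) =
      ((cutoffMul χ₁ g).toLp 2 volume) + ((cutoffMul χ₂ g).toLp 2 volume) := by
    conv_lhs => rw [hsum]
    exact map_add (SchwartzMap.toLpCLM ℝ ℂ 2 (volume : Measure (Space ν))) _ _
  rw [hsum'] at h1
  have h4 := norm_add_le ((cutoffMul χ₁ g).toLp 2 volume) ((cutoffMul χ₂ g).toLp 2 volume)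
  linarith

end Localization

/-! ### Approximate eigenvalues at infinity belong to the essential spectrum -/

section Orthogonal

variable {H : Type*} [NormedAddCommGroup H] [InnerProductSpace ℂ H] [CompleteSpace H]
  {T : H →ₗ.[ℂ] H} {z : ℂ} {A : H →L[ℂ] H}

theorem le_norm_sub_of_inner_eq_zero {x y : H} {c : ℝ} (hx : ‖x‖ = c) (h : inner ℂ x y = 0) :
    c ≤ ‖x - y‖ := by
  have h1 := norm_sub_sq (𝕜 := ℂ) x y
  rw [h, map_zero, mul_zero, sub_zero, hx] at h1
  exact (sq_le_sq₀ (hx ▸ norm_nonneg x) (norm_nonneg _)).mp (by nlinarith [sq_nonneg ‖y‖])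

/-- A finite dimensional subspace is not close to infinitely many orthogonal vectors. -/
theorem exists_forall_mem_lt_norm_sub (N : Submodule ℂ H) [FiniteDimensional ℂ N] {c : ℝ}
    (hc : 0 < c) {ψ : ℕ → H} (hψ : ∀ i, ‖ψ i‖ = c) (horth : ∀ i j, i ≠ j → inner ℂ (ψ i) (ψ j) = 0) :
    ∃ i, ∀ n ∈ N, c / 4 < ‖ψ i - n‖ := by
  by_contra hcon
  push Not at hcon
  choose n hn hle using hcon
  have : ProperSpace N := FiniteDimensional.proper ℂ N
  let m : ℕ → N := fun i => ⟨n i, hn i⟩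
  have hbd : ∀ i, m i ∈ Metric.closedBall (0 : N) (5 / 4 * c) := by
    intro i
    rw [mem_closedBall_zero_iff]
    change ‖n i‖ ≤ _
    have := norm_le_norm_add_norm_sub (ψ i) (n i)
    rw [hψ i] at this
    linarith [hle i]
  -- Two approximants `n i`, `n j` in the finite dimensional space are closer than `c / 2`, so `ψ i`
  -- and `ψ j` are closer than `c / 4 + c / 2 + c / 4`; orthogonality forces a distance of at least
  -- `c`.
  obtain ⟨b, -, f, hf, hlim⟩ := tendsto_subseq_of_bounded Metric.isBounded_closedBall hbd
  obtain ⟨i₀, hi₀⟩ := Metric.cauchySeq_iff'.mp hlim.cauchySeq (c / 2) (by positivity)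
  have h1 := hi₀ (i₀ + 1) (Nat.le_succ _)
  set i := f (i₀ + 1)
  set j := f i₀
  have hij : i ≠ j := (hf (Nat.lt_succ_self i₀)).ne'
  have h2 : ‖n i - n j‖ < c / 2 := by
    rw [dist_eq_norm] at h1
    exact h1
  have h3 := le_norm_sub_of_inner_eq_zero (hψ i) (horth i j hij)
  have h4 : ψ i - ψ j = (ψ i - n i) + (n i - n j) - (ψ j - n j) := by abel
  have h5 := norm_sub_le ((ψ i - n i) + (n i - n j)) (ψ j - n j)
  have h6 := norm_add_le (ψ i - n i) (n i - n j)
  rw [← h4] at h5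
  linarith [hle i, hle j]

/-- The converse half of the Weyl criterion. Small residuals rule out a bounded inverse of `T - w`.
Were `w` discrete, all `ψ i` would lie near the finite dimensional eigenspace, which is impossible
for infinitely many orthogonal vectors of equal norm. -/
theorem IsResolventAt.mem_essentialSpectrum (hA : IsResolventAt T z A) (hn : IsStarNormal A) {w : ℂ}
    (h : ∀ ε > 0, ∃ c > 0, ∃ ψ : ℕ → T.domain, (∀ i, ‖(ψ i : H)‖ = c) ∧
      (∀ i j, i ≠ j → inner ℂ (ψ i : H) (ψ j) = 0) ∧
      ∀ i, ‖T (ψ i) - w • (ψ i : H)‖ ≤ ε * c) :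
    w ∈ essentialSpectrum T := by
  constructor
  · rintro ⟨R, -, hR⟩
    obtain ⟨c, hc, ψ, hψ, -, hle⟩ := h (1 / (2 * (‖R‖ + 1))) (by positivity)
    have h1 := R.le_opNorm (T (ψ 0) - w • (ψ 0 : H))
    rw [hR, hψ] at h1
    have h2 := h1.trans (mul_le_mul_of_nonneg_left (hle 0) (norm_nonneg R))
    have h3 : ‖R‖ * (1 / (2 * (‖R‖ + 1)) * c) ≤ 1 / 2 * c := by
      rw [← mul_assoc]
      refine mul_le_mul_of_nonneg_right ?_ hc.le
      rw [mul_one_div, div_le_div_iff₀ (by positivity) (by norm_num)]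
      linarith
    linarith
  · intro hd
    obtain ⟨N, hN, K, hK, hdist⟩ := hA.dist_eigenspace_le hn hd
    obtain ⟨c, hc, ψ, hψ, horth, hle⟩ := h (1 / (4 * (K + 1))) (by positivity)
    obtain ⟨i, hi⟩ := exists_forall_mem_lt_norm_sub N hc hψ horth
    obtain ⟨n, hn, h1⟩ := hdist (ψ i)
    have h2 := h1.trans (mul_le_mul_of_nonneg_left (hle i) hK)
    have h3 : K * (1 / (4 * (K + 1)) * c) ≤ 1 / 4 * c := by
      rw [← mul_assoc]
      refine mul_le_mul_of_nonneg_right ?_ hc.le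
      rw [mul_one_div, div_le_div_iff₀ (by positivity) (by norm_num)]
      linarith
    linarith [hi n hn]

end Orthogonal

/-! ### Localized approximate eigenfunctions and their translates towards an end. -/

section Ends

variable {ν : ℕ} {k : ℝ}

-- Slowly varying cutoffs in the variable `L` lose little norm and create small commutators. Bounded
-- `L`-support is what later makes translates disjoint.
set_option maxHeartbeats 400000 in
theorem IsApproxEigenvalue.exists_localized {q : Space ν → ℝ} (hq : AEStronglyMeasurable q volume)
    {w : ℂ} (h : IsApproxEigenvalue q w) (L : Space ν →L[ℝ] ℝ) {ε : ℝ} (hε : 0 < ε) :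
    ∃ (φ : 𝓢(Space ν, ℂ)) (M : ℝ), 0 ≤ M ∧ φ ≠ 0 ∧ (∀ x, M < |L x| → φ x = 0) ∧
      eLpNorm (residual q w φ) 2 volume ≤ ENNReal.ofReal (ε * ‖(φ.toLp 2 volume)‖) := by
  -- Residual and commutator contribute `ε / 4` each, relative to the norm of `φ`; the cut-off
  -- function keeps half of that norm, so the relative error is at most `ε`.
  obtain ⟨φ, hφ, hres⟩ := h (ε / 4) (by positivity)
  obtain ⟨b, K, hK, hb, hb1, hbs⟩ := exists_ball_cutoff (E := ℝ) one_pos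
  have hpos : 0 < ‖(φ.toLp 2 volume)‖ := norm_toLp_pos hφ
  set m := ‖(φ.toLp 2 volume)‖
  let δ : ℕ → ℝ := fun n => 1 / ((n : ℝ) + 1) / (‖L‖ + 1)
  have hδ0 : ∀ n, 0 < δ n := fun n => by positivity
  have hδlim : Tendsto δ atTop (nhds 0) := by
    have := (tendsto_one_div_add_atTop_nhds_zero_nat (𝕜 := ℝ)).div_const (‖L‖ + 1)
    rwa [zero_div] at this
  have hδL : ∀ n, ‖δ n • L‖ ≤ 1 / ((n : ℝ) + 1) := by
    intro n
    rw [norm_smul, Real.norm_of_nonneg (hδ0 n).le, div_mul_eq_mul_div,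
      div_le_iff₀ (by positivity)]
    exact mul_le_mul_of_nonneg_left (by linarith) (by positivity)
  have hδL1 : ∀ n, ‖δ n • L‖ ≤ 1 := fun n => (hδL n).trans (by
    rw [div_le_one (by positivity)]
    linarith [(Nat.cast_nonneg n : (0 : ℝ) ≤ n)])
  let χ : ℕ → Space ν → ℝ := fun n x => b ((δ n • L) x)
  have hχ : ∀ n, IsCutoff (χ n) (K * ‖δ n • L‖) := fun n => hb.comp_clm hK (hδL1 n)
  have hclose : Tendsto (fun n => eLpNorm (fun x => ((‖φ x‖ : ℝ) : ℂ) * ((1 - χ n x : ℝ) : ℂ)) 2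
      volume) atTop (nhds 0) := by
    refine tendsto_eLpNorm_mul (φ.memLp 2 volume).norm (fun n => ?_) (K := 2) (fun n x => ?_)
      fun x => ?_
    · exact Complex.continuous_ofReal.comp (continuous_const.sub (hχ n).growth.1.continuous)
    · rw [Complex.norm_real, Real.norm_eq_abs]
      have := abs_le.mp ((hχ n).abs_le_one x)
      exact abs_le.mpr ⟨by linarith, by linarith⟩
    · have h1 : Tendsto (fun n => (δ n • L) x) atTop (nhds 0) := by
        have := hδlim.mul_const (L x)
        rwa [zero_mul] at this
      refine tendsto_const_nhds.congr' ?_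
      filter_upwards [h1 (Metric.ball_mem_nhds 0 one_pos)] with n hn
      have : χ n x = 1 := hb1 _ hn
      rw [this]
      simp
  have hcomm : Tendsto (fun n => K * ‖δ n • L‖ *
      (3 * ν * ‖((schwartzFree 1 φ).toLp 2 volume)‖)) atTop (nhds 0) := by
    have h1 : Tendsto (fun n => ‖δ n • L‖) atTop (nhds 0) :=
      squeeze_zero (fun n => norm_nonneg _) hδL tendsto_one_div_add_atTop_nhds_zero_nat
    have := (h1.const_mul K).mul_const (3 * ν * ‖((schwartzFree 1 φ).toLp 2 volume)‖)
    rwa [mul_zero, zero_mul] at this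
  obtain ⟨n, hn1, hn2⟩ := ((hclose.eventually_lt_const
    (show (0 : ℝ≥0∞) < ENNReal.ofReal (m / 2) by simpa using hpos)).and
    (hcomm.eventually_lt_const (show 0 < ε / 4 * m by positivity))).exists
  have hhalf : m / 2 ≤ ‖((cutoffMul (χ n) φ).toLp 2 volume)‖ := by
    have h1 : eLpNorm (fun x => φ x - cutoffMul (χ n) φ x) 2 volume ≤ ENNReal.ofReal (m / 2) := by
      refine le_trans (eLpNorm_mono fun x => le_of_eq ?_) hn1.le
      rw [cutoffMul_apply (hχ n).growth, norm_mul, Complex.norm_real, norm_norm, mul_comm ‖φ x‖,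
        ← norm_mul]
      congr 1
      push_cast
      ring
    have h2 : eLpNorm φ 2 volume ≤ eLpNorm (fun x => φ x - cutoffMul (χ n) φ x) 2 volume +
        eLpNorm (cutoffMul (χ n) φ) 2 volume := by
      have := eLpNorm_add_le (p := 2) (μ := (volume : Measure (Space ν)))
        (f := fun x => φ x - cutoffMul (χ n) φ x) (g := cutoffMul (χ n) φ)
        (φ.continuous.sub (cutoffMul (χ n) φ).continuous).aestronglyMeasurable
        (cutoffMul (χ n) φ).continuous.aestronglyMeasurable (by norm_num)
      refine le_trans (le_of_eq ?_) this
      congr 1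
      ext x
      simp
    have h3 := h2.trans (add_le_add h1 le_rfl)
    rw [eLpNorm_toLp, eLpNorm_toLp, ← ENNReal.ofReal_add (by positivity) (norm_nonneg _),
      ENNReal.ofReal_le_ofReal_iff (by positivity)] at h3
    linarith
  refine ⟨cutoffMul (χ n) φ, 2 / δ n, by have := hδ0 n; positivity, ?_, fun x hx => ?_, ?_⟩
  · intro h0
    rw [h0] at hhalf
    rw [toLp_zero, norm_zero] at hhalf
    linarith
  · rw [cutoffMul_apply (hχ n).growth]
    have h1 : χ n x = 0 := by
      by_contra hne
      have := hbs (subset_tsupport b (Function.mem_support.mpr hne))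
      rw [mem_closedBall_zero_iff, Real.norm_eq_abs, _root_.smul_apply, smul_eq_mul, abs_mul,
        abs_of_pos (hδ0 n)] at this
      rw [div_lt_iff₀ (hδ0 n)] at hx
      linarith
    rw [h1]
    simp
  · have h1 := eLpNorm_residual_cutoffMul_le (q := q) (q' := q) (W := fun _ => 0) hq
      aestronglyMeasurable_const (by positivity) (hχ n) (fun x => by simp) le_rfl w φ
    have h2 : eLpNorm (fun x => (((0 : ℝ)) : ℂ) * φ x) 2 volume = 0 := by simp
    rw [h2, add_zero] at h1
    refine h1.trans ((add_le_add hres (ENNReal.ofReal_le_ofReal hn2.le)).trans ?_)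
    rw [← ENNReal.ofReal_add (by positivity) (by positivity)]
    refine ENNReal.ofReal_le_ofReal ?_
    have := mul_le_mul_of_nonneg_left hhalf hε.le
    linarith

theorem IsRelativelyBounded.exists_domain {q : Space ν → ℝ} (hq : IsRelativelyBounded k q)
    (hk : 0 < k) (w : ℂ) (φ : 𝓢(Space ν, ℂ)) : ∃ ψ : (schrodinger q).domain,
      (ψ : L2 ν) = φ.toLp 2 ∧
      ENNReal.ofReal ‖schrodinger q ψ - w • (ψ : L2 ν)‖ = eLpNorm (residual q w φ) 2 volume := by
  obtain ⟨hd, h1⟩ := hq.exists_sub_smul_eq_shifted hk w ((schwartzFree k φ).toLp 2)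
  have h2 := hq.eLpNorm_residual hk w (schwartzFree k φ)
  rw [schwartzResolvent_schwartzFree hk] at h2
  have h3 : freeResolvent ν hk ((schwartzFree k φ).toLp 2) = φ.toLp 2 := by
    rw [freeResolvent_toLp, schwartzResolvent_schwartzFree hk]
  exact ⟨⟨_, hd⟩, h3, (congrArg (fun u => ENNReal.ofReal ‖u‖) h1).trans h2.symm⟩

theorem inner_toLp_eq_zero {φ ψ : 𝓢(Space ν, ℂ)} (h : ∀ x, φ x = 0 ∨ ψ x = 0) :
    inner ℂ (φ.toLp 2 volume) (ψ.toLp 2 volume) = 0 := by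
  rw [L2.inner_def]
  refine integral_eq_zero_of_ae ?_
  filter_upwards [SchwartzMap.coeFn_toLp φ 2 volume, SchwartzMap.coeFn_toLp ψ 2 volume]
    with x h1 h2
  rw [h1, h2]
  rcases h x with h | h <;> rw [h] <;> simp

theorem IsRelativelyBounded.mem_essentialSpectrum_of_sequence (hk : 0 < k) {q : Space ν → ℝ}
    (hq : IsRelativelyBounded k q) {w : ℂ}
    (h : ∀ ε > 0, ∃ c > 0, ∃ Φ : ℕ → 𝓢(Space ν, ℂ), (∀ i, ‖((Φ i).toLp 2 volume)‖ = c) ∧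
      (∀ i j, i ≠ j → ∀ x, Φ i x = 0 ∨ Φ j x = 0) ∧
      ∀ i, eLpNorm (residual q w (Φ i)) 2 volume ≤ ENNReal.ofReal (ε * c)) :
    w ∈ essentialSpectrum (schrodinger q) := by
  refine (hq.isResolventAt hk).mem_essentialSpectrum (hq.isStarNormal_resolvent hk) fun ε hε => ?_
  obtain ⟨c, hc, Φ, h1, h2, h3⟩ := h ε hε
  have hex := fun i => hq.exists_domain hk w (Φ i)
  refine ⟨c, hc, fun i => (hex i).choose, fun i => ?_, fun i j hij => ?_, fun i => ?_⟩
  · exact (congrArg norm (hex i).choose_spec.1).trans (h1 i)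
  · have e := inner_toLp_eq_zero (h2 i j hij)
    rwa [← (hex i).choose_spec.1, ← (hex j).choose_spec.1] at e
  · have e := (hex i).choose_spec.2.le.trans (h3 i)
    exact (ENNReal.ofReal_le_ofReal_iff (by positivity)).mp e

/-- If `q` agrees at one end of space with a potential `q₁` that is periodic in a direction pointing
to this end, then the approximate eigenvalues of `-Δ - q₁` belong to the essential spectrum of
`-Δ - q`. -/
theorem IsRelativelyBounded.mem_essentialSpectrum (hk : 0 < k) {q q₁ : Space ν → ℝ}
    (hq : IsRelativelyBounded k q) (hq₁ : AEStronglyMeasurable q₁ volume) (L : Space ν →L[ℝ] ℝ)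
    {M₀ : ℝ} (h₁ : ∀ x, M₀ < L x → q x = q₁ x) {t : Space ν} (ht : 0 < L t)
    (hper : ∀ (n : ℕ) x, q₁ (x - (n : ℝ) • t) = q₁ x) {w : ℂ} (h : IsApproxEigenvalue q₁ w) :
    w ∈ essentialSpectrum (schrodinger q) := by
  refine hq.mem_essentialSpectrum_of_sequence hk fun ε hε => ?_
  obtain ⟨φ, M, hM, hφ, hsupp, hres⟩ := h.exists_localized hq₁ L hε
  have hpos : 0 < ‖(φ.toLp 2 volume)‖ := norm_toLp_pos hφ
  -- One step of `m` periods raises `L` by more than `2 * M + |M₀|`: the supports become disjoint,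
  -- and already the first translate (hence `i + 1` in `s`) lies in `L > M₀`.
  obtain ⟨m, hm⟩ := exists_nat_gt ((2 * M + |M₀|) / L t)
  rw [div_lt_iff₀ ht] at hm
  let s : ℕ → ℕ := fun i => (i + 1) * m
  let Φ : ℕ → 𝓢(Space ν, ℂ) := fun i =>
    compIsometry (LinearIsometryEquiv.refl ℝ (Space ν)) ((s i : ℝ) • t) φ
  have hΦ : ∀ i x, Φ i x = φ (x - (s i : ℝ) • t) := fun i x => rfl
  have hΦsupp : ∀ i x, Φ i x ≠ 0 → |L x - ((i : ℝ) + 1) * (m * L t)| ≤ M := by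
    intro i x hx
    by_contra hlt
    push Not at hlt
    refine hx ?_
    rw [hΦ]
    refine hsupp _ (lt_of_lt_of_eq hlt ?_)
    rw [map_sub, map_smul, smul_eq_mul]
    simp only [s]
    push_cast
    ring_nf
  have hM₀ : M₀ ≤ |M₀| := le_abs_self _
  have hM₀' : 0 ≤ |M₀| := abs_nonneg _
  have hΦres : ∀ i, eLpNorm (residual q w (Φ i)) 2 volume =
      eLpNorm (residual q₁ w φ) 2 volume := by
    intro i
    rw [← eLpNorm_residual_compIsometry hq₁ w (LinearIsometryEquiv.refl ℝ (Space ν))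
      ((s i : ℝ) • t) φ]
    congr 1
    ext x
    change residual q w (Φ i) x = residual _ w (Φ i) x
    have h3 : q₁ ((LinearIsometryEquiv.refl ℝ (Space ν)) (x - (s i : ℝ) • t)) = q₁ x :=
      hper (s i) x
    rw [residual, residual, h3]
    by_cases hx : Φ i x = 0
    · rw [hx, mul_zero, mul_zero, mul_zero]
    · have h2 := (abs_le.mp (hΦsupp i x hx)).1
      rw [h₁ x]
      have : (0 : ℝ) ≤ i * (m * L t) := by positivity
      nlinarith
  have hΦnorm : ∀ i, ‖((Φ i).toLp 2 volume)‖ = ‖(φ.toLp 2 volume)‖ := fun i =>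
    norm_toLp_compIsometry (LinearIsometryEquiv.refl ℝ (Space ν)) ((s i : ℝ) • t) φ
  have hΦle : ∀ i, eLpNorm (residual q w (Φ i)) 2 volume ≤
      ENNReal.ofReal (ε * ‖(φ.toLp 2 volume)‖) := fun i => (hΦres i).le.trans hres
  refine ⟨‖(φ.toLp 2 volume)‖, hpos, Φ, hΦnorm, fun i j hij x => ?_, hΦle⟩
  by_contra hcon
  push Not at hcon
  have e1 := abs_le.mp (hΦsupp i x hcon.1)
  have e2 := abs_le.mp (hΦsupp j x hcon.2)
  have hD : 2 * M < m * L t := by linarith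
  rcases lt_or_gt_of_ne hij with hlt | hlt
  · have : (i : ℝ) + 1 ≤ j := by exact_mod_cast hlt
    nlinarith
  · have : (j : ℝ) + 1 ≤ i := by exact_mod_cast hlt
    nlinarith

end Ends

/-! ### Chains with straight ends -/

section Chains

variable {ν : ℕ} {V : ℝ → ℝ} {ρ : ℝ}

theorem well_eq_zero_of_lt (L : Space ν →L[ℝ] ℝ) {x y : Space ν} (h : L y + ‖L‖ * ρ < L x) :
    well V ρ y x = 0 := by
  refine Set.indicator_of_notMem (fun hx => ?_) _
  have h1 := L.le_opNorm (x - y)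
  rw [Metric.mem_ball, dist_eq_norm] at hx
  have h2 := le_abs_self (L (x - y))
  rw [map_sub] at h1 h2
  rw [Real.norm_eq_abs] at h1
  have h3 := mul_le_mul_of_nonneg_left hx.le (norm_nonneg L)
  linarith

/-- Centres where the arrays differ have `L` bounded above, as all but finitely many lie in `L ≤ 0`.
A ball of radius `ρ` extends this bound by `‖L‖ * ρ`. -/
theorem exists_forall_lt_arrayPotential_eq {Y Z : ℤ → Space ν} (L : Space ν →L[ℝ] ℝ)
    (h : ∀ᶠ i in cofinite, Y i = Z i ∨ (L (Y i) ≤ 0 ∧ L (Z i) ≤ 0)) :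
    ∃ M, ∀ x, M < L x → arrayPotential V ρ Y x = arrayPotential V ρ Z x := by
  rw [eventually_cofinite] at h
  obtain ⟨C, hC⟩ := (h.image fun i => max (L (Y i)) (L (Z i))).bddAbove
  refine ⟨max C 0 + ‖L‖ * ρ, fun x hx => tsum_congr fun i => ?_⟩
  by_cases hi : Y i = Z i
  · rw [hi]
  · have hle : L (Y i) ≤ max C 0 ∧ L (Z i) ≤ max C 0 := by
      by_cases h0 : L (Y i) ≤ 0 ∧ L (Z i) ≤ 0
      · exact ⟨h0.1.trans (le_max_right _ _), h0.2.trans (le_max_right _ _)⟩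
      · have := hC (Set.mem_image_of_mem _ (show i ∈ {i | ¬(Y i = Z i ∨ _)} from
          fun hor => hor.elim hi h0))
        have := max_le_iff.mp this
        exact ⟨this.1.trans (le_max_left _ _), this.2.trans (le_max_left _ _)⟩
    rw [well_eq_zero_of_lt L (by linarith [hle.1]), well_eq_zero_of_lt L (by linarith [hle.2])]

/-- Away from infinity in the direction of `L`, only finitely many wells contribute. -/
theorem memLp_indicator_arrayPotential (hν : 1 ≤ ν)
    (hV : MemLp V 2 (volume.restrict (Set.Ioo 0 ρ))) {Y : ℤ → Space ν} (L : Space ν →L[ℝ] ℝ)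
    (hfin : Tendsto (fun i => |L (Y i)|) cofinite atTop) (M : ℝ) :
    MemLp ({x | |L x| ≤ M}.indicator (arrayPotential V ρ Y)) 2 volume := by
  have h1 := hfin.eventually_gt_atTop (M + ‖L‖ * ρ)
  rw [eventually_cofinite] at h1
  have hS : MeasurableSet {x : Space ν | |L x| ≤ M} :=
    (isClosed_le (by fun_prop) continuous_const).measurableSet
  have h2 : MemLp ({x : Space ν | |L x| ≤ M}.indicator
      fun x => ∑ i ∈ h1.toFinset, well V ρ (Y i) x) 2 volume :=
    (memLp_finsetSum _ fun i _ => memLp_well hν hV (Y i)).indicator hS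
  convert h2 using 1
  refine Set.indicator_congr fun x hx => ?_
  refine tsum_eq_sum fun i hi => ?_
  rw [Set.Finite.mem_toFinset, Set.mem_ofPred_eq, not_not] at hi
  have hx' := abs_le.mp (show |L x| ≤ M from hx)
  rcases lt_abs.mp hi with h | h
  · refine well_eq_zero_of_lt (-L) ?_
    rw [norm_neg, _root_.neg_apply, _root_.neg_apply]
    linarith
  · exact well_eq_zero_of_lt L (by linarith)

theorem tendsto_lineChain_atTop (L : Space ν →L[ℝ] ℝ) {p u : Space ν} {a : ℝ} (ha : 0 < a)
    (hu : 0 < L u) : Tendsto (fun i => L (lineChain p u a i)) atTop atTop := by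
  simp only [lineChain, map_add, map_smul, smul_eq_mul]
  exact tendsto_atTop_add_const_left _ _
    (((tendsto_intCast_atTop_atTop (R := ℝ)).atTop_mul_const ha).atTop_mul_const hu)

theorem tendsto_lineChain_atBot (L : Space ν →L[ℝ] ℝ) {p u : Space ν} {a : ℝ} (ha : 0 < a)
    (hu : 0 < L u) : Tendsto (fun i => L (lineChain p u a i)) atBot atBot := by
  simp only [lineChain, map_add, map_smul, smul_eq_mul]
  exact tendsto_atBot_add_const_left _ _
    (((tendsto_intCast_atBot_iff.mpr tendsto_id).atBot_mul_const ha).atBot_mul_const hu)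

theorem tendsto_abs_cofinite {f : ℤ → ℝ} (h1 : Tendsto f atTop atTop) (h2 : Tendsto f atBot atBot) :
    Tendsto (fun i => |f i|) cofinite atTop := by
  rw [Int.cofinite_eq]
  exact (tendsto_abs_atBot_atTop.comp h2).sup (tendsto_abs_atTop_atTop.comp h1)

/-- The essential spectrum of a chain with two straight ends that do not point in the same direction
is the set of approximate eigenvalues of a straight chain. -/
theorem essentialSpectrum_chainOperator (hν1 : 1 ≤ ν) (hν : ν ≤ 3) (hρ : 0 < ρ)
    (hV : MemLp V 2 (volume.restrict (Set.Ioo 0 ρ))) {a : ℝ} (ha : 2 * ρ ≤ a) {Y : ℤ → Space ν}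
    (hY : ∀ i j, i ≠ j → 2 * ρ ≤ dist (Y i) (Y j)) {p q u v : Space ν} (hu : ‖u‖ = 1)
    (hv : ‖v‖ = 1) (huv : u + v ≠ 0) (htop : ∀ᶠ i in atTop, Y i = lineChain p u a i)
    (hbot : ∀ᶠ i in atBot, Y i = lineChain q v a i) (p' : Space ν) {e : Space ν} (he : ‖e‖ = 1) :
    essentialSpectrum (chainOperator V ρ Y) =
      {w | IsApproxEigenvalue (arrayPotential V ρ (lineChain p' e a)) w} := by
  have ha0 : 0 < a := by linarith
  obtain ⟨k, hk, hrel⟩ := exists_isRelativelyBounded hν1 hν hρ hV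
  have hk0 : 0 < k := by linarith
  have hq := hrel Y hY
  have hline : ∀ (r : Space ν) {d : Space ν}, ‖d‖ = 1 →
      IsRelativelyBounded k (arrayPotential V ρ (lineChain r d a)) :=
    fun r d hd => hrel _ (le_dist_lineChain hd ha)
  -- For unit vectors, `L u = L v = 1 + ⟨u, v⟩ = ‖u + v‖² / 2 > 0`.
  let L : Space ν →L[ℝ] ℝ := innerSL ℝ (u + v)
  have hγ : 0 < 1 + inner ℝ u v := by
    have h1 := norm_add_sq_real u v
    have h2 : 0 < ‖u + v‖ ^ 2 := by
      have := norm_pos_iff.mpr huv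
      positivity
    rw [hu, hv] at h1
    linarith
  have hLu : 0 < L u := by
    have : L u = 1 + inner ℝ u v := by
      change inner ℝ (u + v) u = _
      rw [inner_add_left, real_inner_self_eq_norm_sq, hu, real_inner_comm]
      norm_num
    rwa [this]
  have hLv : 0 < L v := by
    have : L v = 1 + inner ℝ u v := by
      change inner ℝ (u + v) v = _
      rw [inner_add_left, real_inner_self_eq_norm_sq, hv, add_comm]
      norm_num
    rwa [this]
  have hYtop : Tendsto (fun i => L (Y i)) atTop atTop :=
    (tendsto_lineChain_atTop L (p := p) ha0 hLu).congr' (htop.mono fun i hi => congrArg L hi.symm)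
  have hYbot : Tendsto (fun i => L (Y i)) atBot atBot :=
    (tendsto_lineChain_atBot L (p := q) ha0 hLv).congr' (hbot.mono fun i hi => congrArg L hi.symm)
  obtain ⟨M₁, hM₁⟩ := exists_forall_lt_arrayPotential_eq (V := V) (ρ := ρ) (Y := Y)
    (Z := lineChain p u a) L (by
      rw [Int.cofinite_eq]
      refine eventually_sup.mpr ⟨?_, htop.mono fun i => Or.inl⟩
      -- At the far end the chain and the straight line need not agree, but both lie in `L ≤ 0`.
      filter_upwards [hYbot.eventually_le_atBot 0,
        (tendsto_lineChain_atBot L (p := p) ha0 hLu).eventually_le_atBot 0] with i h1 h2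
      exact Or.inr ⟨h1, h2⟩)
  obtain ⟨M₂, hM₂⟩ := exists_forall_lt_arrayPotential_eq (V := V) (ρ := ρ) (Y := Y)
    (Z := lineChain q v a) (-L) (by
      rw [Int.cofinite_eq]
      refine eventually_sup.mpr ⟨hbot.mono fun i => Or.inl, ?_⟩
      filter_upwards [hYtop.eventually_ge_atTop 0,
        (tendsto_lineChain_atTop L (p := q) ha0 hLv).eventually_ge_atTop 0] with i h1 h2
      exact Or.inr ⟨neg_nonpos.mpr h1, neg_nonpos.mpr h2⟩)
  have hmem := fun M => memLp_indicator_arrayPotential (V := V) (ρ := ρ) hν1 hV L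
    (tendsto_abs_cofinite hYtop hYbot) M
  have hmem' : ∀ (r : Space ν) {d : Space ν}, 0 < L d → ∀ M,
      MemLp ({x | |L x| ≤ M}.indicator fun x => arrayPotential V ρ Y x -
        arrayPotential V ρ (lineChain r d a) x) 2 volume := by
    intro r d hd M
    have h1 := (hmem M).sub (memLp_indicator_arrayPotential (V := V) (ρ := ρ) hν1 hV L
      (tendsto_abs_cofinite (tendsto_lineChain_atTop L (p := r) ha0 hd)
        (tendsto_lineChain_atBot L (p := r) ha0 hd)) M)
    rwa [← Set.indicator_sub'] at h1
  ext w
  constructor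
  · intro hw
    rcases hq.isApproxEigenvalue_or hν hk L (M₀ := max M₁ M₂)
      (fun x hx => hM₁ x ((le_max_left _ _).trans_lt hx))
      (fun x hx => hM₂ x (by
        rw [_root_.neg_apply]
        linarith [le_max_right M₁ M₂])) (hmem' p hLu) (hmem' q hLv) hw with h | h
    · exact h.lineChain hu he (hline p hu).measurable
    · exact h.lineChain hv he (hline q hv).measurable
  · intro hw
    -- One end suffices here: the translates are sent along `u`.
    refine hq.mem_essentialSpectrum hk0 (hline p hu).measurable L hM₁ (t := a • u) ?_ ?_
      (IsApproxEigenvalue.lineChain he hu (hline p' he).measurable hw)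
    · rw [map_smul, smul_eq_mul]
      positivity
    · intro n x
      rw [smul_smul]
      exact arrayPotential_lineChain_sub V ρ a p u x n

end Chains

/-! ### From the curve to the directions of its straight ends. -/

section Curves

variable {ν : ℕ} {Γ : ℝ → Space ν}

/-- An interval contains a parameter off the finitely many break points, where the derivative is
`u`. -/
theorem IsUnitSpeedPiecewiseC1.norm_eq_one (hΓ : IsUnitSpeedPiecewiseC1 Γ) {p u : Space ν} {b c : ℝ}
    (hbc : b < c) (h : ∀ s ∈ Set.Ioo b c, Γ s = p + s • u) : ‖u‖ = 1 := by
  obtain ⟨-, F, hF, -, hspeed⟩ := hΓ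
  obtain ⟨s, hs, hsF⟩ := ((Set.Ioo_infinite hbc).sdiff (hF b c)).nonempty
  have hsF' : s ∉ F := fun hs' => hsF ⟨hs', Set.Ioo_subset_Icc_self hs⟩
  have hd : HasDerivAt (fun s : ℝ => p + s • u) u s := by
    simpa using ((hasDerivAt_id s).smul_const u).const_add p
  have he : Γ =ᶠ[nhds s] fun s => p + s • u := by
    filter_upwards [isOpen_Ioo.mem_nhds hs] with t ht
    exact h t ht
  have h1 := hspeed s hsF'
  rwa [he.deriv_eq, hd.deriv] at h1

/-- For large `s` the difference `Γ s - Γ (-s)` is `(p - q) + s • (u + v)`, which would stay bounded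
if `u + v = 0`. -/
theorem add_ne_zero_of_tendsto {p q u v : Space ν} {S : ℝ} (h1 : ∀ s, S ≤ s → Γ s = p + s • u)
    (h2 : ∀ s, s ≤ -S → Γ s = q + s • v)
    (hdiv : Tendsto (fun s : ℝ => ‖Γ s - Γ (-s)‖) (cocompact ℝ) atTop) : u + v ≠ 0 := by
  intro h0
  have h3 := (hdiv.mono_left atTop_le_cocompact).eventually_gt_atTop ‖p - q‖
  obtain ⟨s, hs, hS⟩ := (h3.and (eventually_ge_atTop S)).exists
  have h4 : Γ s - Γ (-s) = (p - q) + s • (u + v) := by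
    rw [h1 s hS, h2 (-s) (neg_le_neg hS), smul_add, neg_smul]
    abel
  rw [h4, h0, smul_zero, add_zero] at hs
  exact lt_irrefl _ hs

theorem chainPoints_lineCurve (p e : Space ν) (a : ℝ) :
    chainPoints (lineCurve p e) a = lineChain p e a := rfl

end Curves

end BentChain

end

theorem proposition3p2 (ν : ℕ) (hν : ν = 2 ∨ ν = 3)
    (ρ : ℝ) (hρ : 0 < ρ)
    (V : ℝ → ℝ) (hV : MeasureTheory.MemLp V 2 (MeasureTheory.volume.restrict (Set.Ioo 0 ρ)))
    (a : ℝ) (ha : 2 * ρ ≤ a)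
    (Γ : ℝ → BentChain.Space ν)
    (hΓ : BentChain.IsUnitSpeedPiecewiseC1 Γ)
    (hdisj : ∀ i j : ℤ, i ≠ j →
      2 * ρ ≤ dist (BentChain.chainPoints Γ a i) (BentChain.chainPoints Γ a j))
    (hstraight : BentChain.IsStraightOutsideCompact Γ)
    (hdiv : Filter.Tendsto (fun s : ℝ => ‖Γ s - Γ (-s)‖) (Filter.cocompact ℝ) Filter.atTop)
    (p e : BentChain.Space ν) (he : ‖e‖ = 1) :
    BentChain.essentialSpectrum
        (BentChain.chainOperator V ρ (BentChain.chainPoints Γ a)) =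
      BentChain.essentialSpectrum
        (BentChain.chainOperator V ρ (BentChain.chainPoints (BentChain.lineCurve p e) a)) := by
  have ha0 : 0 < a := by linarith
  have hν1 : 1 ≤ ν := by omega
  have hν3 : ν ≤ 3 := by omega
  obtain ⟨S, p', q', u, v, h1, h2⟩ := hstraight
  have hu : ‖u‖ = 1 := hΓ.norm_eq_one (lt_add_one S) fun s hs => h1 s hs.1.le
  have hv : ‖v‖ = 1 := hΓ.norm_eq_one (sub_one_lt (-S)) fun s hs => h2 s hs.2.le
  have htop : ∀ᶠ i : ℤ in atTop, BentChain.chainPoints Γ a i = BentChain.lineChain p' u a i := by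
    filter_upwards [((tendsto_intCast_atTop_atTop (R := ℝ)).atTop_mul_const ha0).eventually_ge_atTop
      S] with i hi
    exact h1 _ hi
  have hbot : ∀ᶠ i : ℤ in atBot, BentChain.chainPoints Γ a i = BentChain.lineChain q' v a i := by
    filter_upwards [((tendsto_intCast_atBot_iff.mpr tendsto_id).atBot_mul_const ha0).eventually_le_atBot
      (-S)] with i hi
    exact h2 _ hi
  -- Both sides become the set of approximate eigenvalues of the same line. For the straight chain
  -- both end directions are `e`, and `e + e ≠ 0` remains to be checked.
  rw [BentChain.essentialSpectrum_chainOperator hν1 hν3 hρ hV ha hdisj hu hv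
      (BentChain.add_ne_zero_of_tendsto h1 h2 hdiv) htop hbot p he,
    BentChain.chainPoints_lineCurve,
    BentChain.essentialSpectrum_chainOperator hν1 hν3 hρ hV ha (BentChain.le_dist_lineChain he ha)
      (p := p) (q := p) he he (fun h0 => ?_) (Eventually.of_forall fun _ => rfl)
      (Eventually.of_forall fun _ => rfl) p he]
  rw [← two_smul ℝ e] at h0
  have h3 := (smul_eq_zero.mp h0).resolve_left two_ne_zero
  rw [h3, norm_zero] at he
  exact zero_ne_one he
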